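/- **Language.** The types are $A ::= \mathtt{nat}\mid\mathtt{comm}\mid\mathtt{var}\mid A\multimap A$. The terms of $SCI_{\mathtt{mk}}$ (Syntactic Control of Interference extended with the bad-variable constructor $\mathtt{mkvar}$), taken up to $\alpha$-equivalence, are $$M ::= n \mid M\odot M \mid \mathtt{skip}\mid M;M\mid M:=M\mid\, !M\mid \mathtt{while}\,M\,\mathtt{do}\,M\mid \mathtt{ifzero}\,M\,M\,M\mid x\mid\lambda x^A.M\mid MM\mid \mathtt{new}\,x\,\mathtt{in}\,M\mid\mathtt{mkvar}\,M\,M,$$ where $n\in\mathbb N$ and $\odot$ ranges over addition, truncated subtraction, and an arbitrary family of further total binary operations on $\mathbb N$. Contexts are lists $x_1:A_1,\dots,x_n:A_n$ with distinct identifiers. Typing judgments $\Gamma\vdash M:A$ are derived by the rules: $x:A\vdash x:A$; from $\Gamma,x:A\vdash M:B$ infer $\Gamma\vdash\lambda x^A.M:A\multimap B$; from $\Gamma\vdash M:A\multimap B$ and $\Delta\vdash N:A$, with no identifier common to $\Gamma$ and $\Delta$, infer $\Gamma,\Delta\vdash MN:B$; weakening and exchange; $\vdash n:\mathtt{nat}$;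 $\vdash\mathtt{skip}:\mathtt{comm}$; and the following, in which all premises and the conclusion have the same context $\Gamma$: $M\odot N:\mathtt{nat}$ if $M,N:\mathtt{nat}$; $M;N:B$ if $M:\mathtt{comm}$, $N:B$, with $B\in\{\mathtt{comm},\mathtt{nat},\mathtt{var}\}$; $M:=N:\mathtt{comm}$ if $M:\mathtt{var}$, $N:\mathtt{nat}$; $!M:\mathtt{nat}$ if $M:\mathtt{var}$; $\mathtt{while}\,M\,\mathtt{do}\,N:\mathtt{comm}$ if $M:\mathtt{nat}$, $N:\mathtt{comm}$; $\mathtt{ifzero}\,M\,N_1\,N_2:B$ if $M:\mathtt{nat}$, $N_1,N_2:B$, with $B\in\{\mathtt{comm},\mathtt{nat},\mathtt{var}\}$; $\mathtt{mkvar}\,M\,N:\mathtt{var}$ if $M:\mathtt{nat}\multimap\mathtt{comm}$, $N:\mathtt{nat}$; finally, from $\Gamma,x:\mathtt{var}\vdash M:B$ with $B\in\{\mathtt{comm},\mathtt{nat}\}$ infer $\Gamma\vdash\mathtt{new}\,x\,\mathtt{in}\,M:B$. **Evaluation.** Values are numerals, $\mathtt{skip}$, identifiers, abstractions and terms $\mathtt{mkvar}\,M\,N$.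 Big-step evaluation $\sigma,M\Downarrow\sigma',V$, where the stores $\sigma,\sigma'$ assign natural numbers to finitely many identifiers, is defined inductively. Values evaluate to themselves with the store unchanged; the store is otherwise threaded through the evaluations in the order listed. $MN$: evaluate $M$ to $\lambda x^A.M'$, then evaluate $M'[N/x]$. $M\odot N$: evaluate $M$, then $N$, and apply $\odot$. $M;N$: evaluate $M$ to $\mathtt{skip}$, then $N$. $M:=N$: evaluate $N$ to $n$, then $M$; if $M$ yields an identifier $x$, set $x$ to $n$ and return $\mathtt{skip}$; if $M$ yields $\mathtt{mkvar}\,M_1\,M_2$, evaluate $M_1n$. $!M$: evaluate $M$; if it yields $x$, return the content of $x$; if it yields $\mathtt{mkvar}\,M_1\,M_2$, evaluate $M_2$. $\mathtt{ifzero}\,M\,N_1\,N_2$: evaluate $M$, then $N_1$ if the result is $0$ and $N_2$ otherwise. $\mathtt{while}\,M\,\mathtt{do}\,N$: evaluate $M$; if the result is non-zero, return $\mathtt{skip}$; if it is $0$, evaluate $N$ to $\mathtt{skip}$ and then the loop again. $\mathtt{new}\,x\,\mathtt{in}\,M$: evaluate $M$ in the store extended by $x\mapsto 0$, and then discard $x$.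 For closed $M$ write $M\Downarrow V$ when $M$ evaluates to $V$ from the empty store. **Contextual equivalence.** For closed terms $M,N$ of the same type, $M\cong_{\mathtt{mk}}N$ means: for every $SCI_{\mathtt{mk}}$ program context $C[-]$ with $\vdash C[M],C[N]:B$, where $B\in\{\mathtt{comm},\mathtt{nat}\}$, and every value $\vdash V:B$, one has $C[M]\Downarrow V\iff C[N]\Downarrow V$. **Model.** $\mathbf{MonRel}$ has monoids as objects; a map $A\to B$ is a monoid homomorphism $f:B\to\mathcal P(A)$, where subsets of $A$ are multiplied elementwise, and $(f;g)(c)=\bigcup_{b\in g(c)}f(b)$. Put $\alpha(\mathtt{nat})=\mathbb N$, $\alpha(\mathtt{comm})=\{*\}$, $\alpha(\mathtt{var})=\{\mathsf{read}(n),\mathsf{write}(n)\mid n\in\mathbb N\}$, $\alpha(A\multimap B)=\alpha(A)^*\times\alpha(B)$, and let $[\![A]\!]$ be the free monoid $\alpha(A)^*$. A derivation of $x_1:A_1,\dots,x_n:A_n\vdash M:B$ is interpreted, by induction on the derivation, as a map $[\![A_1]\!]\times\cdots\times[\![A_n]\!]\to[\![B]\!]$, equivalently as a set of tuples $(\vec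 s,b)$ with $s_i\in\alpha(A_i)^*$ and $b\in\alpha(B)$. Juxtaposition of tuples of sequences denotes componentwise concatenation, and a word $s\in\alpha(\mathtt{var})^*$ is a cell trace if each $\mathsf{read}$ in it carries the value of the latest preceding $\mathsf{write}$, or $0$ if there is none. The interpretation is as follows. * $[\![x]\!]=\{(a,a)\}$; $[\![n]\!]=\{n\}$; $[\![\mathtt{skip}]\!]=\{*\}$; weakening inserts an empty sequence and exchange permutes the components; * $(\vec s,(s,b))\in[\![\lambda x^A.M]\!]$ iff $(\vec s,s,b)\in[\![M]\!]$; * $[\![MN]\!]$ consists of the $(\vec s,\vec t^1\cdots\vec t^k,b)$ with $(\vec s,(a_1\cdots a_k,b))\in[\![M]\!]$ and $(\vec t^i,a_i)\in[\![N]\!]$ for all $i$; * $[\![M\odot N]\!]$ consists of the $(\vec s\vec t,m\odot n)$ with $(\vec s,m)\in[\![M]\!]$, $(\vec t,n)\in[\![N]\!]$; $[\![M;N]\!]$ of the $(\vec s\vec t,b)$ with $(\vec s,*)\in[\![M]\!]$, $(\vec t,b)\in[\![N]\!]$; $[\![M:=N]\!]$ of the $(\vec s\vec t,*)$ with $(\vec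 s,n)\in[\![N]\!]$, $(\vec t,\mathsf{write}(n))\in[\![M]\!]$ for some $n$; $[\![!M]\!]$ of the $(\vec s,n)$ with $(\vec s,\mathsf{read}(n))\in[\![M]\!]$; * $[\![\mathtt{while}\,M\,\mathtt{do}\,N]\!]$ consists of the $(\vec s^1\vec t^1\cdots\vec s^j\vec t^j\vec s,*)$, $j\ge0$, with $(\vec s^i,0)\in[\![M]\!]$, $(\vec t^i,*)\in[\![N]\!]$ and $(\vec s,m)\in[\![M]\!]$ for some $m\ne0$; * $[\![\mathtt{ifzero}\,M\,N_1\,N_2]\!]$ consists of the $(\vec s\vec t,b)$ with either $(\vec s,0)\in[\![M]\!]$ and $(\vec t,b)\in[\![N_1]\!]$, or $(\vec s,m)\in[\![M]\!]$ for some $m\neq0$ and $(\vec t,b)\in[\![N_2]\!]$; * $[\![\mathtt{new}\,x\,\mathtt{in}\,M]\!]$ consists of the $(\vec s,b)$ with $(\vec s,s,b)\in[\![M]\!]$ for some cell trace $s$; * $[\![\mathtt{mkvar}\,M\,N]\!]$ consists of the $(\vec s,\mathsf{write}(n))$ with $(\vec s,*)\in[\![M\,n]\!]$ and the $(\vec s,\mathsf{read}(n))$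 with $(\vec s,n)\in[\![N]\!]$. **Theorem.** The model of $SCI_{\mathtt{mk}}$ in $\mathbf{MonRel}$ is fully abstract: for all closed terms $M$ and $N$ of $SCI_{\mathtt{mk}}$ of the same type (with any typing derivations), $[\![M]\!]=[\![N]\!]$ if and only if $M\cong_{\mathtt{mk}}N$. -/

import Mathlib

/-! ## The category of monoids and relations -/

namespace MonRel

open scoped Pointwise

noncomputable section

/-- A map `A → B` of `MonRel`, the opposite of the Kleisli category of the powerset monad on
monoids: a monoid homomorphism from `B` to the powerset of `A`, where sets are multiplied
elementwise. The corresponding relation between `A` and `B` relates `a` to `b` iff `a ∈ f b`. -/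
abbrev Hom (A B : Type) [Monoid A] [Monoid B] : Type := B →* Set A

variable {A B C D : Type} [Monoid A] [Monoid B] [Monoid C] [Monoid D]

/-- The map of `MonRel` given by (the opposite of) a monoid homomorphism. -/
def ofHom (h : B →* A) : Hom A B where
  toFun b := {h b}
  map_one' := by rw [map_one]; rfl
  map_mul' x y := by rw [map_mul, Set.singleton_mul_singleton]

/-- Identity. -/
def idm (A : Type) [Monoid A] : Hom A A := ofHom (MonoidHom.id A)

/-- Composition `f ; g` in diagrammatic order. -/
def comp (f : Hom A B) (g : Hom B C) : Hom A C where
  toFun c := {a | ∃ b ∈ g c, a ∈ f b}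
  map_one' := by
    ext a
    simp
  map_mul' x y := by
    ext a
    simp only [map_mul, Set.mem_ofPred_eq, Set.mem_mul]
    constructor
    · rintro ⟨_, ⟨b₁, h₁, b₂, h₂, rfl⟩, h⟩
      rw [map_mul] at h
      obtain ⟨a₁, k₁, a₂, k₂, rfl⟩ := h
      exact ⟨a₁, ⟨b₁, h₁, k₁⟩, a₂, ⟨b₂, h₂, k₂⟩, rfl⟩
    · rintro ⟨a₁, ⟨b₁, h₁, k₁⟩, a₂, ⟨b₂, h₂, k₂⟩, rfl⟩
      exact ⟨b₁ * b₂, ⟨b₁, h₁, b₂, h₂, rfl⟩, by rw [map_mul]; exact Set.mul_mem_mul k₁ k₂⟩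

theorem idm_comp (f : Hom A B) : comp (idm A) f = f := by
  ext b a
  simp [comp, idm, ofHom]

theorem comp_idm (f : Hom A B) : comp f (idm B) = f := by
  ext b a
  simp [comp, idm, ofHom]

theorem comp_assoc (f : Hom A B) (g : Hom B C) (h : Hom C D) :
    comp (comp f g) h = comp f (comp g h) := by
  ext d a
  simp only [comp, MonoidHom.coe_mk, OneHom.coe_mk, Set.mem_ofPred_eq]
  constructor
  · rintro ⟨c, hc, b, hb, ha⟩
    exact ⟨b, ⟨c, hc, hb⟩, ha⟩
  · rintro ⟨b, ⟨c, hc, hb⟩, ha⟩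
    exact ⟨c, hc, b, hb, ha⟩

/-- The tensor `f ⊗ g : A ⊗ C → B ⊗ D`; on objects, the tensor is the product of monoids. -/
def tensor (f : Hom A B) (g : Hom C D) : Hom (A × C) (B × D) where
  toFun p := f p.1 ×ˢ g p.2
  map_one' := by
    ext ⟨a, c⟩
    simp [Prod.ext_iff]
  map_mul' x y := by
    ext ⟨a, c⟩
    simp only [Prod.fst_mul, Prod.snd_mul, map_mul, Set.mem_prod, Set.mem_mul]
    constructor
    · rintro ⟨⟨a₁, h₁, a₂, h₂, rfl⟩, c₁, k₁, c₂, k₂, rfl⟩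
      exact ⟨(a₁, c₁), ⟨h₁, k₁⟩, (a₂, c₂), ⟨h₂, k₂⟩, rfl⟩
    · rintro ⟨⟨a₁, c₁⟩, ⟨h₁, k₁⟩, ⟨a₂, c₂⟩, ⟨h₂, k₂⟩, h⟩
      obtain ⟨rfl, rfl⟩ := Prod.ext_iff.mp h
      exact ⟨⟨a₁, h₁, a₂, h₂, rfl⟩, c₁, k₁, c₂, k₂, rfl⟩

/-- The map into a free monoid determined by a set of pairs `(a, x)`, `x` a generator. -/
def gen {X : Type} (R : X → Set A) : Hom A (FreeMonoid X) := FreeMonoid.lift R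

/-- Pairing into the product of two free monoids, the free monoid on the disjoint union. -/
def pair {X Y : Type} (f : Hom A (FreeMonoid X)) (g : Hom A (FreeMonoid Y)) :
    Hom A (FreeMonoid (X ⊕ Y)) :=
  gen (Sum.elim (fun x => f (.of x)) (fun y => g (.of y)))

/-- Currying; the exponential `B ⊸ X*` is the free monoid on `B × X`. -/
def curry {X : Type} (f : Hom (A × B) (FreeMonoid X)) : Hom A (FreeMonoid (B × X)) :=
  gen (fun p => {a | (a, p.1) ∈ f (.of p.2)})

/-- Evaluation, the counit of the exponential adjunction. -/
def ev {X : Type} : Hom (FreeMonoid (B × X) × B) (FreeMonoid X) :=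
  gen (fun x => {q | q.1 = .of (q.2, x)})

end

end MonRel

/-! ## The language: SCI extended with `mkvar` -/

namespace SCI

/-- Types. -/
inductive Ty : Type
  | nat
  | comm
  | var
  | fn (A B : Ty)
  deriving DecidableEq

/-- The arithmetic operators: addition, truncated subtraction, and any family `E` of further
binary operators. -/
inductive Op (E : Type) : Type
  | add
  | sub
  | ext (e : E)

/-- The meaning of the operators, given the meaning `I` of the further ones. -/
def Op.apply {E : Type} (I : E → ℕ → ℕ → ℕ) : Op E → ℕ → ℕ → ℕ
  | .add, m, n => m + n
  | .sub, m, n => m - n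
  | .ext e, m, n => I e m n

/-- Terms up to renaming of bound identifiers, in de Bruijn style: identifiers are natural
numbers; `lam` and `local_` bind the identifier `0` of their body, in which any other identifier
`x + 1` denotes the identifier `x` of the surrounding scope. -/
inductive Tm (E : Type) : Type
  | num (n : ℕ)
  | arith (o : Op E) (M N : Tm E)
  | skip
  | seq (M N : Tm E)
  | assign (M N : Tm E)
  | deref (M : Tm E)
  | loop (M N : Tm E)
  | ifzero (M N₁ N₂ : Tm E)
  | var (x : ℕ)
  | lam (A : Ty) (M : Tm E)
  | app (M N : Tm E)
  | local_ (M : Tm E)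
  | mkvar (M N : Tm E)

/-- Extend a renaming under a binder. -/
def upRen (r : ℕ → ℕ) : ℕ → ℕ
  | 0 => 0
  | x + 1 => r x + 1

/-- Renaming of free identifiers. -/
def Tm.rename {E : Type} : (ℕ → ℕ) → Tm E → Tm E
  | _, .num n => .num n
  | r, .arith o M N => .arith o (M.rename r) (N.rename r)
  | _, .skip => .skip
  | r, .seq M N => .seq (M.rename r) (N.rename r)
  | r, .assign M N => .assign (M.rename r) (N.rename r)
  | r, .deref M => .deref (M.rename r)
  | r, .loop M N => .loop (M.rename r) (N.rename r)
  | r, .ifzero M N₁ N₂ => .ifzero (M.rename r) (N₁.rename r) (N₂.rename r)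
  | r, .var x => .var (r x)
  | r, .lam A M => .lam A (M.rename (upRen r))
  | r, .app M N => .app (M.rename r) (N.rename r)
  | r, .local_ M => .local_ (M.rename (upRen r))
  | r, .mkvar M N => .mkvar (M.rename r) (N.rename r)

/-- Extend a simultaneous substitution under a binder. -/
def upSub {E : Type} (s : ℕ → Tm E) : ℕ → Tm E
  | 0 => .var 0
  | x + 1 => (s x).rename Nat.succ

/-- Capture-avoiding simultaneous substitution. -/
def Tm.subst {E : Type} : (ℕ → Tm E) → Tm E → Tm E
  | _, .num n => .num n
  | s, .arith o M N => .arith o (M.subst s) (N.subst s)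
  | _, .skip => .skip
  | s, .seq M N => .seq (M.subst s) (N.subst s)
  | s, .assign M N => .assign (M.subst s) (N.subst s)
  | s, .deref M => .deref (M.subst s)
  | s, .loop M N => .loop (M.subst s) (N.subst s)
  | s, .ifzero M N₁ N₂ => .ifzero (M.subst s) (N₁.subst s) (N₂.subst s)
  | s, .var x => s x
  | s, .lam A M => .lam A (M.subst (upSub s))
  | s, .app M N => .app (M.subst s) (N.subst s)
  | s, .local_ M => .local_ (M.subst (upSub s))
  | s, .mkvar M N => .mkvar (M.subst s) (N.subst s)

/-- `M.inst N` is the body `M` of a binder with `N` substituted for the bound identifier. -/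
def Tm.inst {E : Type} (M N : Tm E) : Tm E :=
  M.subst (fun x => match x with
    | 0 => N
    | y + 1 => .var y)

/-! ### Typing -/

/-- Typing contexts `x₁ : A₁, …, xₙ : Aₙ`; the most recent entry is the head of the list. -/
abbrev Cx : Type := List (ℕ × Ty)

/-- All identifiers are distinct. -/
def Cx.Distinct (Γ : Cx) : Prop := (Γ.map Prod.fst).Nodup

/-- The context `Γ` as seen from below one more binder. -/
def Cx.shift (Γ : Cx) : Cx := Γ.map (fun p => (p.1 + 1, p.2))

/-- Typing derivations for the judgment `Γ ⊢ M : A`. -/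
inductive Deriv {E : Type} : Cx → Tm E → Ty → Type
  | var (x : ℕ) (A : Ty) : Deriv [(x, A)] (.var x) A
  | lam {Γ : Cx} {A B : Ty} {M : Tm E} :
      Deriv ((0, A) :: Γ.shift) M B → Deriv Γ (.lam A M) (.fn A B)
  | app {Γ Δ : Cx} {A B : Ty} {M N : Tm E} :
      Deriv Γ M (.fn A B) → Deriv Δ N A → Cx.Distinct (Γ ++ Δ) → Deriv (Γ ++ Δ) (.app M N) B
  | weakening {Γ : Cx} {B : Ty} {M : Tm E} (x : ℕ) (A : Ty) :
      Deriv Γ M B → Cx.Distinct ((x, A) :: Γ) → Deriv ((x, A) :: Γ) M B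
  | exchange {Γ Γ' : Cx} {A : Ty} {M : Tm E} :
      Deriv Γ M A → Γ.Perm Γ' → Deriv Γ' M A
  | num (n : ℕ) : Deriv [] (.num n) .nat
  | arith {Γ : Cx} {M N : Tm E} (o : Op E) :
      Deriv Γ M .nat → Deriv Γ N .nat → Deriv Γ (.arith o M N) .nat
  | skip : Deriv [] .skip .comm
  | seq {Γ : Cx} {B : Ty} {M N : Tm E} :
      (B = .comm ∨ B = .nat ∨ B = .var) →
      Deriv Γ M .comm → Deriv Γ N B → Deriv Γ (.seq M N) B
  | assign {Γ : Cx} {M N : Tm E} :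
      Deriv Γ M .var → Deriv Γ N .nat → Deriv Γ (.assign M N) .comm
  | deref {Γ : Cx} {M : Tm E} : Deriv Γ M .var → Deriv Γ (.deref M) .nat
  | loop {Γ : Cx} {M N : Tm E} :
      Deriv Γ M .nat → Deriv Γ N .comm → Deriv Γ (.loop M N) .comm
  | ifzero {Γ : Cx} {B : Ty} {M N₁ N₂ : Tm E} :
      (B = .comm ∨ B = .nat ∨ B = .var) →
      Deriv Γ M .nat → Deriv Γ N₁ B → Deriv Γ N₂ B → Deriv Γ (.ifzero M N₁ N₂) B
  | local_ {Γ : Cx} {B : Ty} {M : Tm E} :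
      (B = .comm ∨ B = .nat) →
      Deriv ((0, .var) :: Γ.shift) M B → Deriv Γ (.local_ M) B
  | mkvar {Γ : Cx} {M N : Tm E} :
      Deriv Γ M (.fn .nat .comm) → Deriv Γ N .nat → Deriv Γ (.mkvar M N) .var

/-- The typing judgment `Γ ⊢ M : A`. -/
def HasType {E : Type} (Γ : Cx) (M : Tm E) (A : Ty) : Prop := Nonempty (Deriv Γ M A)

/-! ### Operational semantics -/

/-- Values. -/
inductive IsValue {E : Type} : Tm E → Prop
  | num (n : ℕ) : IsValue (.num n)
  | skip : IsValue .skip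
  | var (x : ℕ) : IsValue (.var x)
  | lam (A : Ty) (M : Tm E) : IsValue (.lam A M)
  | mkvar (M N : Tm E) : IsValue (.mkvar M N)

/-- Big-step evaluation `σ, M ⇓ σ', V`. A store is a list whose `x`-th entry is the content of
the identifier `x`. -/
inductive Eval {E : Type} (I : E → ℕ → ℕ → ℕ) : List ℕ → Tm E → List ℕ → Tm E → Prop
  | value {σ : List ℕ} {V : Tm E} : IsValue V → Eval I σ V σ V
  | app {σ σ' σ'' : List ℕ} {M N M' V : Tm E} {A : Ty} :
      Eval I σ M σ' (.lam A M') → Eval I σ' (M'.inst N) σ'' V → Eval I σ (.app M N) σ'' V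
  | arith {σ σ' σ'' : List ℕ} {M N : Tm E} {m n : ℕ} (o : Op E) :
      Eval I σ M σ' (.num m) → Eval I σ' N σ'' (.num n) →
      Eval I σ (.arith o M N) σ'' (.num (o.apply I m n))
  | assign {σ σ' σ'' : List ℕ} {M N : Tm E} {n x : ℕ} :
      Eval I σ N σ' (.num n) → Eval I σ' M σ'' (.var x) → x < σ''.length →
      Eval I σ (.assign M N) (σ''.set x n) .skip
  | deref {σ σ' : List ℕ} {M : Tm E} {x n : ℕ} :
      Eval I σ M σ' (.var x) → σ'[x]? = some n → Eval I σ (.deref M) σ' (.num n)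
  | assignMkvar {σ σ' σ'' σ''' : List ℕ} {M N M₁ M₂ V : Tm E} {n : ℕ} :
      Eval I σ N σ' (.num n) → Eval I σ' M σ'' (.mkvar M₁ M₂) →
      Eval I σ'' (.app M₁ (.num n)) σ''' V → Eval I σ (.assign M N) σ''' V
  | derefMkvar {σ σ' σ'' : List ℕ} {M M₁ M₂ V : Tm E} :
      Eval I σ M σ' (.mkvar M₁ M₂) → Eval I σ' M₂ σ'' V → Eval I σ (.deref M) σ'' V
  | seq {σ σ' σ'' : List ℕ} {M N V : Tm E} :
      Eval I σ M σ' .skip → Eval I σ' N σ'' V → Eval I σ (.seq M N) σ'' V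
  | loopStop {σ σ' : List ℕ} {M N : Tm E} {n : ℕ} :
      Eval I σ M σ' (.num n) → n ≠ 0 → Eval I σ (.loop M N) σ' .skip
  | loopStep {σ σ' σ'' σ''' : List ℕ} {M N : Tm E} :
      Eval I σ M σ' (.num 0) → Eval I σ' N σ'' .skip → Eval I σ'' (.loop M N) σ''' .skip →
      Eval I σ (.loop M N) σ''' .skip
  | ifZero {σ σ' σ'' : List ℕ} {M N₁ N₂ V : Tm E} :
      Eval I σ M σ' (.num 0) → Eval I σ' N₁ σ'' V → Eval I σ (.ifzero M N₁ N₂) σ'' V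
  | ifNonzero {σ σ' σ'' : List ℕ} {M N₁ N₂ V : Tm E} {n : ℕ} :
      Eval I σ M σ' (.num n) → n ≠ 0 → Eval I σ' N₂ σ'' V → Eval I σ (.ifzero M N₁ N₂) σ'' V
  | local_ {σ σ' : List ℕ} {M V : Tm E} {n : ℕ} :
      Eval I (0 :: σ) M (n :: σ') V → (V = .skip ∨ ∃ k, V = .num k) →
      Eval I σ (.local_ M) σ' V

/-! ### Contextual equivalence -/

/-- Program contexts `C[-]`: terms with any number of occurrences of a hole. -/
inductive Context (E : Type) : Type
  | hole
  | num (n : ℕ)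
  | arith (o : Op E) (M N : Context E)
  | skip
  | seq (M N : Context E)
  | assign (M N : Context E)
  | deref (M : Context E)
  | loop (M N : Context E)
  | ifzero (M N₁ N₂ : Context E)
  | var (x : ℕ)
  | lam (A : Ty) (M : Context E)
  | app (M N : Context E)
  | local_ (M : Context E)
  | mkvar (M N : Context E)

/-- `C.plug P` is `C[P]`. -/
def Context.plug {E : Type} (P : Tm E) : Context E → Tm E
  | .hole => P
  | .num n => .num n
  | .arith o M N => .arith o (M.plug P) (N.plug P)
  | .skip => .skip
  | .seq M N => .seq (M.plug P) (N.plug P)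
  | .assign M N => .assign (M.plug P) (N.plug P)
  | .deref M => .deref (M.plug P)
  | .loop M N => .loop (M.plug P) (N.plug P)
  | .ifzero M N₁ N₂ => .ifzero (M.plug P) (N₁.plug P) (N₂.plug P)
  | .var x => .var x
  | .lam A M => .lam A (M.plug P)
  | .app M N => .app (M.plug P) (N.plug P)
  | .local_ M => .local_ (M.plug P)
  | .mkvar M N => .mkvar (M.plug P) (N.plug P)

/-- Contextual equivalence (of closed terms of the same type). -/
def CtxEquiv {E : Type} (I : E → ℕ → ℕ → ℕ) (M N : Tm E) : Prop :=
  ∀ (C : Context E) (B : Ty), (B = .comm ∨ B = .nat) →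
    HasType [] (C.plug M) B → HasType [] (C.plug N) B →
    ∀ V : Tm E, IsValue V → HasType [] V B →
      (Eval I [] (C.plug M) [] V ↔ Eval I [] (C.plug N) [] V)

/-! ### The model in the category of monoids and relations -/

/-- Observable events at type `var`. -/
inductive VarEvent : Type
  | read (n : ℕ)
  | write (n : ℕ)

/-- The set of events at each type. -/
def Event : Ty → Type
  | .nat => ℕ
  | .comm => Unit
  | .var => VarEvent
  | .fn A B => FreeMonoid (Event A) × Event B

/-- The monoid interpreting a type. In particular `Obj .var` is the product of countably many
copies of `Obj .comm` with `Obj .nat`, and `Obj (.fn A B)` is an exponential. -/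
abbrev Obj (A : Ty) : Type := FreeMonoid (Event A)

/-- The monoid interpreting a context: the product (tensor) of the monoids interpreting the types
of its entries. Its elements assign a sequence of events to each entry, and are multiplied
componentwise. -/
abbrev CxObj (Γ : Cx) : Type := (p : {p : ℕ × Ty // p ∈ Γ}) → Obj p.1.2

/-- State transitions of a single cell. -/
inductive Trans : ℕ → Obj .var → ℕ → Prop
  | nil (n : ℕ) : Trans n 1 n
  | read (n : ℕ) : Trans n (FreeMonoid.of (VarEvent.read n)) n
  | write (n n' : ℕ) : Trans n (FreeMonoid.of (VarEvent.write n')) n'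
  | append {n n' n'' : ℕ} {s s' : Obj .var} :
      Trans n s n' → Trans n' s' n'' → Trans n (s * s') n''

/-- Cell traces: histories of a cell that initially contains zero. -/
def CellTrace (s : Obj .var) : Prop := ∃ n, Trans 0 s n

noncomputable section

open MonRel

/-- Extending a tuple over `Γ` to one over `Γ'`, by empty sequences. -/
def extend (Γ Γ' : Cx) : CxObj Γ →* CxObj Γ' where
  toFun ρ p := if h : p.1 ∈ Γ then ρ ⟨p.1, h⟩ else 1
  map_one' := by
    funext p
    by_cases h : p.1 ∈ Γ <;> simp [h]
  map_mul' ρ ρ' := by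
    funext p
    by_cases h : p.1 ∈ Γ <;> simp [h]

/-- The projection from `Γ'` to `Γ` when `Γ` is part of `Γ'`; the symmetry isomorphism when `Γ'`
is a permutation of `Γ`. -/
def proj (Γ' Γ : Cx) : Hom (CxObj Γ') (CxObj Γ) := ofHom (extend Γ Γ')

/-- Joining a tuple over `Γ` and a tuple over `Δ` (for disjoint `Γ` and `Δ`). -/
def join (Γ Δ : Cx) : CxObj Γ × CxObj Δ →* CxObj (Γ ++ Δ) where
  toFun ρ p :=
    if h : p.1 ∈ Γ then ρ.1 ⟨p.1, h⟩
    else ρ.2 ⟨p.1, (List.mem_append.mp p.2).resolve_left h⟩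
  map_one' := by
    funext p
    by_cases h : p.1 ∈ Γ <;> simp [h]
  map_mul' ρ ρ' := by
    funext p
    by_cases h : p.1 ∈ Γ <;> simp [h]

/-- The isomorphism from `Γ, Δ` to the tensor of `Γ` and `Δ`. -/
def splitm (Γ Δ : Cx) : Hom (CxObj (Γ ++ Δ)) (CxObj Γ × CxObj Δ) := ofHom (join Γ Δ)

/-- A tuple over `Γ` extended by a bound identifier, as a tuple over `Γ` and a sequence for the
bound identifier. -/
def unbind (Γ : Cx) (A : Ty) : CxObj ((0, A) :: Γ.shift) →* CxObj Γ × Obj A where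
  toFun ρ :=
    (fun p => ρ ⟨(p.1.1 + 1, p.1.2), List.mem_cons_of_mem _ (List.mem_map_of_mem p.2)⟩,
      ρ ⟨(0, A), List.mem_cons_self⟩)
  map_one' := rfl
  map_mul' _ _ := rfl

/-- The isomorphism from the tensor of `Γ` and `A` to `Γ` extended by a bound identifier. -/
def bindm (Γ : Cx) (A : Ty) : Hom (CxObj Γ × Obj A) (CxObj ((0, A) :: Γ.shift)) :=
  ofHom (unbind Γ A)

/-- The isomorphism (identity) from the context `x : A` to `A`. -/
def varm (x : ℕ) (A : Ty) : Hom (CxObj [(x, A)]) (Obj A) :=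
  ofHom (MonoidHom.mulSingle (fun p : {p : ℕ × Ty // p ∈ [(x, A)]} => Obj p.1.2)
    ⟨(x, A), List.mem_cons_self⟩)

/-- Evaluation at the types of the language. -/
def evm (A B : Ty) : Hom (Obj (.fn A B) × Obj A) (Obj B) := MonRel.ev

/-- Currying at the types of the language. -/
def currym {Γ : Cx} {A B : Ty} (f : Hom (CxObj ((0, A) :: Γ.shift)) (Obj B)) :
    Hom (CxObj Γ) (Obj (.fn A B)) := MonRel.curry (comp (bindm Γ A) f)

/-- Numerals. -/
def numm (n : ℕ) : Hom (CxObj []) (Obj .nat) := gen (fun m : ℕ => {_ρ | m = n})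

/-- `skip`. -/
def skipm : Hom (CxObj []) (Obj .comm) := gen (fun _ => {_ρ | True})

/-- Arithmetic: first the left operand, then the right one. -/
def arithm (f : ℕ → ℕ → ℕ) : Hom (FreeMonoid (Event .nat ⊕ Event .nat)) (Obj .nat) :=
  gen (fun k : ℕ => {s | ∃ m n : ℕ, k = f m n ∧ s = .of (.inl m) * .of (.inr n)})

/-- Sequential composition. -/
def seqm (B : Ty) : Hom (FreeMonoid (Event .comm ⊕ Event B)) (Obj B) :=
  gen (fun b => {s | s = .of (.inl ()) * .of (.inr b)})

/-- Assignment: first the value is computed, then it is written. -/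
def assignm : Hom (FreeMonoid (Event .var ⊕ Event .nat)) (Obj .comm) :=
  gen (fun _ => {s | ∃ n : ℕ, s = .of (.inr n) * .of (.inl (VarEvent.write n))})

/-- Dereferencing: the projection from `var` to `nat`. -/
def derefm : Hom (Obj .var) (Obj .nat) := gen (fun n : ℕ => {s | s = .of (VarEvent.read n)})

/-- While loops: `(0 * 0 * ⋯ 0 * n, *)` for `n ≠ 0`. -/
def loopm : Hom (FreeMonoid (Event .nat ⊕ Event .comm)) (Obj .comm) :=
  gen (fun _ => {s | ∃ (j n : ℕ), n ≠ 0 ∧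
    s = (.of (.inl (0 : ℕ)) * .of (.inr ())) ^ j * .of (.inl n)})

/-- Conditionals. -/
def ifzerom (B : Ty) : Hom (FreeMonoid (Event .nat ⊕ (Event B ⊕ Event B))) (Obj B) :=
  gen (fun b => {s | s = .of (.inl (0 : ℕ)) * .of (.inr (.inl b)) ∨
    ∃ m : ℕ, m ≠ 0 ∧ s = .of (.inl m) * .of (.inr (.inr b))})

/-- Local blocks. -/
def localm (B : Ty) : Hom (Obj (.fn .var B)) (Obj B) :=
  gen (fun b => {t | ∃ s : Obj .var, CellTrace s ∧ t = FreeMonoid.of (s, b)})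

/-- The `n`-th component of the map flattening a function from `nat` to `comm` into a tuple of
commands: the function applied to the constant argument `n`. -/
def flattenm (n : ℕ) : Hom (Obj (.fn .nat .comm)) (Obj .comm) :=
  gen (fun _ => {t | ∃ k : ℕ, t = FreeMonoid.of ((FreeMonoid.of n : FreeMonoid ℕ) ^ k, ())})

/-- Pairing into `var`, the product of countably many copies of `comm` with `nat`. -/
def pairVar {A : Type} [Monoid A] (f : ℕ → Hom A (Obj .comm)) (g : Hom A (Obj .nat)) :
    Hom A (Obj .var) :=
  gen (fun e : VarEvent => match e with
    | .write n => f n (FreeMonoid.of ())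
    | .read n => g (FreeMonoid.of n))

/-- The interpretation of typing derivations in `MonRel`. -/
def den {E : Type} (I : E → ℕ → ℕ → ℕ) :
    {Γ : Cx} → {M : Tm E} → {A : Ty} → Deriv Γ M A → Hom (CxObj Γ) (Obj A)
  | _, _, _, .var x A => varm x A
  | _, _, _, .lam d => currym (den I d)
  | _, _, _, .app (Γ := Γ) (Δ := Δ) (A := A) (B := B) d e _ =>
      comp (splitm Γ Δ) (comp (tensor (den I d) (den I e)) (evm A B))
  | _, _, _, .weakening (Γ := Γ) x A d _ => comp (proj ((x, A) :: Γ) Γ) (den I d)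
  | _, _, _, .exchange (Γ := Γ) (Γ' := Γ') d _ => comp (proj Γ' Γ) (den I d)
  | _, _, _, .num n => numm n
  | _, _, _, .arith o d e => comp (pair (den I d) (den I e)) (arithm (o.apply I))
  | _, _, _, .skip => skipm
  | _, _, _, .seq (B := B) _ d e => comp (pair (den I d) (den I e)) (seqm B)
  | _, _, _, .assign d e => comp (pair (den I d) (den I e)) assignm
  | _, _, _, .deref d => comp (den I d) derefm
  | _, _, _, .loop d e => comp (pair (den I d) (den I e)) loopm
  | _, _, _, .ifzero (B := B) _ d e₁ e₂ =>
      comp (pair (den I d) (pair (den I e₁) (den I e₂))) (ifzerom B)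
  | _, _, _, .local_ (B := B) _ d => comp (currym (den I d)) (localm B)
  | _, _, _, .mkvar d e => pairVar (fun n => comp (den I d) (flattenm n)) (den I e)

end

end SCI

namespace SCI

/-! ## Untyped events and traces -/

/-- Events of all types, in one untyped universe. -/
inductive Ev : Type
  | num (n : ℕ)
  | star
  | read (n : ℕ)
  | write (n : ℕ)
  | fn (w : List Ev) (b : Ev)

/-- Words of events form a monoid under concatenation. -/
instance : Monoid (List Ev) := inferInstanceAs (Monoid (FreeMonoid Ev))

theorem word_mul (v w : List Ev) : v * w = v ++ w := rfl

theorem word_one : (1 : List Ev) = [] := rfl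

/-- A trace assigns a word of events to every identifier; traces are multiplied pointwise. -/
abbrev Trace : Type := ℕ → List Ev

theorem trace_mul (s t : Trace) (x : ℕ) : (s * t) x = s x ++ t x := rfl

theorem trace_one (x : ℕ) : (1 : Trace) x = [] := rfl

/-- The semantic form of non-interference: at every identifier one of the two words is empty, and
the empty word commutes with all words. -/
theorem trace_comm {s t : Trace} (h : ∀ x, s x = [] ∨ t x = []) : s * t = t * s := by
  funext x
  rcases h x with h | h <;> simp [word_mul, h]

/-- The events of a type, among the untyped events. -/
def TyEv : Ty → Ev → Prop
  | .nat, b => ∃ n, b = .num n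
  | .comm, b => b = .star
  | .var, b => ∃ n, b = .read n ∨ b = .write n
  | .fn A B, b => ∃ w c, b = .fn w c ∧ (∀ a ∈ w, TyEv A a) ∧ TyEv B c

/-- Histories of a cell with content `m` before and `m'` after. -/
def Cell : ℕ → List Ev → ℕ → Prop
  | m, [], m' => m = m'
  | m, .read k :: w, m' => k = m ∧ Cell m w m'
  | _, .write k :: w, m' => Cell k w m'
  | _, _ :: _, _ => False

theorem cell_append {m m'' : ℕ} {v w : List Ev} :
    Cell m (v ++ w) m'' ↔ ∃ m', Cell m v m' ∧ Cell m' w m'' := by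
  induction v generalizing m with
  | nil => simp [Cell]
  | cons a v ih => cases a <;> simp [Cell, ih, and_assoc]

theorem cell_typed {m m' : ℕ} {w : List Ev} (h : Cell m w m') : ∀ a ∈ w, TyEv .var a := by
  induction w generalizing m with
  | nil => simp
  | cons a w ih =>
    cases a <;> simp only [Cell] at h
    all_goals
      intro b hb
      rcases List.mem_cons.mp hb with rfl | hb
      · simp [TyEv]
    · exact ih h.2 b hb
    · exact ih h b hb

/-! ### Inserting and deleting an entry -/

/-- Put a new entry in front. -/
def scons {X : Type} (a : X) (f : ℕ → X) : ℕ → X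
  | 0 => a
  | x + 1 => f x

/-- Put a new entry at position `k`. -/
def ins {X : Type} (k : ℕ) (a : X) (f : ℕ → X) : ℕ → X :=
  fun x => if x < k then f x else if x = k then a else f (x - 1)

/-- The renaming that avoids `k`. -/
def sh (k : ℕ) : ℕ → ℕ := fun x => if x < k then x else x + 1

theorem sh_zero : sh 0 = Nat.succ := by
  funext x
  simp [sh]

theorem sh_injective (k : ℕ) : Function.Injective (sh k) := by
  intro x y h
  simp only [sh] at h
  split_ifs at h <;> omega

theorem upRen_sh (k : ℕ) : upRen (sh k) = sh (k + 1) := by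
  funext x
  cases x with
  | zero => simp [upRen, sh]
  | succ x => simp only [upRen, sh]; split_ifs <;> omega

theorem sh_ne (k x : ℕ) : sh k x ≠ k := by
  simp only [sh]
  split_ifs <;> omega

/-- With `ins_self` and `ins_sh` this case split replaces index arithmetic in all that follows. -/
theorem eq_or_sh (k y : ℕ) : y = k ∨ ∃ x, y = sh k x := by
  rcases lt_trichotomy y k with h | h | h
  · exact .inr ⟨y, by simp [sh, h]⟩
  · exact .inl h
  · refine .inr ⟨y - 1, ?_⟩
    simp only [sh]
    split_ifs <;> omega

theorem ins_self {X : Type} (k : ℕ) (a : X) (f : ℕ → X) : ins k a f k = a := by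
  simp [ins]

theorem ins_sh {X : Type} (k : ℕ) (a : X) (f : ℕ → X) (x : ℕ) : ins k a f (sh k x) = f x := by
  simp only [ins, sh]
  split_ifs <;> first | rfl | omega

theorem ins_eta {X : Type} (k : ℕ) (f : ℕ → X) : ins k (f k) (f ∘ sh k) = f := by
  funext y
  rcases eq_or_sh k y with rfl | ⟨x, rfl⟩
  · rw [ins_self]
  · rw [ins_sh]; rfl

theorem ins_comp_sh {X : Type} (k : ℕ) (a : X) (f : ℕ → X) : ins k a f ∘ sh k = f :=
  funext fun x => ins_sh k a f x

theorem ins_inj {X : Type} {k : ℕ} {a b : X} {f g : ℕ → X} (h : ins k a f = ins k b g) :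
    a = b ∧ f = g := by
  constructor
  · rw [← ins_self k a f, h, ins_self]
  · rw [← ins_comp_sh k a f, h, ins_comp_sh]

theorem ins_mul (k : ℕ) (v w : List Ev) (s t : Trace) :
    (ins k (v ++ w) (s * t) : Trace) = ins k v s * ins k w t := by
  funext y
  rcases eq_or_sh k y with rfl | ⟨x, rfl⟩
  · simp [word_mul, ins_self]
  · simp [word_mul, ins_sh]

theorem ins_one (k : ℕ) : (ins k [] 1 : Trace) = 1 := by
  funext y
  rcases eq_or_sh k y with rfl | ⟨x, rfl⟩
  · simp [ins_self, word_one]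
  · simp [ins_sh, word_one]

theorem ins_zero {X : Type} (a : X) (f : ℕ → X) : ins 0 a f = scons a f := by
  funext y
  cases y <;> simp [ins, scons]

theorem ins_scons {X : Type} (k : ℕ) (a b : X) (f : ℕ → X) :
    ins (k + 1) a (scons b f) = scons b (ins k a f) := by
  funext y
  cases y with
  | zero => simp [ins, scons]
  | succ y =>
    simp only [ins, scons, Nat.add_lt_add_iff_right, Nat.add_right_cancel_iff, Nat.add_sub_cancel]
    split_ifs with h1 h2
    · rfl
    · rfl
    · obtain ⟨z, rfl⟩ : ∃ z, y = z + 1 := ⟨y - 1, by omega⟩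
      rfl

theorem scons_comp_sh {X : Type} (k : ℕ) (a : X) (f : ℕ → X) :
    scons a f ∘ sh (k + 1) = scons a (f ∘ sh k) := by
  funext y
  cases y with
  | zero => simp [sh, scons]
  | succ y =>
    simp only [Function.comp, sh, Nat.add_lt_add_iff_right, scons]
    split_ifs <;> rfl

theorem scons_eta {X : Type} (f : ℕ → X) : scons (f 0) (fun x => f (x + 1)) = f := by
  funext y
  cases y <;> rfl

theorem scons_inj {X : Type} {a b : X} {f g : ℕ → X} (h : scons a f = scons b g) :
    a = b ∧ f = g :=
  ⟨congrFun h 0, funext fun x => congrFun h (x + 1)⟩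

theorem scons_mul (v w : List Ev) (s t : Trace) :
    (scons (v ++ w) (s * t) : Trace) = scons v s * scons w t := by
  funext y
  cases y <;> rfl

theorem scons_one : (scons [] 1 : Trace) = 1 := by
  funext y
  cases y <;> rfl

/-- The trace with a single event `b`, at identifier `x`. -/
def single (x : ℕ) (b : Ev) : Trace := fun y => if y = x then [b] else []

/-! ### Relations between traces and observations, graded by sizes -/

/-- Relations between traces and elements of `X`, graded by a size. -/
abbrev Rel (X : Type) : Type := ℕ → Trace → X → Prop

namespace Rel

variable {X Y Z : Type}

/-- The empty trace, with observation `x`. -/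
def leaf (x : X) : Rel X := fun n s z => n = 0 ∧ s = 1 ∧ z = x

/-- Increase the size by one. -/
def tick (R : Rel X) : Rel X := fun n s z => ∃ m, n = m + 1 ∧ R m s z

/-- First `R`, then `S`, with the observations combined by `g`. -/
def seq2 (R : Rel X) (S : Rel Y) (g : X → Y → Z → Prop) : Rel Z := fun n s z =>
  ∃ n₁ n₂ s₁ s₂ x y, n = n₁ + n₂ ∧ s = s₁ * s₂ ∧ R n₁ s₁ x ∧ S n₂ s₂ y ∧ g x y z

/-- Change the observations. -/
def relabel (R : Rel X) (g : X → Z → Prop) : Rel Z := fun n s z => ∃ x, R n s x ∧ g x z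

/-- Union. -/
def union (R S : Rel X) : Rel X := fun n s z => R n s z ∨ S n s z

/-- Words of successive observations. -/
inductive words (R : Rel X) : Rel (List X)
  | nil : words R 0 1 []
  | cons {n₁ n₂ : ℕ} {s₁ s₂ : Trace} {a : X} {w : List X} :
      R n₁ s₁ a → words R n₂ s₂ w → words R (n₁ + n₂) (s₁ * s₂) (a :: w)

/-- Bind an identifier. -/
def under (R : Rel X) (P : List Ev → X → Z → Prop) : Rel Z := fun n s z =>
  ∃ w x, P w x z ∧ R n (scons w s) x

/-- Forget the size. -/
def E (R : Rel X) (s : Trace) (x : X) : Prop := ∃ n, R n s x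

theorem words_nil {R : Rel X} {n : ℕ} {s : Trace} : words R n s [] ↔ n = 0 ∧ s = 1 := by
  constructor
  · rintro ⟨⟩
    exact ⟨rfl, rfl⟩
  · rintro ⟨rfl, rfl⟩
    exact .nil

theorem words_cons {R : Rel X} {n : ℕ} {s : Trace} {a : X} {w : List X} :
    words R n s (a :: w) ↔
      ∃ n₁ n₂ s₁ s₂, n = n₁ + n₂ ∧ s = s₁ * s₂ ∧ R n₁ s₁ a ∧ words R n₂ s₂ w := by
  constructor
  · intro h
    cases h with
    | cons h1 h2 => exact ⟨_, _, _, _, rfl, rfl, h1, h2⟩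
  · rintro ⟨n₁, n₂, s₁, s₂, rfl, rfl, h1, h2⟩
    exact .cons h1 h2

theorem words_append {R : Rel X} {n : ℕ} {s : Trace} {v w : List X} :
    words R n s (v ++ w) ↔
      ∃ n₁ n₂ s₁ s₂, n = n₁ + n₂ ∧ s = s₁ * s₂ ∧ words R n₁ s₁ v ∧ words R n₂ s₂ w := by
  induction v generalizing n s with
  | nil =>
    constructor
    · intro h
      exact ⟨0, n, 1, s, by simp, by simp, .nil, h⟩
    · rintro ⟨n₁, n₂, s₁, s₂, rfl, rfl, h1, h2⟩
      obtain ⟨rfl, rfl⟩ := words_nil.mp h1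
      simpa using h2
  | cons a v ih =>
    rw [List.cons_append, words_cons]
    constructor
    · rintro ⟨n₁, n₂, s₁, s₂, rfl, rfl, h1, h2⟩
      obtain ⟨n₃, n₄, s₃, s₄, rfl, rfl, h3, h4⟩ := ih.mp h2
      exact ⟨n₁ + n₃, n₄, s₁ * s₃, s₄, by omega, by rw [mul_assoc], .cons h1 h3, h4⟩
    · rintro ⟨n₁, n₂, s₁, s₂, rfl, rfl, h1, h2⟩
      obtain ⟨n₃, n₄, s₃, s₄, rfl, rfl, h3, h4⟩ := words_cons.mp h1
      exact ⟨n₃, n₄ + n₂, s₃, s₄ * s₂, by omega, by rw [mul_assoc], h3,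
        ih.mpr ⟨_, _, _, _, rfl, rfl, h4, h2⟩⟩

/-! #### Forgetting sizes -/

theorem E_leaf {x y : X} {s : Trace} : E (leaf x) s y ↔ s = 1 ∧ y = x := by
  simp [E, leaf]

theorem E_tick {R : Rel X} {s : Trace} {x : X} : E (tick R) s x ↔ E R s x := by
  constructor
  · rintro ⟨_, m, rfl, h⟩
    exact ⟨m, h⟩
  · rintro ⟨m, h⟩
    exact ⟨m + 1, m, rfl, h⟩

theorem E_seq2 {R : Rel X} {S : Rel Y} {g : X → Y → Z → Prop} {s : Trace} {z : Z} :
    E (seq2 R S g) s z ↔ ∃ s₁ s₂ x y, s = s₁ * s₂ ∧ E R s₁ x ∧ E S s₂ y ∧ g x y z := by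
  constructor
  · rintro ⟨_, n₁, n₂, s₁, s₂, x, y, rfl, rfl, h1, h2, h3⟩
    exact ⟨s₁, s₂, x, y, rfl, ⟨_, h1⟩, ⟨_, h2⟩, h3⟩
  · rintro ⟨s₁, s₂, x, y, rfl, ⟨n₁, h1⟩, ⟨n₂, h2⟩, h3⟩
    exact ⟨_, n₁, n₂, s₁, s₂, x, y, rfl, rfl, h1, h2, h3⟩

theorem E_relabel {R : Rel X} {g : X → Z → Prop} {s : Trace} {z : Z} :
    E (relabel R g) s z ↔ ∃ x, E R s x ∧ g x z := by
  constructor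
  · rintro ⟨n, x, h1, h2⟩
    exact ⟨x, ⟨n, h1⟩, h2⟩
  · rintro ⟨x, ⟨n, h1⟩, h2⟩
    exact ⟨n, x, h1, h2⟩

theorem E_union {R S : Rel X} {s : Trace} {x : X} : E (union R S) s x ↔ E R s x ∨ E S s x :=
  exists_or

theorem E_under {R : Rel X} {P : List Ev → X → Z → Prop} {s : Trace} {z : Z} :
    E (under R P) s z ↔ ∃ w x, P w x z ∧ E R (scons w s) x := by
  constructor
  · rintro ⟨n, w, x, h1, h2⟩
    exact ⟨w, x, h1, n, h2⟩
  · rintro ⟨w, x, h1, n, h2⟩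
    exact ⟨n, w, x, h1, h2⟩

theorem E_words_nil {R : Rel X} {s : Trace} : E (words R) s [] ↔ s = 1 := by
  simp [E, words_nil]

theorem E_words_cons {R : Rel X} {s : Trace} {a : X} {w : List X} :
    E (words R) s (a :: w) ↔ ∃ s₁ s₂, s = s₁ * s₂ ∧ E R s₁ a ∧ E (words R) s₂ w := by
  constructor
  · rintro ⟨_, h⟩
    obtain ⟨n₁, n₂, s₁, s₂, rfl, rfl, h1, h2⟩ := words_cons.mp h
    exact ⟨s₁, s₂, rfl, ⟨_, h1⟩, ⟨_, h2⟩⟩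
  · rintro ⟨s₁, s₂, rfl, ⟨n₁, h1⟩, ⟨n₂, h2⟩⟩
    exact ⟨_, .cons h1 h2⟩

theorem E_words_congr {R S : Rel X} (h : E R = E S) : E (words R) = E (words S) := by
  funext s w
  apply propext
  induction w generalizing s with
  | nil => rw [E_words_nil, E_words_nil]
  | cons a w ih => simp only [E_words_cons, h, ih]

theorem E_seq2_congr {R R' : Rel X} {S S' : Rel Y} {g : X → Y → Z → Prop} (h : E R = E R')
    (h' : E S = E S') : E (seq2 R S g) = E (seq2 R' S' g) := by
  funext s z
  simp only [E_seq2, h, h']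

/-! #### Supports -/

/-- Identifiers outside `S` have empty sequences. -/
def SuppIn (R : Rel X) (S : ℕ → Prop) : Prop := ∀ n s x, R n s x → ∀ y, ¬ S y → s y = []

theorem suppIn_leaf (x : X) (S : ℕ → Prop) : SuppIn (leaf x) S := by
  rintro n s z ⟨-, rfl, -⟩ y -
  rfl

theorem SuppIn.mono {R : Rel X} {S S' : ℕ → Prop} (h : SuppIn R S) (hS : ∀ y, S y → S' y) :
    SuppIn R S' := fun n s x hR y hy => h n s x hR y (fun h' => hy (hS y h'))

theorem SuppIn.tick {R : Rel X} {S : ℕ → Prop} (h : SuppIn R S) : SuppIn R.tick S := by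
  rintro n s z ⟨m, -, h'⟩
  exact h _ _ _ h'

theorem SuppIn.seq2 {R : Rel X} {R' : Rel Y} {S S' : ℕ → Prop} (h : SuppIn R S)
    (h' : SuppIn R' S') (g : X → Y → Z → Prop) : SuppIn (R.seq2 R' g) (fun y => S y ∨ S' y) := by
  rintro n s z ⟨n₁, n₂, s₁, s₂, x, x', rfl, rfl, h1, h2, -⟩ y hy
  rw [trace_mul, h _ _ _ h1 y (fun k => hy (.inl k)), h' _ _ _ h2 y (fun k => hy (.inr k))]
  rfl

theorem SuppIn.relabel {R : Rel X} {S : ℕ → Prop} (h : SuppIn R S) (g : X → Z → Prop) :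
    SuppIn (R.relabel g) S := by
  rintro n s z ⟨x, h', -⟩
  exact h _ _ _ h'

theorem SuppIn.union {R R' : Rel X} {S S' : ℕ → Prop} (h : SuppIn R S) (h' : SuppIn R' S') :
    SuppIn (R.union R') (fun y => S y ∨ S' y) := by
  rintro n s z (k | k) y hy
  · exact h _ _ _ k y (fun k => hy (.inl k))
  · exact h' _ _ _ k y (fun k => hy (.inr k))

theorem SuppIn.words {R : Rel X} {S : ℕ → Prop} (h : SuppIn R S) : SuppIn R.words S := by
  intro n s w hw y hy
  induction hw with
  | nil => rfl
  | cons h1 _ ih => rw [trace_mul, h _ _ _ h1 y hy, ih]; rfl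

theorem SuppIn.under {R : Rel X} {S : ℕ → Prop} (h : SuppIn R S) (P : List Ev → X → Z → Prop) :
    SuppIn (R.under P) (fun y => S (y + 1)) := by
  rintro n s z ⟨w, x, -, h'⟩ y hy
  exact h _ _ _ h' (y + 1) hy

/-! #### Renaming -/

/-- Rename identifiers so as to avoid `k`. -/
def shift (k : ℕ) (R : Rel X) : Rel X := fun n s x => s k = [] ∧ R n (s ∘ sh k) x

theorem shift_leaf (k : ℕ) (x : X) : shift k (leaf x) = leaf x := by
  funext n s z
  simp only [shift, leaf, eq_iff_iff]
  constructor
  · rintro ⟨h, rfl, h', rfl⟩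
    refine ⟨rfl, ?_, rfl⟩
    rw [← ins_eta k s, h, h', ins_one]
  · rintro ⟨rfl, rfl, rfl⟩
    exact ⟨rfl, rfl, rfl, rfl⟩

theorem shift_tick (k : ℕ) (R : Rel X) : shift k (tick R) = tick (shift k R) := by
  funext n s z
  simp only [shift, tick, eq_iff_iff]
  constructor
  · rintro ⟨h, m, rfl, h'⟩
    exact ⟨m, rfl, h, h'⟩
  · rintro ⟨m, rfl, h, h'⟩
    exact ⟨h, m, rfl, h'⟩

theorem shift_seq2 (k : ℕ) (R : Rel X) (S : Rel Y) (g : X → Y → Z → Prop) :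
    shift k (seq2 R S g) = seq2 (shift k R) (shift k S) g := by
  funext n s z
  simp only [shift, seq2, eq_iff_iff]
  constructor
  · rintro ⟨h, n₁, n₂, s₁, s₂, x, y, rfl, h', h1, h2, h3⟩
    -- Each factor is put back with the empty word at `k`, which is what the product has there.
    refine ⟨n₁, n₂, ins k [] s₁, ins k [] s₂, x, y, rfl, ?_, ⟨ins_self _ _ _, ?_⟩,
      ⟨ins_self _ _ _, ?_⟩, h3⟩
    · rw [← ins_mul, ← h']
      conv_lhs => rw [← ins_eta k s, h]
      rfl
    · rwa [ins_comp_sh]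
    · rwa [ins_comp_sh]
  · rintro ⟨n₁, n₂, s₁, s₂, x, y, rfl, rfl, ⟨k1, h1⟩, ⟨k2, h2⟩, h3⟩
    exact ⟨by rw [trace_mul, k1, k2]; rfl, n₁, n₂, _, _, x, y, rfl, rfl, h1, h2, h3⟩

theorem shift_relabel (k : ℕ) (R : Rel X) (g : X → Z → Prop) :
    shift k (relabel R g) = relabel (shift k R) g := by
  funext n s z
  simp only [shift, relabel, eq_iff_iff]
  constructor
  · rintro ⟨h, x, h1, h2⟩
    exact ⟨x, ⟨h, h1⟩, h2⟩
  · rintro ⟨x, ⟨h, h1⟩, h2⟩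
    exact ⟨h, x, h1, h2⟩

theorem shift_union (k : ℕ) (R S : Rel X) :
    shift k (union R S) = union (shift k R) (shift k S) := by
  funext n s z
  simp only [shift, union, and_or_left]

theorem shift_under (k : ℕ) (R : Rel X) (P : List Ev → X → Z → Prop) :
    shift k (under R P) = under (shift (k + 1) R) P := by
  funext n s z
  simp only [shift, under, eq_iff_iff, scons_comp_sh]
  constructor
  · rintro ⟨h, w, x, h1, h2⟩
    exact ⟨w, x, h1, h, h2⟩
  · rintro ⟨w, x, h1, h, h2⟩
    exact ⟨h, w, x, h1, h2⟩

theorem shift_words (k : ℕ) (R : Rel X) : shift k (words R) = words (shift k R) := by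
  funext n s w
  induction w generalizing n s with
  | nil =>
    simp only [words_nil, shift, eq_iff_iff]
    constructor
    · rintro ⟨h, rfl, h'⟩
      refine ⟨rfl, ?_⟩
      rw [← ins_eta k s, h, h', ins_one]
    · rintro ⟨rfl, rfl⟩
      exact ⟨rfl, rfl, rfl⟩
  | cons a w ih =>
    -- A nonempty word is an observation of `R` followed by a word, that is, a `seq2` that combines
    -- the observations by consing; so the law for `seq2` applies.
    have h1 := congrFun (congrFun (congrFun
      (shift_seq2 k R (words R) (fun x v z => z = x :: v)) n) s) (a :: w)
    have h2 : ∀ (R : Rel X) (S : Rel (List X)) n s,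
        seq2 R S (fun x v z => z = x :: v) n s (a :: w) ↔
          ∃ n₁ n₂ s₁ s₂, n = n₁ + n₂ ∧ s = s₁ * s₂ ∧ R n₁ s₁ a ∧ S n₂ s₂ w := by
      intro R S n s
      constructor
      · rintro ⟨n₁, n₂, s₁, s₂, x, y, rfl, rfl, h1, h2, h3⟩
        obtain ⟨rfl, rfl⟩ := List.cons.inj h3
        exact ⟨n₁, n₂, s₁, s₂, rfl, rfl, h1, h2⟩
      · rintro ⟨n₁, n₂, s₁, s₂, rfl, rfl, h1, h2⟩
        exact ⟨n₁, n₂, s₁, s₂, a, w, rfl, rfl, h1, h2, rfl⟩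
    rw [h2] at h1
    simp only [words_cons, ← ih]
    rw [← h1]
    simp only [shift, words_cons, h2]

/-! #### Substitution -/

/-- Substitute `P` for the identifier `k`. -/
def sub (k : ℕ) (P : Rel Ev) (R : Rel X) : Rel X := fun n s x =>
  ∃ n₁ n₂ u t w, n = n₁ + n₂ ∧ s = u * t ∧ words P n₂ t w ∧ R n₁ (ins k w u) x

/-- No identifier (other than `k`, in `R`) is used by both relations. -/
def Apart (k : ℕ) (P : Rel Ev) (R : Rel X) : Prop :=
  ∀ n s x, R n s x → ∀ m t w, words P m t w → ∀ y, t y = [] ∨ s (sh k y) = []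

theorem SuppIn.apart {P : Rel Ev} {R : Rel X} {k : ℕ} {S S' : ℕ → Prop} (h : SuppIn P S)
    (h' : SuppIn R S') (hS : ∀ y, S y → ¬ S' (sh k y)) : Apart k P R := by
  intro n s x hR m t w hw y
  by_cases hy : S y
  · exact .inr (h' _ _ _ hR _ (hS y hy))
  · exact .inl (h.words _ _ _ hw y hy)

theorem sub_leaf (k : ℕ) (P : Rel Ev) (x : X) : sub k P (leaf x) = leaf x := by
  funext n s z
  simp only [sub, leaf, eq_iff_iff]
  constructor
  · rintro ⟨n₁, n₂, u, t, w, rfl, rfl, hw, rfl, h, rfl⟩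
    rw [← ins_one k] at h
    obtain ⟨rfl, rfl⟩ := ins_inj h
    obtain ⟨rfl, rfl⟩ := words_nil.mp hw
    exact ⟨rfl, by simp, rfl⟩
  · rintro ⟨rfl, rfl, rfl⟩
    exact ⟨0, 0, 1, 1, [], rfl, by simp, .nil, rfl, ins_one k, rfl⟩

theorem sub_tick (k : ℕ) (P : Rel Ev) (R : Rel X) : sub k P (tick R) = tick (sub k P R) := by
  funext n s z
  simp only [sub, tick, eq_iff_iff]
  constructor
  · rintro ⟨_, n₂, u, t, w, rfl, rfl, hw, m, rfl, h⟩
    exact ⟨m + n₂, by omega, m, n₂, u, t, w, rfl, rfl, hw, h⟩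
  · rintro ⟨_, rfl, m, n₂, u, t, w, rfl, rfl, hw, h⟩
    exact ⟨m + 1, n₂, u, t, w, by omega, rfl, hw, m, rfl, h⟩

/-- The uses of `P` split into those made by `R` and those made by `S`. Regrouping `u₁u₂t₁t₂` as
`u₁t₁u₂t₂` only moves `t₁` past `u₂`, so `P` has to be apart from the second relation alone. -/
theorem sub_seq2 {k : ℕ} {P : Rel Ev} {R : Rel X} {S : Rel Y} (g : X → Y → Z → Prop)
    (hS : Apart k P S) : sub k P (seq2 R S g) = seq2 (sub k P R) (sub k P S) g := by
  funext n s z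
  simp only [sub, seq2, eq_iff_iff]
  constructor
  · rintro ⟨_, n₂, u, t, w, rfl, rfl, hw, n₃, n₄, s₁, s₂, x, y, rfl, h, h1, h2, h3⟩
    rw [← ins_eta k s₁, ← ins_eta k s₂, ← ins_mul] at h
    obtain ⟨rfl, rfl⟩ := ins_inj h
    obtain ⟨n₅, n₆, t₁, t₂, rfl, rfl, k1, k2⟩ := words_append.mp hw
    refine ⟨n₃ + n₅, n₄ + n₆, (s₁ ∘ sh k) * t₁, (s₂ ∘ sh k) * t₂, x, y, by omega, ?_,
      ⟨n₃, n₅, _, t₁, _, rfl, rfl, k1, ?_⟩, ⟨n₄, n₆, _, t₂, _, rfl, rfl, k2, ?_⟩, h3⟩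
    · have hc : t₁ * (s₂ ∘ sh k) = (s₂ ∘ sh k) * t₁ := trace_comm (hS _ _ _ h2 _ _ _ k1)
      rw [mul_assoc, mul_assoc, ← mul_assoc t₁, hc, mul_assoc]
    · rwa [ins_eta]
    · rwa [ins_eta]
  · rintro ⟨_, _, _, _, x, y, rfl, rfl, ⟨n₃, n₅, u₁, t₁, w₁, rfl, rfl, k1, h1⟩,
      ⟨n₄, n₆, u₂, t₂, w₂, rfl, rfl, k2, h2⟩, h3⟩
    refine ⟨n₃ + n₄, n₅ + n₆, u₁ * u₂, t₁ * t₂, w₁ ++ w₂, by omega, ?_,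
      words_append.mpr ⟨_, _, _, _, rfl, rfl, k1, k2⟩,
      n₃, n₄, ins k w₁ u₁, ins k w₂ u₂, x, y, rfl, ins_mul _ _ _ _ _, h1, h2, h3⟩
    have hc : t₁ * u₂ = u₂ * t₁ :=
      trace_comm fun y => by simpa only [ins_sh] using hS _ _ _ h2 _ _ _ k1 y
    rw [mul_assoc, mul_assoc, ← mul_assoc t₁, hc, mul_assoc]

theorem sub_relabel (k : ℕ) (P : Rel Ev) (R : Rel X) (g : X → Z → Prop) :
    sub k P (relabel R g) = relabel (sub k P R) g := by
  funext n s z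
  simp only [sub, relabel, eq_iff_iff]
  constructor
  · rintro ⟨n₁, n₂, u, t, w, h1, h2, hw, x, h, hg⟩
    exact ⟨x, ⟨n₁, n₂, u, t, w, h1, h2, hw, h⟩, hg⟩
  · rintro ⟨x, ⟨n₁, n₂, u, t, w, h1, h2, hw, h⟩, hg⟩
    exact ⟨n₁, n₂, u, t, w, h1, h2, hw, x, h, hg⟩

theorem sub_union (k : ℕ) (P : Rel Ev) (R S : Rel X) :
    sub k P (union R S) = union (sub k P R) (sub k P S) := by
  funext n s z
  simp only [sub, union, eq_iff_iff]
  constructor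
  · rintro ⟨n₁, n₂, u, t, w, h1, h2, hw, h | h⟩
    · exact .inl ⟨n₁, n₂, u, t, w, h1, h2, hw, h⟩
    · exact .inr ⟨n₁, n₂, u, t, w, h1, h2, hw, h⟩
  · rintro (⟨n₁, n₂, u, t, w, h1, h2, hw, h⟩ | ⟨n₁, n₂, u, t, w, h1, h2, hw, h⟩)
    · exact ⟨n₁, n₂, u, t, w, h1, h2, hw, .inl h⟩
    · exact ⟨n₁, n₂, u, t, w, h1, h2, hw, .inr h⟩

theorem Apart.words {k : ℕ} {P : Rel Ev} {R : Rel X} (hR : Apart k P R) :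
    Apart k P R.words := by
  intro n s w hw m t v hv y
  induction hw with
  | nil => exact .inr rfl
  | cons h1 _ ih =>
    rcases hR _ _ _ h1 _ _ _ hv y with h | h
    · exact .inl h
    · rcases ih with h' | h'
      · exact .inl h'
      · exact .inr (by rw [trace_mul, h, h']; rfl)

theorem sub_words {k : ℕ} {P : Rel Ev} {R : Rel X} (hR : Apart k P R) :
    sub k P (words R) = words (sub k P R) := by
  funext n s w
  induction w generalizing n s with
  | nil =>
    simp only [words_nil, sub, eq_iff_iff]
    constructor
    · rintro ⟨n₁, n₂, u, t, w, rfl, rfl, hw, rfl, h⟩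
      rw [← ins_one k] at h
      obtain ⟨rfl, rfl⟩ := ins_inj h
      obtain ⟨rfl, rfl⟩ := words_nil.mp hw
      exact ⟨rfl, by simp⟩
    · rintro ⟨rfl, rfl⟩
      exact ⟨0, 0, 1, 1, [], rfl, by simp, .nil, rfl, ins_one k⟩
  | cons a w ih =>
    -- As for renaming, a nonempty word is treated as a `seq2`; apartness from `R` passes to its
    -- words.
    have h1 := congrFun (congrFun (congrFun
      (sub_seq2 (R := R) (fun x v z => z = x :: v) hR.words) n) s) (a :: w)
    have h2 : ∀ (R : Rel X) (S : Rel (List X)) n s,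
        seq2 R S (fun x v z => z = x :: v) n s (a :: w) ↔
          ∃ n₁ n₂ s₁ s₂, n = n₁ + n₂ ∧ s = s₁ * s₂ ∧ R n₁ s₁ a ∧ S n₂ s₂ w := by
      intro R S n s
      constructor
      · rintro ⟨n₁, n₂, s₁, s₂, x, y, rfl, rfl, h1, h2, h3⟩
        obtain ⟨rfl, rfl⟩ := List.cons.inj h3
        exact ⟨n₁, n₂, s₁, s₂, rfl, rfl, h1, h2⟩
      · rintro ⟨n₁, n₂, s₁, s₂, rfl, rfl, h1, h2⟩
        exact ⟨n₁, n₂, s₁, s₂, a, w, rfl, rfl, h1, h2, rfl⟩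
    rw [h2] at h1
    simp only [words_cons, ← ih]
    rw [← h1]
    simp only [sub, words_cons, h2]

/-- Below the binder `P` is shifted, so it contributes nothing at the bound identifier, and the word
bound there comes from `R` alone. -/
theorem sub_under (k : ℕ) (P : Rel Ev) (R : Rel X) (g : List Ev → X → Z → Prop) :
    sub k P (under R g) = under (sub (k + 1) (shift 0 P) R) g := by
  funext n s z
  simp only [sub, under, eq_iff_iff, ← shift_words]
  constructor
  · rintro ⟨n₁, n₂, u, t, w, rfl, rfl, hw, v, x, hg, h⟩
    refine ⟨v, x, hg, n₁, n₂, scons v u, scons [] t, w, rfl, ?_, ⟨rfl, ?_⟩, ?_⟩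
    · rw [← scons_mul, List.append_nil]
    · rw [← ins_zero, ins_comp_sh]
      exact hw
    · rwa [ins_scons]
  · rintro ⟨v, x, hg, n₁, n₂, u, t, w, rfl, hs, ⟨ht, hw⟩, h⟩
    rw [sh_zero] at hw
    rw [← scons_eta u, ← scons_eta t, ht, ← scons_mul, List.append_nil] at hs
    obtain ⟨rfl, rfl⟩ := scons_inj hs
    refine ⟨n₁, n₂, _, _, w, rfl, rfl, hw, u 0, x, hg, ?_⟩
    rwa [← ins_scons, scons_eta]

end Rel

open SCI.Rel

variable {E : Type}

/-! ## The relational semantics of raw terms -/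

/-- The interpretation of terms as relations between traces and events. -/
def sem (I : E → ℕ → ℕ → ℕ) : Tm E → Rel Ev
  | .num n => leaf (.num n)
  | .skip => leaf .star
  | .var x => fun n s b => n = 0 ∧ s = single x b
  | .arith o M N => tick (seq2 (sem I M) (sem I N) fun a c b =>
      ∃ m n, a = .num m ∧ c = .num n ∧ b = .num (o.apply I m n))
  | .seq M N => tick (seq2 (sem I M) (sem I N) fun a c b => a = .star ∧ b = c)
  | .assign M N => tick (seq2 (sem I N) (sem I M) fun a c b =>
      ∃ n, a = .num n ∧ c = .write n ∧ b = .star)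
  | .deref M => tick (relabel (sem I M) fun a b => ∃ n, a = .read n ∧ b = .num n)
  | .loop M N => tick (seq2
      (words (seq2 (sem I M) (sem I N) fun a c (_ : Unit) => a = .num 0 ∧ c = .star)) (sem I M)
      fun _ a b => ∃ m, m ≠ 0 ∧ a = .num m ∧ b = .star)
  | .ifzero M N₁ N₂ => tick (union
      (seq2 (sem I M) (sem I N₁) fun a c b => a = .num 0 ∧ b = c)
      (seq2 (sem I M) (sem I N₂) fun a c b => ∃ m, m ≠ 0 ∧ a = .num m ∧ b = c))
  -- Only words of the annotated type count as arguments. This restriction is what allows raw terms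
  -- to agree with the typed model.
  | .lam A M => tick (under (sem I M) fun w c b => (∀ a ∈ w, TyEv A a) ∧ b = .fn w c)
  | .app M N => tick (seq2 (sem I M) (words (sem I N)) fun a w b => a = .fn w b)
  | .local_ M => tick (under (sem I M) fun w c b => (∃ m, Cell 0 w m) ∧ b = c)
  -- The write component applies `M` to a numeral, which may be used any number `k` of times, always
  -- with the same value and an empty trace.
  | .mkvar M N => tick (union
      (relabel (sem I M) fun a b =>
        ∃ n k, a = .fn (List.replicate k (.num n)) .star ∧ b = .write n)
      (relabel (sem I N) fun a b => ∃ n, a = .num n ∧ b = .read n))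

/-- The identifier `x` occurs free in a term. -/
def Occ : ℕ → Tm E → Prop
  | _, .num _ => False
  | _, .skip => False
  | x, .var y => x = y
  | x, .arith _ M N => Occ x M ∨ Occ x N
  | x, .seq M N => Occ x M ∨ Occ x N
  | x, .assign M N => Occ x M ∨ Occ x N
  | x, .deref M => Occ x M
  | x, .loop M N => Occ x M ∨ Occ x N
  | x, .ifzero M N₁ N₂ => Occ x M ∨ Occ x N₁ ∨ Occ x N₂
  | x, .lam _ M => Occ (x + 1) M
  | x, .app M N => Occ x M ∨ Occ x N
  | x, .local_ M => Occ (x + 1) M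
  | x, .mkvar M N => Occ x M ∨ Occ x N

theorem sem_suppIn (I : E → ℕ → ℕ → ℕ) (M : Tm E) : SuppIn (sem I M) (fun x => Occ x M) := by
  induction M with
  | num n => exact suppIn_leaf _ _
  | skip => exact suppIn_leaf _ _
  | var x =>
    rintro n s b ⟨-, rfl⟩ y hy
    exact if_neg hy
  | arith o M N ihM ihN => exact (ihM.seq2 ihN _).tick
  | seq M N ihM ihN => exact (ihM.seq2 ihN _).tick
  | assign M N ihM ihN => exact ((ihN.seq2 ihM _).mono fun y => Or.symm).tick
  | deref M ih => exact (ih.relabel _).tick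
  | loop M N ihM ihN =>
    exact (((ihM.seq2 ihN _).words.seq2 ihM _).mono fun y => by simp only [Occ]; tauto).tick
  | ifzero M N₁ N₂ ih ih₁ ih₂ =>
    exact (((ih.seq2 ih₁ _).union (ih.seq2 ih₂ _)).mono fun y => by simp only [Occ]; tauto).tick
  | lam A M ih => exact (ih.under _).tick
  | app M N ihM ihN => exact (ihM.seq2 ihN.words _).tick
  | local_ M ih => exact (ih.under _).tick
  | mkvar M N ihM ihN => exact ((ihM.relabel _).union (ihN.relabel _)).tick

-- Renaming and substitution in the relational semantics

theorem single_comp_sh (k x : ℕ) (b : Ev) : single (sh k x) b ∘ sh k = single x b := by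
  funext y
  simp [single, (sh_injective k).eq_iff]

theorem ins_single (k x : ℕ) (b : Ev) : (ins k [] (single x b) : Trace) = single (sh k x) b := by
  funext y
  rcases eq_or_sh k y with rfl | ⟨y, rfl⟩
  · simp [single, ins_self, (sh_ne y x).symm]
  · simp [single, ins_sh, (sh_injective k).eq_iff]

theorem ins_single_self (k : ℕ) (b : Ev) : (ins k [b] 1 : Trace) = single k b := by
  funext y
  rcases eq_or_sh k y with rfl | ⟨y, rfl⟩
  · simp [single, ins_self]
  · simp [single, ins_sh, sh_ne, word_one]

theorem sem_rename (I : E → ℕ → ℕ → ℕ) (M : Tm E) (k : ℕ) :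
    sem I (M.rename (sh k)) = shift k (sem I M) := by
  induction M generalizing k with
  | num n => simp only [Tm.rename, sem, shift_leaf]
  | skip => simp only [Tm.rename, sem, shift_leaf]
  | var x =>
    funext n s b
    simp only [Tm.rename, sem, shift, eq_iff_iff]
    constructor
    · rintro ⟨rfl, rfl⟩
      exact ⟨by simp [single, (sh_ne k x).symm], rfl, single_comp_sh k x b⟩
    · rintro ⟨h, rfl, h'⟩
      refine ⟨rfl, ?_⟩
      rw [← ins_single, ← h', ← h, ins_eta]
  | arith o M N ihM ihN => simp only [Tm.rename, sem, ihM, ihN, shift_tick, shift_seq2]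
  | seq M N ihM ihN => simp only [Tm.rename, sem, ihM, ihN, shift_tick, shift_seq2]
  | assign M N ihM ihN => simp only [Tm.rename, sem, ihM, ihN, shift_tick, shift_seq2]
  | deref M ih => simp only [Tm.rename, sem, ih, shift_tick, shift_relabel]
  | loop M N ihM ihN =>
    simp only [Tm.rename, sem, ihM, ihN, shift_tick, shift_seq2, shift_words]
  | ifzero M N₁ N₂ ih ih₁ ih₂ =>
    simp only [Tm.rename, sem, ih, ih₁, ih₂, shift_tick, shift_seq2, shift_union]
  | lam A M ih => simp only [Tm.rename, sem, upRen_sh, ih, shift_tick, shift_under]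
  | app M N ihM ihN => simp only [Tm.rename, sem, ihM, ihN, shift_tick, shift_seq2, shift_words]
  | local_ M ih => simp only [Tm.rename, sem, upRen_sh, ih, shift_tick, shift_under]
  | mkvar M N ihM ihN =>
    simp only [Tm.rename, sem, ihM, ihN, shift_tick, shift_relabel, shift_union]

theorem occ_rename (r : ℕ → ℕ) (M : Tm E) (y : ℕ) :
    Occ y (M.rename r) ↔ ∃ x, r x = y ∧ Occ x M := by
  have up : ∀ (r : ℕ → ℕ) (M : Tm E) y, (∀ r y, Occ y (M.rename r) ↔ ∃ x, r x = y ∧ Occ x M) →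
      (Occ (y + 1) (M.rename (upRen r)) ↔ ∃ x, r x = y ∧ Occ (x + 1) M) := by
    intro r M y h
    rw [h]
    constructor
    · rintro ⟨_ | x, h1, h2⟩
      · simp [upRen] at h1
      · exact ⟨x, by simpa [upRen] using h1, h2⟩
    · rintro ⟨x, rfl, h2⟩
      exact ⟨x + 1, rfl, h2⟩
  induction M generalizing r y with
  | num n => simp [Tm.rename, Occ]
  | skip => simp [Tm.rename, Occ]
  | var x => simp [Tm.rename, Occ, eq_comm]
  | deref M ih => simp only [Tm.rename, Occ, ih]
  | ifzero M N₁ N₂ ih ih₁ ih₂ =>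
    simp only [Tm.rename, Occ, ih, ih₁, ih₂, and_or_left, exists_or]
  | lam A M ih => exact up r M y ih
  | local_ M ih => exact up r M y ih
  | _ => simp only [Tm.rename, Occ, *, and_or_left, exists_or]

/-- The substitution of `P` for the identifier `k`, where `k` disappears. -/
def inst1 (k : ℕ) (P : Tm E) : ℕ → Tm E :=
  fun x => if x < k then .var x else if x = k then P else .var (x - 1)

theorem inst1_self (k : ℕ) (P : Tm E) : inst1 k P k = P := by simp [inst1]

theorem inst1_sh (k : ℕ) (P : Tm E) (x : ℕ) : inst1 k P (sh k x) = .var x := by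
  simp only [inst1, sh]
  split_ifs <;> first | rfl | omega

/-- Substitution of one term keeps the form `inst1` under binders, so inductions can range over `k`
and `P` and need not handle general substitutions. -/
theorem upSub_inst1 (k : ℕ) (P : Tm E) :
    upSub (inst1 k P) = inst1 (k + 1) (P.rename (sh 0)) := by
  funext y
  rcases eq_or_sh (k + 1) y with rfl | ⟨x, rfl⟩
  · rw [inst1_self, upSub, inst1_self, sh_zero]
  · rw [inst1_sh, ← upRen_sh]
    cases x with
    | zero => rfl
    | succ x => rw [upRen, upSub, inst1_sh]; rfl

theorem Tm.inst_eq (M N : Tm E) : M.inst N = M.subst (inst1 0 N) := by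
  unfold Tm.inst
  congr 1
  funext x
  cases x <;> simp [inst1]

theorem occ_subst {k y : ℕ} {M P : Tm E} (h : Occ y (M.subst (inst1 k P))) :
    Occ (sh k y) M ∨ Occ k M ∧ Occ y P := by
  induction M generalizing k y P with
  | num n => exact h.elim
  | skip => exact h.elim
  | var x =>
    rw [Tm.subst] at h
    rcases eq_or_sh k x with rfl | ⟨x, rfl⟩
    · rw [inst1_self] at h
      exact .inr ⟨rfl, h⟩
    · rw [inst1_sh] at h
      exact .inl (by rw [Occ, show y = x from h])
  | deref M ih => exact ih h
  | lam A M ih =>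
    simp only [Tm.subst, Occ, upSub_inst1] at h ⊢
    refine (ih h).imp (fun h => ?_) (And.imp_right fun h => ?_)
    · rwa [← upRen_sh] at h
    · obtain ⟨x, h1, h2⟩ := (occ_rename _ _ _).mp h
      rw [sh_zero] at h1
      rwa [← Nat.succ_injective h1]
  | local_ M ih =>
    simp only [Tm.subst, Occ, upSub_inst1] at h ⊢
    refine (ih h).imp (fun h => ?_) (And.imp_right fun h => ?_)
    · rwa [← upRen_sh] at h
    · obtain ⟨x, h1, h2⟩ := (occ_rename _ _ _).mp h
      rw [sh_zero] at h1
      rwa [← Nat.succ_injective h1]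
  | ifzero M N₁ N₂ ih ih₁ ih₂ =>
    simp only [Tm.subst, Occ] at h ⊢
    rcases h with h | h | h
    · have := ih h; tauto
    · have := ih₁ h; tauto
    · have := ih₂ h; tauto
  | arith o M N ihM ihN | seq M N ihM ihN | assign M N ihM ihN | loop M N ihM ihN
  | app M N ihM ihN | mkvar M N ihM ihN =>
    simp only [Tm.subst, Occ] at h ⊢
    rcases h with h | h
    · have := ihM h; tauto
    · have := ihN h; tauto

/-- The laws of `sub` push it through every construct; apartness follows from the disjointness of
free identifiers. The equality includes the sizes, and this is what adequacy rests on. -/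
theorem sem_subst (I : E → ℕ → ℕ → ℕ) (M P : Tm E) (k : ℕ)
    (h : ∀ y, Occ y P → ¬ Occ (sh k y) M) :
    sem I (M.subst (inst1 k P)) = sub k (sem I P) (sem I M) := by
  have ap : ∀ (k : ℕ) (P M : Tm E), (∀ y, Occ y P → ¬ Occ (sh k y) M) →
      Apart k (sem I P) (sem I M) :=
    fun k P M h => (sem_suppIn I P).apart (sem_suppIn I M) h
  have up : ∀ (k : ℕ) (P M : Tm E), (∀ y, Occ y P → ¬ Occ (sh k y + 1) M) →
      ∀ y, Occ y (P.rename (sh 0)) → ¬ Occ (sh (k + 1) y) M := by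
    intro k P M h y hy
    obtain ⟨x, rfl, hx⟩ := (occ_rename _ _ _).mp hy
    rw [sh_zero, ← upRen_sh]
    exact h x hx
  induction M generalizing k P with
  | num n => simp only [Tm.subst, sem, sub_leaf]
  | skip => simp only [Tm.subst, sem, sub_leaf]
  | var x =>
    funext n s b
    simp only [Tm.subst, sem, sub, eq_iff_iff]
    rcases eq_or_sh k x with rfl | ⟨x, rfl⟩
    · rw [inst1_self]
      constructor
      · intro h
        refine ⟨0, n + 0, 1, s * 1, [b], by simp, by simp, .cons h .nil, rfl, ?_⟩
        exact ins_single_self x b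
      · rintro ⟨n₁, n₂, u, t, w, rfl, rfl, hw, rfl, h⟩
        rw [← ins_single_self] at h
        obtain ⟨rfl, rfl⟩ := ins_inj h
        obtain ⟨n₁, n₂, s₁, s₂, rfl, rfl, h1, h2⟩ := words_cons.mp hw
        obtain ⟨rfl, rfl⟩ := words_nil.mp h2
        simpa using h1
    · rw [inst1_sh, sem]
      constructor
      · rintro ⟨rfl, rfl⟩
        exact ⟨0, 0, _, 1, [], rfl, by simp, .nil, rfl, ins_single k x b⟩
      · rintro ⟨n₁, n₂, u, t, w, rfl, rfl, hw, rfl, h⟩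
        rw [← ins_single] at h
        obtain ⟨rfl, rfl⟩ := ins_inj h
        obtain ⟨rfl, rfl⟩ := words_nil.mp hw
        simp
  | deref M ih => simp only [Tm.subst, sem, ih P k h, sub_tick, sub_relabel]
  | lam A M ih =>
    simp only [Tm.subst, sem, upSub_inst1, ih _ _ (up _ _ _ h), sub_tick, sub_under, sem_rename]
  | local_ M ih =>
    simp only [Tm.subst, sem, upSub_inst1, ih _ _ (up _ _ _ h), sub_tick, sub_under, sem_rename]
  | ifzero M N₁ N₂ ih ih₁ ih₂ =>
    simp only [Occ, not_or] at h
    simp only [Tm.subst, sem, ih P k fun y hy => (h y hy).1, ih₁ P k fun y hy => (h y hy).2.1,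
      ih₂ P k fun y hy => (h y hy).2.2, sub_tick, sub_union,
      sub_seq2 _ (ap k P N₁ fun y hy => (h y hy).2.1),
      sub_seq2 _ (ap k P N₂ fun y hy => (h y hy).2.2)]
  | arith o M N ihM ihN | seq M N ihM ihN | assign M N ihM ihN | loop M N ihM ihN
  | app M N ihM ihN | mkvar M N ihM ihN =>
    simp only [Occ, not_or] at h
    have hM := fun y hy => (h y hy).1
    have hN := fun y hy => (h y hy).2
    have hM' := ap k P M hM
    have hN' := ap k P N hN
    -- A loop repeats the composite of guard and body, so apartness is needed for this composite
    -- too.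
    have hL : ∀ g : Ev → Ev → Unit → Prop, Apart k (sem I P) (seq2 (sem I M) (sem I N) g) := by
      intro g
      refine (sem_suppIn I P).apart ((sem_suppIn I M).seq2 (sem_suppIn I N) g) fun y hy => ?_
      exact not_or.mpr (h y hy)
    simp only [Tm.subst, sem, ihM P k hM, ihN P k hN, sub_tick, sub_relabel, sub_union,
      sub_seq2 _ hM', sub_seq2 _ hN', sub_seq2 _ hN'.words, sub_words hN', sub_words (hL _)]

/-! ### The semantics up to size -/

theorem E_sem_support (I : E → ℕ → ℕ → ℕ) {M : Tm E} {s : Trace} {b : Ev}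
    (h : Rel.E (sem I M) s b) {x : ℕ} (hx : ¬ Occ x M) : s x = [] :=
  let ⟨n, hn⟩ := h
  sem_suppIn I M n s b hn x hx

/-- Each clause of `sem` depends on its parts only through the relations without sizes. These
contain the traces of open terms, so binders of the context above the hole do no harm. -/
theorem plug_congr (I : E → ℕ → ℕ → ℕ) {M N : Tm E} (h : Rel.E (sem I M) = Rel.E (sem I N))
    (C : Context E) : Rel.E (sem I (C.plug M)) = Rel.E (sem I (C.plug N)) := by
  have ht : ∀ {R S : Rel Ev}, Rel.E R = Rel.E S → Rel.E R.tick = Rel.E S.tick := by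
    intro R S h
    funext s x
    simp only [E_tick, h]
  have hr : ∀ {R S : Rel Ev} (g : Ev → Ev → Prop), Rel.E R = Rel.E S →
      Rel.E (R.relabel g) = Rel.E (S.relabel g) := by
    intro R S g h
    funext s x
    simp only [E_relabel, h]
  have hu : ∀ {R R' S S' : Rel Ev}, Rel.E R = Rel.E S → Rel.E R' = Rel.E S' →
      Rel.E (R.union R') = Rel.E (S.union S') := by
    intro R R' S S' h h'
    funext s x
    simp only [E_union, h, h']
  have hb : ∀ {R S : Rel Ev} (g : List Ev → Ev → Ev → Prop), Rel.E R = Rel.E S →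
      Rel.E (R.under g) = Rel.E (S.under g) := by
    intro R S g h
    funext s x
    simp only [E_under, h]
  induction C with
  | hole => exact h
  | num n => rfl
  | skip => rfl
  | var x => rfl
  | arith o M N ihM ihN => exact ht (E_seq2_congr ihM ihN)
  | seq M N ihM ihN => exact ht (E_seq2_congr ihM ihN)
  | assign M N ihM ihN => exact ht (E_seq2_congr ihN ihM)
  | deref M ih => exact ht (hr _ ih)
  | loop M N ihM ihN => exact ht (E_seq2_congr (E_words_congr (E_seq2_congr ihM ihN)) ihM)
  | ifzero M N₁ N₂ ih ih₁ ih₂ => exact ht (hu (E_seq2_congr ih ih₁) (E_seq2_congr ih ih₂))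
  | lam A M ih => exact ht (hb _ ih)
  | app M N ihM ihN => exact ht (E_seq2_congr ihM (E_words_congr ihN))
  | local_ M ih => exact ht (hb _ ih)
  | mkvar M N ihM ihN => exact ht (hu (hr _ ihM) (hr _ ihN))

/-! ## Typing without contexts -/

/-- Typing relative to an assignment of types to all identifiers. -/
inductive WT : (ℕ → Ty) → Tm E → Ty → Prop
  | var (T : ℕ → Ty) (x : ℕ) : WT T (.var x) (T x)
  | lam {T : ℕ → Ty} {A B : Ty} {M : Tm E} : WT (scons A T) M B → WT T (.lam A M) (.fn A B)
  | app {T : ℕ → Ty} {A B : Ty} {M N : Tm E} : WT T M (.fn A B) → WT T N A →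
      (∀ x, Occ x M → ¬ Occ x N) → WT T (.app M N) B
  | num (T : ℕ → Ty) (n : ℕ) : WT T (.num n) .nat
  | arith {T : ℕ → Ty} {M N : Tm E} (o : Op E) : WT T M .nat → WT T N .nat →
      WT T (.arith o M N) .nat
  | skip (T : ℕ → Ty) : WT T .skip .comm
  | seq {T : ℕ → Ty} {B : Ty} {M N : Tm E} : (B = .comm ∨ B = .nat ∨ B = .var) →
      WT T M .comm → WT T N B → WT T (.seq M N) B
  | assign {T : ℕ → Ty} {M N : Tm E} : WT T M .var → WT T N .nat → WT T (.assign M N) .comm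
  | deref {T : ℕ → Ty} {M : Tm E} : WT T M .var → WT T (.deref M) .nat
  | loop {T : ℕ → Ty} {M N : Tm E} : WT T M .nat → WT T N .comm → WT T (.loop M N) .comm
  | ifzero {T : ℕ → Ty} {B : Ty} {M N₁ N₂ : Tm E} : (B = .comm ∨ B = .nat ∨ B = .var) →
      WT T M .nat → WT T N₁ B → WT T N₂ B → WT T (.ifzero M N₁ N₂) B
  | local_ {T : ℕ → Ty} {B : Ty} {M : Tm E} : (B = .comm ∨ B = .nat) →
      WT (scons .var T) M B → WT T (.local_ M) B
  | mkvar {T : ℕ → Ty} {M N : Tm E} : WT T M (.fn .nat .comm) → WT T N .nat →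
      WT T (.mkvar M N) .var

theorem Cx.Distinct.shift {Γ : Cx} (h : Γ.Distinct) (A : Ty) :
    Cx.Distinct ((0, A) :: Γ.shift) := by
  simp only [Cx.Distinct, Cx.shift, List.map_cons, List.map_map, List.nodup_cons]
  constructor
  · simp
  · rw [show (Prod.fst ∘ fun p : ℕ × Ty => (p.1 + 1, p.2)) = Nat.succ ∘ Prod.fst from rfl,
      ← List.map_map]
    exact List.Nodup.map Nat.succ_injective h

theorem mem_fst_shift {Γ : Cx} {x : ℕ} {A : Ty}
    (h : x + 1 ∈ ((0, A) :: Γ.shift).map Prod.fst) : x ∈ Γ.map Prod.fst := by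
  simpa [Cx.shift] using h

/-- Weakening and exchange do not change the term, so they vanish when types are assigned to all
identifiers. Disjointness of the contexts in an application becomes disjointness of the free
identifiers. -/
theorem Deriv.wt {Γ : Cx} {M : Tm E} {A : Ty} (d : Deriv Γ M A) {T : ℕ → Ty}
    (hT : ∀ p ∈ Γ, T p.1 = p.2) : WT T M A ∧ ∀ x, Occ x M → x ∈ Γ.map Prod.fst := by
  have hS : ∀ {Γ : Cx} {T : ℕ → Ty} (A : Ty), (∀ p ∈ Γ, T p.1 = p.2) →
      ∀ p ∈ (0, A) :: Γ.shift, scons A T p.1 = p.2 := by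
    intro Γ T A hT p hp
    rcases List.mem_cons.mp hp with rfl | hp
    · rfl
    · obtain ⟨q, hq, rfl⟩ := List.mem_map.mp hp
      exact hT q hq
  induction d generalizing T with
  | var x A =>
    refine ⟨?_, fun y hy => by simp [show y = x from hy]⟩
    have := WT.var (E := E) T x
    rwa [hT (x, A) (by simp)] at this
  | lam d ih =>
    obtain ⟨h1, h2⟩ := ih (hS _ hT)
    exact ⟨.lam h1, fun x hx => mem_fst_shift (h2 _ hx)⟩
  | @app Γ Δ A B M N d e hD ihd ihe =>
    obtain ⟨h1, h2⟩ := ihd fun p hp => hT p (List.mem_append_left _ hp)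
    obtain ⟨h3, h4⟩ := ihe fun p hp => hT p (List.mem_append_right _ hp)
    rw [Cx.Distinct, List.map_append] at hD
    refine ⟨.app h1 h3 fun x hM hN => List.disjoint_of_nodup_append hD (h2 x hM) (h4 x hN),
      fun x hx => ?_⟩
    rw [List.map_append, List.mem_append]
    exact hx.imp (h2 x) (h4 x)
  | weakening x A d _ ih =>
    obtain ⟨h1, h2⟩ := ih fun p hp => hT p (List.mem_cons_of_mem _ hp)
    exact ⟨h1, fun y hy => List.mem_cons_of_mem _ (h2 y hy)⟩
  | exchange d hp ih =>
    obtain ⟨h1, h2⟩ := ih fun p h => hT p (hp.mem_iff.mp h)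
    exact ⟨h1, fun y hy => (hp.map _).mem_iff.mp (h2 y hy)⟩
  | num n => exact ⟨.num _ _, fun _ h => h.elim⟩
  | skip => exact ⟨.skip _, fun _ h => h.elim⟩
  | arith o d e ihd ihe =>
    exact ⟨.arith o (ihd hT).1 (ihe hT).1, fun x h => h.elim ((ihd hT).2 x) ((ihe hT).2 x)⟩
  | seq hB d e ihd ihe =>
    exact ⟨.seq hB (ihd hT).1 (ihe hT).1, fun x h => h.elim ((ihd hT).2 x) ((ihe hT).2 x)⟩
  | assign d e ihd ihe =>
    exact ⟨.assign (ihd hT).1 (ihe hT).1, fun x h => h.elim ((ihd hT).2 x) ((ihe hT).2 x)⟩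
  | deref d ih => exact ⟨.deref (ih hT).1, (ih hT).2⟩
  | loop d e ihd ihe =>
    exact ⟨.loop (ihd hT).1 (ihe hT).1, fun x h => h.elim ((ihd hT).2 x) ((ihe hT).2 x)⟩
  | ifzero hB d e₁ e₂ ih ih₁ ih₂ =>
    exact ⟨.ifzero hB (ih hT).1 (ih₁ hT).1 (ih₂ hT).1,
      fun x h => h.elim ((ih hT).2 x) fun h => h.elim ((ih₁ hT).2 x) ((ih₂ hT).2 x)⟩
  | local_ hB d ih =>
    obtain ⟨h1, h2⟩ := ih (hS _ hT)
    exact ⟨.local_ hB h1, fun x hx => mem_fst_shift (h2 _ hx)⟩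
  | mkvar d e ihd ihe =>
    exact ⟨.mkvar (ihd hT).1 (ihe hT).1, fun x h => h.elim ((ihd hT).2 x) ((ihe hT).2 x)⟩

/-- The missing entries are added by weakening and then put in their places by exchange. -/
theorem HasType.of_sublist {Γ Γ' : Cx} {M : Tm E} {A : Ty} (h : HasType Γ M A)
    (hs : Γ.Sublist Γ') (hD : Γ'.Distinct) : HasType Γ' M A := by
  obtain ⟨Δ, hΔ⟩ := hs.exists_perm_append
  have hp : Γ'.Perm (Δ ++ Γ) := hΔ.trans List.perm_append_comm
  have hD' : Cx.Distinct (Δ ++ Γ) := (hp.map Prod.fst).nodup hD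
  suffices h' : HasType (Δ ++ Γ) M A from h'.map fun d => d.exchange hp.symm
  clear hΔ hp
  induction Δ with
  | nil => exact h
  | cons p Δ ih =>
    exact (ih (List.Nodup.of_cons hD')).map fun d => d.weakening p.1 p.2 hD'

theorem WT.hasType {T : ℕ → Ty} {M : Tm E} {A : Ty} (h : WT T M A) {Γ : Cx} (hD : Γ.Distinct)
    (hT : ∀ p ∈ Γ, T p.1 = p.2) (hM : ∀ x, Occ x M → x ∈ Γ.map Prod.fst) : HasType Γ M A := by
  have hS : ∀ {Γ : Cx} {T : ℕ → Ty} (A : Ty), (∀ p ∈ Γ, T p.1 = p.2) →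
      ∀ p ∈ (0, A) :: Γ.shift, scons A T p.1 = p.2 := by
    intro Γ T A hT p hp
    rcases List.mem_cons.mp hp with rfl | hp
    · rfl
    · obtain ⟨q, hq, rfl⟩ := List.mem_map.mp hp
      exact hT q hq
  have hO : ∀ {Γ : Cx} {M : Tm E} (A : Ty), (∀ x, Occ (x + 1) M → x ∈ Γ.map Prod.fst) →
      ∀ x, Occ x M → x ∈ ((0, A) :: Γ.shift).map Prod.fst := by
    intro Γ M A h x hx
    cases x with
    | zero => simp
    | succ x => simpa [Cx.shift] using h x hx
  induction h generalizing Γ with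
  | var T x =>
    obtain ⟨⟨y, B⟩, hp, rfl⟩ := List.mem_map.mp (hM x rfl)
    have := hT _ hp
    exact HasType.of_sublist ⟨this ▸ .var _ _⟩ (List.singleton_sublist.mpr hp) hD
  | lam _ ih => exact (ih (hD.shift _) (hS _ hT) (hO _ hM)).map .lam
  | @app T A B M N _ _ hd ihM ihN =>
    classical
    -- The context is divided between function and argument: entries that occur in `M` go left, all
    -- others right.
    let p : ℕ × Ty → Bool := fun q => decide (Occ q.1 M)
    have hp : (Γ.filter p ++ Γ.filter fun q => !p q).Perm Γ := List.filter_append_perm p Γ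
    have hD' : Cx.Distinct (Γ.filter p ++ Γ.filter fun q => !p q) := (hp.symm.map _).nodup hD
    have hM' : HasType (Γ.filter p) M (.fn A B) := by
      refine ihM (List.Nodup.sublist ((List.filter_sublist (p := p) (l := Γ)).map _) hD)
        (fun q hq => hT q (List.mem_of_mem_filter hq)) fun x hx => ?_
      obtain ⟨q, hq, rfl⟩ := List.mem_map.mp (hM x (.inl hx))
      exact List.mem_map_of_mem (List.mem_filter.mpr ⟨hq, by simpa [p] using hx⟩)
    have hN' : HasType (Γ.filter fun q => !p q) N A := by
      refine ihN (List.Nodup.sublist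
        ((List.filter_sublist (p := fun q => !p q) (l := Γ)).map _) hD)
        (fun q hq => hT q (List.mem_of_mem_filter hq)) fun x hx => ?_
      obtain ⟨q, hq, rfl⟩ := List.mem_map.mp (hM x (.inr hx))
      refine List.mem_map_of_mem (List.mem_filter.mpr ⟨hq, ?_⟩)
      simpa [p] using fun h => hd _ h hx
    obtain ⟨d⟩ := hM'
    obtain ⟨e⟩ := hN'
    exact ⟨(Deriv.app d e hD').exchange hp⟩
  | num T n => exact HasType.of_sublist ⟨.num n⟩ (List.nil_sublist _) hD
  | skip T => exact HasType.of_sublist ⟨.skip⟩ (List.nil_sublist _) hD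
  | arith o _ _ ihM ihN =>
    obtain ⟨d⟩ := ihM hD hT fun x h => hM x (.inl h)
    obtain ⟨e⟩ := ihN hD hT fun x h => hM x (.inr h)
    exact ⟨.arith o d e⟩
  | seq hB _ _ ihM ihN =>
    obtain ⟨d⟩ := ihM hD hT fun x h => hM x (.inl h)
    obtain ⟨e⟩ := ihN hD hT fun x h => hM x (.inr h)
    exact ⟨.seq hB d e⟩
  | assign _ _ ihM ihN =>
    obtain ⟨d⟩ := ihM hD hT fun x h => hM x (.inl h)
    obtain ⟨e⟩ := ihN hD hT fun x h => hM x (.inr h)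
    exact ⟨.assign d e⟩
  | deref _ ih => exact (ih hD hT hM).map .deref
  | loop _ _ ihM ihN =>
    obtain ⟨d⟩ := ihM hD hT fun x h => hM x (.inl h)
    obtain ⟨e⟩ := ihN hD hT fun x h => hM x (.inr h)
    exact ⟨.loop d e⟩
  | ifzero hB _ _ _ ih ih₁ ih₂ =>
    obtain ⟨d⟩ := ih hD hT fun x h => hM x (.inl h)
    obtain ⟨e₁⟩ := ih₁ hD hT fun x h => hM x (.inr (.inl h))
    obtain ⟨e₂⟩ := ih₂ hD hT fun x h => hM x (.inr (.inr h))
    exact ⟨.ifzero hB d e₁ e₂⟩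
  | local_ hB _ ih => exact (ih (hD.shift _) (hS _ hT) (hO _ hM)).map (.local_ hB)
  | mkvar _ _ ihM ihN =>
    obtain ⟨d⟩ := ihM hD hT fun x h => hM x (.inl h)
    obtain ⟨e⟩ := ihN hD hT fun x h => hM x (.inr h)
    exact ⟨.mkvar d e⟩

-- Typing under renaming and substitution

/-- Injectivity keeps the free identifiers of function and argument disjoint. -/
theorem WT.rename {T T' : ℕ → Ty} {M : Tm E} {A : Ty} (h : WT T M A) {r : ℕ → ℕ}
    (hr : Function.Injective r) (hT : ∀ x, Occ x M → T' (r x) = T x) : WT T' (M.rename r) A := by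
  have up : ∀ {r : ℕ → ℕ}, Function.Injective r → Function.Injective (upRen r) := by
    rintro r hr (_ | x) (_ | y) h
    · rfl
    · simp [upRen] at h
    · simp [upRen] at h
    · rw [hr (Nat.succ_injective h)]
  have upT : ∀ {r : ℕ → ℕ} {T T' : ℕ → Ty} {M : Tm E} (A : Ty),
      (∀ x, Occ (x + 1) M → T' (r x) = T x) →
      ∀ x, Occ x M → scons A T' (upRen r x) = scons A T x := by
    rintro r T T' M A h (_ | x) hx
    · rfl
    · exact h x hx
  induction h generalizing T' r with
  | var T x =>
    rw [← hT x rfl]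
    exact .var _ _
  | lam _ ih => exact .lam (ih (up hr) (upT _ hT))
  | app _ _ hd ihM ihN =>
    refine .app (ihM hr fun x h => hT x (.inl h)) (ihN hr fun x h => hT x (.inr h)) ?_
    intro y hM hN
    obtain ⟨x, rfl, hx⟩ := (occ_rename _ _ _).mp hM
    obtain ⟨x', h', hx'⟩ := (occ_rename _ _ _).mp hN
    rw [hr h'] at hx'
    exact hd x hx hx'
  | num T n => exact .num _ _
  | skip T => exact .skip _
  | arith o _ _ ihM ihN =>
    exact .arith o (ihM hr fun x h => hT x (.inl h)) (ihN hr fun x h => hT x (.inr h))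
  | seq hB _ _ ihM ihN =>
    exact .seq hB (ihM hr fun x h => hT x (.inl h)) (ihN hr fun x h => hT x (.inr h))
  | assign _ _ ihM ihN =>
    exact .assign (ihM hr fun x h => hT x (.inl h)) (ihN hr fun x h => hT x (.inr h))
  | deref _ ih => exact .deref (ih hr hT)
  | loop _ _ ihM ihN =>
    exact .loop (ihM hr fun x h => hT x (.inl h)) (ihN hr fun x h => hT x (.inr h))
  | ifzero hB _ _ _ ih ih₁ ih₂ =>
    exact .ifzero hB (ih hr fun x h => hT x (.inl h)) (ih₁ hr fun x h => hT x (.inr (.inl h)))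
      (ih₂ hr fun x h => hT x (.inr (.inr h)))
  | local_ hB _ ih => exact .local_ hB (ih (up hr) (upT _ hT))
  | mkvar _ _ ihM ihN =>
    exact .mkvar (ihM hr fun x h => hT x (.inl h)) (ihN hr fun x h => hT x (.inr h))

theorem WT.rename_sh {T : ℕ → Ty} {M : Tm E} {A : Ty} (h : WT T M A) (B : Ty) :
    WT (scons B T) (M.rename (sh 0)) A :=
  h.rename (sh_injective 0) fun x _ => by rw [sh_zero]; rfl

theorem occ_rename_sh {M : Tm E} {y : ℕ} : Occ y (M.rename (sh 0)) ↔ ∃ x, y = x + 1 ∧ Occ x M := by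
  rw [occ_rename, sh_zero]
  exact exists_congr fun x => and_congr_left' eq_comm

theorem WT.subst {T T' : ℕ → Ty} {M P : Tm E} {A B : Ty} {k : ℕ} (h : WT T' M B)
    (hT : T' = ins k A T) (hP : WT T P A) (hd : ∀ y, Occ y P → ¬ Occ (sh k y) M) :
    WT T (M.subst (inst1 k P)) B := by
  have up : ∀ {k : ℕ} {P M : Tm E}, (∀ y, Occ y P → ¬ Occ (sh k y + 1) M) →
      ∀ y, Occ y (P.rename (sh 0)) → ¬ Occ (sh (k + 1) y) M := by
    intro k P M h y hy
    obtain ⟨x, rfl, hx⟩ := occ_rename_sh.mp hy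
    rw [← upRen_sh]
    exact h x hx
  induction h generalizing T P k with
  | var T' x =>
    subst hT
    rcases eq_or_sh k x with rfl | ⟨x, rfl⟩
    · rw [Tm.subst, inst1_self, ins_self]
      exact hP
    · rw [Tm.subst, inst1_sh, ins_sh]
      exact .var _ _
  | @lam T' C B M _ ih =>
    rw [Tm.subst, upSub_inst1]
    exact .lam (ih (by rw [hT, ins_scons]) (hP.rename_sh C) (up hd))
  | app _ _ hMN ihM ihN =>
    refine .app (ihM hT hP fun y h h' => hd y h (.inl h'))
      (ihN hT hP fun y h h' => hd y h (.inr h')) fun y hM hN => ?_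
    -- A shared identifier cannot come from `M` and `N` themselves, nor from one of them and `P`; if
    -- it came from `P` on both sides, then `k` would occur in both `M` and `N`.
    rcases occ_subst hM with h1 | ⟨h1, h2⟩ <;> rcases occ_subst hN with h3 | ⟨h3, h4⟩
    · exact hMN _ h1 h3
    · exact hd y h4 (.inl h1)
    · exact hd y h2 (.inr h3)
    · exact hMN _ h1 h3
  | num T n => exact .num _ _
  | skip T => exact .skip _
  | arith o _ _ ihM ihN =>
    exact .arith o (ihM hT hP fun y h h' => hd y h (.inl h'))
      (ihN hT hP fun y h h' => hd y h (.inr h'))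
  | seq hB _ _ ihM ihN =>
    exact .seq hB (ihM hT hP fun y h h' => hd y h (.inl h'))
      (ihN hT hP fun y h h' => hd y h (.inr h'))
  | assign _ _ ihM ihN =>
    exact .assign (ihM hT hP fun y h h' => hd y h (.inl h'))
      (ihN hT hP fun y h h' => hd y h (.inr h'))
  | deref _ ih => exact .deref (ih hT hP hd)
  | loop _ _ ihM ihN =>
    exact .loop (ihM hT hP fun y h h' => hd y h (.inl h'))
      (ihN hT hP fun y h h' => hd y h (.inr h'))
  | ifzero hB _ _ _ ih ih₁ ih₂ =>
    exact .ifzero hB (ih hT hP fun y h h' => hd y h (.inl h'))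
      (ih₁ hT hP fun y h h' => hd y h (.inr (.inl h')))
      (ih₂ hT hP fun y h h' => hd y h (.inr (.inr h')))
  | local_ hB _ ih =>
    rw [Tm.subst, upSub_inst1]
    exact .local_ hB (ih (by rw [hT, ins_scons]) (hP.rename_sh .var) (up hd))
  | mkvar _ _ ihM ihN =>
    exact .mkvar (ihM hT hP fun y h h' => hd y h (.inl h'))
      (ihN hT hP fun y h h' => hd y h (.inr h'))

-- Typed traces

/-- All events in the trace have the assigned types. -/
def TyTr (T : ℕ → Ty) (s : Trace) : Prop := ∀ x, ∀ a ∈ s x, TyEv (T x) a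

theorem tyTr_mul {T : ℕ → Ty} {s t : Trace} : TyTr T (s * t) ↔ TyTr T s ∧ TyTr T t := by
  simp only [TyTr, trace_mul, List.mem_append, or_imp, forall_and]

theorem tyTr_one (T : ℕ → Ty) : TyTr T 1 := fun x a h => by
  rw [trace_one] at h
  cases h

theorem tyTr_scons {T : ℕ → Ty} {A : Ty} {w : List Ev} {s : Trace} :
    TyTr (scons A T) (scons w s) ↔ (∀ a ∈ w, TyEv A a) ∧ TyTr T s := by
  constructor
  · exact fun h => ⟨h 0, fun x => h (x + 1)⟩
  · rintro ⟨h, h'⟩ (_ | x)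
    · exact h
    · exact h' x

/-- At a local block the typing of the trace is extended to the cell, whose history consists of
events of type `var`. -/
theorem WT.sound {I : E → ℕ → ℕ → ℕ} {T : ℕ → Ty} {M : Tm E} {A : Ty} (h : WT T M A)
    {n : ℕ} {s : Trace} {b : Ev} (hs : TyTr T s) (hb : sem I M n s b) : TyEv A b := by
  induction h generalizing n s b with
  | var T x =>
    obtain ⟨-, rfl⟩ := hb
    exact hs x b (by simp [single])
  | lam _ ih =>
    obtain ⟨m, rfl, w, c, ⟨hw, rfl⟩, hc⟩ := hb
    exact ⟨w, c, rfl, hw, ih (tyTr_scons.mpr ⟨hw, hs⟩) hc⟩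
  | app _ _ _ ihM ihN =>
    obtain ⟨m, rfl, n₁, n₂, s₁, s₂, a, w, rfl, rfl, h1, h2, rfl⟩ := hb
    obtain ⟨w', c, h, -, hc⟩ := ihM (tyTr_mul.mp hs).1 h1
    cases h
    exact hc
  | num T n =>
    obtain ⟨-, -, rfl⟩ := hb
    exact ⟨_, rfl⟩
  | skip T =>
    obtain ⟨-, -, rfl⟩ := hb
    rfl
  | arith o _ _ ihM ihN =>
    obtain ⟨m, rfl, n₁, n₂, s₁, s₂, a, c, rfl, rfl, h1, h2, k, l, -, -, rfl⟩ := hb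
    exact ⟨_, rfl⟩
  | seq hB _ _ ihM ihN =>
    obtain ⟨m, rfl, n₁, n₂, s₁, s₂, a, c, rfl, rfl, h1, h2, -, rfl⟩ := hb
    exact ihN (tyTr_mul.mp hs).2 h2
  | assign _ _ ihM ihN =>
    obtain ⟨m, rfl, n₁, n₂, s₁, s₂, a, c, rfl, rfl, h1, h2, k, -, -, rfl⟩ := hb
    rfl
  | deref _ ih =>
    obtain ⟨m, rfl, a, h1, k, -, rfl⟩ := hb
    exact ⟨k, rfl⟩
  | loop _ _ ihM ihN =>
    obtain ⟨m, rfl, n₁, n₂, s₁, s₂, a, c, rfl, rfl, h1, h2, k, -, -, rfl⟩ := hb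
    rfl
  | ifzero hB _ _ _ ih ih₁ ih₂ =>
    obtain ⟨m, rfl, h | h⟩ := hb
    · obtain ⟨n₁, n₂, s₁, s₂, a, c, rfl, rfl, h1, h2, -, rfl⟩ := h
      exact ih₁ (tyTr_mul.mp hs).2 h2
    · obtain ⟨n₁, n₂, s₁, s₂, a, c, rfl, rfl, h1, h2, k, -, -, rfl⟩ := h
      exact ih₂ (tyTr_mul.mp hs).2 h2
  | local_ hB _ ih =>
    obtain ⟨m, rfl, w, c, ⟨⟨k, hw⟩, rfl⟩, hc⟩ := hb
    exact ih (tyTr_scons.mpr ⟨cell_typed hw, hs⟩) hc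
  | mkvar _ _ ihM ihN =>
    obtain ⟨m, rfl, ⟨a, h, k, l, rfl, rfl⟩ | ⟨a, h, k, rfl, rfl⟩⟩ := hb
    · exact ⟨k, .inr rfl⟩
    · exact ⟨k, .inl rfl⟩

/-! ## Evaluation and the relational semantics -/

/-- A trace leads from one store to another. -/
def StoreTr : List ℕ → Trace → List ℕ → Prop
  | [], s, [] => s = 1
  | m :: σ, s, m' :: σ' => Cell m (s 0) m' ∧ StoreTr σ (fun x => s (x + 1)) σ'
  | _, _, _ => False

theorem trace_mul_eq_one {s t : Trace} : s * t = 1 ↔ s = 1 ∧ t = 1 := by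
  constructor
  · intro h
    have h' : ∀ x, s x = [] ∧ t x = [] := fun x => List.append_eq_nil_iff.mp (congrFun h x)
    exact ⟨funext fun x => (h' x).1, funext fun x => (h' x).2⟩
  · rintro ⟨rfl, rfl⟩
    exact mul_one 1

/-- This is `cell_append` in each cell. It turns concatenation of traces into threading of the
store. -/
theorem storeTr_mul {σ σ'' : List ℕ} {s t : Trace} :
    StoreTr σ (s * t) σ'' ↔ ∃ σ', StoreTr σ s σ' ∧ StoreTr σ' t σ'' := by
  induction σ generalizing s t σ'' with
  | nil =>
    constructor
    · intro h
      cases σ'' with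
      | nil => exact ⟨[], trace_mul_eq_one.mp h⟩
      | cons => exact h.elim
    · rintro ⟨σ', h1, h2⟩
      cases σ' with
      | nil =>
        cases σ'' with
        | nil => exact trace_mul_eq_one.mpr ⟨h1, h2⟩
        | cons => exact h2.elim
      | cons => exact h1.elim
  | cons m σ ih =>
    constructor
    · intro h
      cases σ'' with
      | nil => exact h.elim
      | cons m'' σ'' =>
        obtain ⟨h1, h2⟩ := h
        obtain ⟨m', h3, h4⟩ := cell_append.mp h1
        obtain ⟨σ', h5, h6⟩ :=
          (ih (s := fun x => s (x + 1)) (t := fun x => t (x + 1))).mp h2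
        exact ⟨m' :: σ', ⟨h3, h5⟩, h4, h6⟩
    · rintro ⟨σ', h1, h2⟩
      cases σ' with
      | nil => exact h1.elim
      | cons m' σ' =>
        cases σ'' with
        | nil => exact h2.elim
        | cons m'' σ'' =>
          exact ⟨cell_append.mpr ⟨m', h1.1, h2.1⟩, ih.mpr ⟨σ', h1.2, h2.2⟩⟩

theorem storeTr_one {σ σ' : List ℕ} : StoreTr σ 1 σ' ↔ σ' = σ := by
  induction σ generalizing σ' with
  | nil => cases σ' <;> simp [StoreTr]
  | cons m σ ih =>
    cases σ' with
    | nil => simp [StoreTr]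
    | cons m' σ' =>
      rw [StoreTr, List.cons.injEq]
      exact and_congr eq_comm ih

theorem single_succ (x : ℕ) (b : Ev) : (fun y => single (x + 1) b (y + 1)) = single x b := by
  funext y
  simp [single]

theorem single_zero_succ (b : Ev) : (fun y => single 0 b (y + 1)) = 1 := by
  funext y
  simp [single, word_one]

/-- With `storeTr_read` this ties single events to the store operations in the evaluation rules; the
side condition is that the identifier belongs to the store. -/
theorem storeTr_write {σ σ' : List ℕ} {x n : ℕ} :
    StoreTr σ (single x (.write n)) σ' ↔ x < σ.length ∧ σ' = σ.set x n := by
  induction σ generalizing σ' x with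
  | nil =>
    cases σ' with
    | nil =>
      simp only [StoreTr, List.length_nil, Nat.not_lt_zero, false_and, iff_false]
      intro h
      simpa [single, word_one] using congrFun h x
    | cons => simp [StoreTr]
  | cons m σ ih =>
    cases σ' with
    | nil => cases x <;> simp [StoreTr]
    | cons m' σ' =>
      cases x with
      | zero =>
        rw [StoreTr, single_zero_succ, storeTr_one]
        simp [single, Cell, eq_comm]
      | succ x =>
        rw [StoreTr, single_succ, ih]
        simp only [single, List.length_cons, List.set_cons_succ, List.cons.injEq]
        simp only [Nat.right_eq_add, Nat.add_eq_zero_iff, one_ne_zero, and_false, if_false, Cell,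
          Nat.add_lt_add_iff_right]
        tauto

theorem storeTr_read {σ σ' : List ℕ} {x n : ℕ} :
    StoreTr σ (single x (.read n)) σ' ↔ σ[x]? = some n ∧ σ' = σ := by
  induction σ generalizing σ' x with
  | nil =>
    cases σ' with
    | nil =>
      simp only [StoreTr, List.getElem?_nil, reduceCtorEq, false_and, iff_false]
      intro h
      simpa [single, word_one] using congrFun h x
    | cons => simp [StoreTr]
  | cons m σ ih =>
    cases σ' with
    | nil => cases x <;> simp [StoreTr]
    | cons m' σ' =>
      cases x with
      | zero =>
        rw [StoreTr, single_zero_succ, storeTr_one]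
        simp only [single, if_true, Cell, List.getElem?_cons_zero, Option.some.injEq,
          List.cons.injEq, eq_comm]
        tauto
      | succ x =>
        rw [StoreTr, single_succ, ih]
        simp only [single, List.getElem?_cons_succ, List.cons.injEq]
        simp only [Nat.right_eq_add, Nat.add_eq_zero_iff, one_ne_zero, and_false, if_false, Cell]
        tauto

/-- The assignment of the type `var` to all identifiers, for terms evaluated in stores. -/
def tv : ℕ → Ty := fun _ => .var

theorem scons_tv : scons .var tv = tv := by
  funext x
  cases x <;> rfl

theorem StoreTr.tyTr {σ σ' : List ℕ} {s : Trace} (h : StoreTr σ s σ') : TyTr tv s := by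
  induction σ generalizing s σ' with
  | nil =>
    cases σ' with
    | nil =>
      rw [show s = 1 from h]
      exact tyTr_one _
    | cons => exact h.elim
  | cons m σ ih =>
    cases σ' with
    | nil => exact h.elim
    | cons m' σ' =>
      rintro (_ | x)
      · exact cell_typed h.1
      · exact ih h.2 x

theorem WT.words_sound {I : E → ℕ → ℕ → ℕ} {T : ℕ → Ty} {M : Tm E} {A : Ty} (h : WT T M A)
    {n : ℕ} {s : Trace} {w : List Ev} (hs : TyTr T s) (hw : words (sem I M) n s w) :
    ∀ a ∈ w, TyEv A a := by
  induction hw with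
  | nil => simp
  | cons h1 _ ih =>
    rw [tyTr_mul] at hs
    exact List.forall_mem_cons.mpr ⟨h.sound hs.1 h1, ih hs.2⟩

/-! ### Values -/

theorem IsValue.comm {V : Tm E} (h : IsValue V) (hV : WT tv V .comm) : V = .skip := by
  generalize hA : Ty.comm = A at hV
  cases h <;> cases hV <;> first | rfl | cases hA

theorem IsValue.nat {V : Tm E} (h : IsValue V) (hV : WT tv V .nat) : ∃ n, V = .num n := by
  generalize hA : Ty.nat = A at hV
  cases h <;> cases hV <;> first | exact ⟨_, rfl⟩ | cases hA

theorem tyTr_single {T : ℕ → Ty} {x : ℕ} {b : Ev} (h : TyTr T (single x b)) : TyEv (T x) b :=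
  h x b (by simp [single])

section

variable {I : E → ℕ → ℕ → ℕ} {V : Tm E} {n k : ℕ} {s : Trace}

/-- Identifiers are excluded by the typing of the trace, since under `tv` they only have reads and
writes. -/
theorem IsValue.sem_num (h : IsValue V) (hs : TyTr tv s) (hV : sem I V n s (.num k)) :
    V = .num k ∧ s = 1 := by
  cases h with
  | num m => obtain ⟨-, rfl, h⟩ := hV; cases h; exact ⟨rfl, rfl⟩
  | skip => obtain ⟨-, -, h⟩ := hV; cases h
  | var x =>
    obtain ⟨-, rfl⟩ := hV
    obtain ⟨m, h | h⟩ := tyTr_single hs <;> cases h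
  | lam A M => obtain ⟨m, -, w, c, ⟨-, h⟩, -⟩ := hV; cases h
  | mkvar M N => obtain ⟨m, -, ⟨a, -, k, l, -, h⟩ | ⟨a, -, k, -, h⟩⟩ := hV <;> cases h

theorem IsValue.sem_star (h : IsValue V) (hs : TyTr tv s) (hV : sem I V n s .star) :
    V = .skip ∧ s = 1 := by
  cases h with
  | num m => obtain ⟨-, -, h⟩ := hV; cases h
  | skip => exact ⟨rfl, hV.2.1⟩
  | var x =>
    obtain ⟨-, rfl⟩ := hV
    obtain ⟨m, h | h⟩ := tyTr_single hs <;> cases h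
  | lam A M => obtain ⟨m, -, w, c, ⟨-, h⟩, -⟩ := hV; cases h
  | mkvar M N => obtain ⟨m, -, ⟨a, -, k, l, -, h⟩ | ⟨a, -, k, -, h⟩⟩ := hV <;> cases h

theorem IsValue.sem_fn (h : IsValue V) (hs : TyTr tv s) {w : List Ev} {b : Ev}
    (hV : sem I V n s (.fn w b)) : ∃ A M, V = .lam A M := by
  cases h with
  | num m => obtain ⟨-, -, h⟩ := hV; cases h
  | skip => obtain ⟨-, -, h⟩ := hV; cases h
  | var x =>
    obtain ⟨-, rfl⟩ := hV
    obtain ⟨m, h | h⟩ := tyTr_single hs <;> cases h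
  | lam A M => exact ⟨A, M, rfl⟩
  | mkvar M N => obtain ⟨m, -, ⟨a, -, k, l, -, h⟩ | ⟨a, -, k, -, h⟩⟩ := hV <;> cases h

/-- In the case of `mkvar` the size drops by one, which makes the read component accessible to the
induction in `sem_runs`. -/
theorem IsValue.sem_read (h : IsValue V) (hV : sem I V n s (.read k)) :
    (∃ x, V = .var x ∧ s = single x (.read k)) ∨
      ∃ m M N, n = m + 1 ∧ V = .mkvar M N ∧ sem I N m s (.num k) := by
  cases h with
  | num m => obtain ⟨-, -, h⟩ := hV; cases h
  | skip => obtain ⟨-, -, h⟩ := hV; cases h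
  | var x => exact .inl ⟨x, rfl, hV.2⟩
  | lam A M => obtain ⟨m, -, w, c, ⟨-, h⟩, -⟩ := hV; cases h
  | mkvar M N =>
    obtain ⟨m, hm, ⟨a, -, k, l, -, h⟩ | ⟨a, h', k, rfl, h⟩⟩ := hV <;> cases h
    exact .inr ⟨m, M, N, hm, rfl, h'⟩

/-- The size is unchanged: the tick of the application replaces that of `mkvar`, and the numeral has
size zero however often it is used. -/
theorem IsValue.sem_write (h : IsValue V) (hV : sem I V n s (.write k)) :
    (∃ x, V = .var x ∧ s = single x (.write k)) ∨
      ∃ M N, V = .mkvar M N ∧ sem I (.app M (.num k)) n s .star := by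
  cases h with
  | num m => obtain ⟨-, -, h⟩ := hV; cases h
  | skip => obtain ⟨-, -, h⟩ := hV; cases h
  | var x => exact .inl ⟨x, rfl, hV.2⟩
  | lam A M => obtain ⟨m, -, w, c, ⟨-, h⟩, -⟩ := hV; cases h
  | mkvar M N =>
    obtain ⟨m, rfl, ⟨a, h', k, l, rfl, h⟩ | ⟨a, -, k, -, h⟩⟩ := hV <;> cases h
    refine .inr ⟨M, N, rfl, m, rfl, m, 0, s, 1, _, _, rfl, (mul_one s).symm, h', ?_, rfl⟩
    clear h'
    induction l with
    | zero => exact .nil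
    | succ l ih =>
      have := words.cons (R := sem I (.num k)) ⟨rfl, rfl, rfl⟩ ih
      simpa [List.replicate_succ] using this

end

/-! ### Soundness of evaluation -/

/-- The third component says that evaluation introduces no identifiers; thus the abstraction
obtained from a function still shares none with the argument. -/
theorem Eval.preserves {I : E → ℕ → ℕ → ℕ} {σ σ' : List ℕ} {M V : Tm E}
    (h : Eval I σ M σ' V) {A : Ty} (hM : WT tv M A) :
    IsValue V ∧ WT tv V A ∧ ∀ x, Occ x V → Occ x M := by
  induction h generalizing A with
  | value hV => exact ⟨hV, hM, fun x h => h⟩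
  | @app σ σ' σ'' M N M' V B _ _ ih1 ih2 =>
    cases hM with
    | app hM hN hd =>
      obtain ⟨-, h1, h2⟩ := ih1 hM
      cases h1 with
      | lam h1 =>
        have hd' : ∀ y, Occ y N → ¬ Occ (sh 0 y) M' := by
          intro y hy hy'
          rw [sh_zero] at hy'
          exact hd y (h2 y hy') hy
        obtain ⟨h3, h4, h5⟩ := ih2 (A := A) (by
          rw [Tm.inst_eq]
          exact h1.subst (ins_zero _ _).symm hN hd')
        refine ⟨h3, h4, fun x hx => ?_⟩
        have := h5 x hx
        rw [Tm.inst_eq] at this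
        rcases occ_subst this with h | h
        · rw [sh_zero] at h
          exact .inl (h2 x h)
        · exact .inr h.2
  | arith o _ _ _ _ =>
    cases hM
    exact ⟨.num _, .num _ _, fun _ h => h.elim⟩
  | assign _ _ _ _ _ =>
    cases hM
    exact ⟨.skip, .skip _, fun _ h => h.elim⟩
  | deref _ _ _ =>
    cases hM
    exact ⟨.num _, .num _ _, fun _ h => h.elim⟩
  | assignMkvar _ _ _ ih1 ih2 ih3 =>
    cases hM with
    | assign hM hN =>
      obtain ⟨-, h1, h2⟩ := ih2 hM
      cases h1 with
      | mkvar h1 _ =>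
        obtain ⟨h3, h4, h5⟩ := ih3 (.app h1 (.num _ _) fun _ _ h => h)
        refine ⟨h3, h4, fun x hx => .inl (h2 x ?_)⟩
        exact (h5 x hx).elim .inl False.elim
  | derefMkvar _ _ ih1 ih2 =>
    cases hM with
    | deref hM =>
      obtain ⟨-, h1, h2⟩ := ih1 hM
      cases h1 with
      | mkvar _ h1 =>
        obtain ⟨h3, h4, h5⟩ := ih2 h1
        exact ⟨h3, h4, fun x hx => h2 x (.inr (h5 x hx))⟩
  | seq _ _ _ ih2 =>
    cases hM with
    | seq hB hM hN =>
      obtain ⟨h3, h4, h5⟩ := ih2 hN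
      exact ⟨h3, h4, fun x hx => .inr (h5 x hx)⟩
  | loopStop _ _ _ =>
    cases hM
    exact ⟨.skip, .skip _, fun _ h => h.elim⟩
  | loopStep _ _ _ _ _ _ =>
    cases hM
    exact ⟨.skip, .skip _, fun _ h => h.elim⟩
  | ifZero _ _ _ ih =>
    cases hM with
    | ifzero hB hM h1 h2 =>
      obtain ⟨h3, h4, h5⟩ := ih h1
      exact ⟨h3, h4, fun x hx => .inr (.inl (h5 x hx))⟩
  | ifNonzero _ _ _ _ ih =>
    cases hM with
    | ifzero hB hM h1 h2 =>
      obtain ⟨h3, h4, h5⟩ := ih h2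
      exact ⟨h3, h4, fun x hx => .inr (.inr (h5 x hx))⟩
  | local_ _ hV ih =>
    cases hM with
    | local_ hB hM =>
      obtain ⟨h3, h4, -⟩ := ih (scons_tv ▸ hM)
      refine ⟨h3, h4, fun x hx => ?_⟩
      rcases hV with rfl | ⟨k, rfl⟩ <;> exact hx.elim

/-- The trace `s'` is the use that will be made of the value later on. The induction needs it
because values such as abstractions and variables have effects of their own when used. -/
theorem Eval.sem {I : E → ℕ → ℕ → ℕ} {σ σ' : List ℕ} {M V : Tm E}
    (h : Eval I σ M σ' V) {A : Ty} (hM : WT tv M A) {s' : Trace} {b : Ev} (hs : TyTr tv s')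
    (hb : Rel.E (sem I V) s' b) : ∃ s, StoreTr σ s σ' ∧ Rel.E (SCI.sem I M) (s * s') b := by
  have E1 : ∀ n, Rel.E (SCI.sem I (.num n)) 1 (.num n) := fun n => E_leaf.mpr ⟨rfl, rfl⟩
  have E2 : Rel.E (SCI.sem I (.skip)) 1 .star := E_leaf.mpr ⟨rfl, rfl⟩
  have E3 : ∀ {s b}, Rel.E (SCI.sem I .skip) s b → s = 1 ∧ b = .star := fun h => E_leaf.mp h
  have E4 : ∀ {n s b}, Rel.E (SCI.sem I (.num n)) s b → s = 1 ∧ b = .num n := fun h => E_leaf.mp h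
  have E5 : ∀ x b, Rel.E (SCI.sem I (.var x)) (single x b) b := fun x b => ⟨0, rfl, rfl⟩
  have hv : ∀ {x b}, TyEv .var b → TyTr tv (single x b) := by
    intro x b hb y a ha
    simp only [single] at ha
    split_ifs at ha
    · rw [List.mem_singleton.mp ha]
      exact hb
    · cases ha
  induction h generalizing A s' b with
  | value hV => exact ⟨1, storeTr_one.mpr rfl, by rwa [one_mul]⟩
  | @app σ σ' σ'' M N M' V B h1 h2 ih1 ih2 =>
    cases hM with
    | @app _ B' _ _ _ hM hN hd =>
      obtain ⟨-, k1, k2⟩ := h1.preserves hM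
      cases k1 with
      | lam k1 =>
        have hd' : ∀ y, Occ y N → ¬ Occ (sh 0 y) M' := by
          intro y hy hy'
          rw [sh_zero] at hy'
          exact hd y (k2 y hy') hy
        obtain ⟨s₂, h3, n, h4⟩ := ih2 (A := A) (by
          rw [Tm.inst_eq]
          exact k1.subst (ins_zero _ _).symm hN hd') hs hb
        rw [Tm.inst_eq, sem_subst _ _ _ _ hd'] at h4
        obtain ⟨n₁, n₂, u, t, w, rfl, hst, hw, h4⟩ := h4
        rw [ins_zero] at h4
        have hut : TyTr tv (u * t) := hst ▸ tyTr_mul.mpr ⟨h3.tyTr, hs⟩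
        rw [tyTr_mul] at hut
        -- The trace of the body splits into `u` and the uses `t` of the argument. The word `w`
        -- obtained from these uses is recorded in the event `.fn w b`, so the later use of the
        -- function value is `u` alone.
        obtain ⟨s₁, h5, h6⟩ := ih1 hM (b := .fn w b) hut.1
          (E_tick.mpr ⟨n₁, w, b, ⟨hN.words_sound hut.2 hw, rfl⟩, h4⟩)
        refine ⟨s₁ * s₂, storeTr_mul.mpr ⟨_, h5, h3⟩, E_tick.mpr (E_seq2.mpr
          ⟨s₁ * u, t, _, w, ?_, h6, ⟨n₂, hw⟩, rfl⟩)⟩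
        rw [mul_assoc, hst, mul_assoc]
  | arith o h1 h2 ih1 ih2 =>
    cases hM with
    | arith _ hM hN =>
      obtain ⟨rfl, rfl⟩ := E4 hb
      obtain ⟨s₁, k1, k2⟩ := ih1 hM (tyTr_one _) (E1 _)
      obtain ⟨s₂, k3, k4⟩ := ih2 hN (tyTr_one _) (E1 _)
      rw [mul_one] at k2 k4
      refine ⟨s₁ * s₂, storeTr_mul.mpr ⟨_, k1, k3⟩, ?_⟩
      rw [mul_one]
      exact E_tick.mpr (E_seq2.mpr ⟨_, _, _, _, rfl, k2, k4, _, _, rfl, rfl, rfl⟩)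
  | assign h1 h2 hx ih1 ih2 =>
    cases hM with
    | assign hM hN =>
      obtain ⟨rfl, rfl⟩ := E3 hb
      obtain ⟨s₁, k1, k2⟩ := ih1 hN (tyTr_one _) (E1 _)
      obtain ⟨s₂, k3, k4⟩ := ih2 hM (hv ⟨_, .inr rfl⟩) (E5 _ (.write _))
      rw [mul_one] at k2
      refine ⟨s₁ * (s₂ * single _ (.write _)), storeTr_mul.mpr ⟨_, k1, storeTr_mul.mpr
        ⟨_, k3, storeTr_write.mpr ⟨hx, rfl⟩⟩⟩, ?_⟩
      rw [mul_one]
      exact E_tick.mpr (E_seq2.mpr ⟨_, _, _, _, rfl, k2, k4, _, rfl, rfl, rfl⟩)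
  | deref h1 hx ih =>
    cases hM with
    | deref hM =>
      obtain ⟨rfl, rfl⟩ := E4 hb
      obtain ⟨s₂, k3, k4⟩ := ih hM (hv ⟨_, .inl rfl⟩) (E5 _ (.read _))
      refine ⟨s₂ * single _ (.read _), storeTr_mul.mpr
        ⟨_, k3, storeTr_read.mpr ⟨hx, rfl⟩⟩, ?_⟩
      rw [mul_one]
      exact E_tick.mpr (E_relabel.mpr ⟨_, k4, _, rfl, rfl⟩)
  | @assignMkvar σ σ' σ'' σ''' M N M₁ M₂ V n h1 h2 h3 ih1 ih2 ih3 =>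
    cases hM with
    | assign hM hN =>
      obtain ⟨-, k1, k2⟩ := h2.preserves hM
      cases k1 with
      | mkvar k1 k1' =>
        have hW : WT tv (.app M₁ (.num n)) .comm := .app k1 (.num tv n) fun _ _ h => h
        obtain ⟨k3, k4, -⟩ := h3.preserves hW
        obtain rfl := k3.comm k4
        obtain ⟨rfl, rfl⟩ := E3 hb
        obtain ⟨s₁, k5, k6⟩ := ih1 hN (tyTr_one _) (E1 _)
        obtain ⟨s₃, k7, k8⟩ := ih3 hW (tyTr_one _) E2
        rw [mul_one] at k6 k8
        obtain ⟨u, t, a, w, rfl, h4, h5, rfl⟩ := E_seq2.mp (E_tick.mp k8)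
        -- The argument is a numeral, so every word of its uses is constant and leaves no trace;
        -- this is the shape demanded by the clause for `mkvar`.
        obtain ⟨rfl, j, rfl⟩ : t = 1 ∧ ∃ j, w = List.replicate j (.num n) := by
          clear k7 k8 h4
          induction w generalizing t with
          | nil => exact ⟨E_words_nil.mp h5, 0, rfl⟩
          | cons a w ih =>
            obtain ⟨t₁, t₂, rfl, h6, h7⟩ := E_words_cons.mp h5
            obtain ⟨rfl, rfl⟩ := E4 h6
            obtain ⟨rfl, j, rfl⟩ := ih _ h7
            exact ⟨mul_one 1, j + 1, rfl⟩
        rw [mul_one] at k7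
        obtain ⟨s₂, k9, k10⟩ := ih2 hM k7.tyTr
          (E_tick.mpr (E_union.mpr (.inl (E_relabel.mpr ⟨_, h4, n, j, rfl, rfl⟩))))
        refine ⟨s₁ * (s₂ * u), storeTr_mul.mpr ⟨_, k5, storeTr_mul.mpr ⟨_, k9, k7⟩⟩, ?_⟩
        rw [mul_one]
        exact E_tick.mpr (E_seq2.mpr ⟨_, _, _, _, rfl, k6, k10, _, rfl, rfl, rfl⟩)
  | derefMkvar h1 h2 ih1 ih2 =>
    cases hM with
    | deref hM =>
      obtain ⟨-, k1, k2⟩ := h1.preserves hM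
      cases k1 with
      | mkvar k1 k1' =>
        obtain ⟨k3, k4, -⟩ := h2.preserves k1'
        obtain ⟨n, rfl⟩ := k3.nat k4
        obtain ⟨rfl, rfl⟩ := E4 hb
        obtain ⟨s₂, k5, k6⟩ := ih2 k1' (tyTr_one _) (E1 _)
        rw [mul_one] at k6
        obtain ⟨s₁, k7, k8⟩ := ih1 hM (b := .read n) k5.tyTr
          (E_tick.mpr (E_union.mpr (.inr (E_relabel.mpr ⟨_, k6, _, rfl, rfl⟩))))
        refine ⟨s₁ * s₂, storeTr_mul.mpr ⟨_, k7, k5⟩, ?_⟩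
        rw [mul_one]
        exact E_tick.mpr (E_relabel.mpr ⟨_, k8, _, rfl, rfl⟩)
  | seq h1 h2 ih1 ih2 =>
    cases hM with
    | seq hB hM hN =>
      obtain ⟨s₁, k1, k2⟩ := ih1 hM (tyTr_one _) E2
      obtain ⟨s₂, k3, k4⟩ := ih2 hN hs hb
      rw [mul_one] at k2
      refine ⟨s₁ * s₂, storeTr_mul.mpr ⟨_, k1, k3⟩, ?_⟩
      rw [mul_assoc]
      exact E_tick.mpr (E_seq2.mpr ⟨_, _, _, _, rfl, k2, k4, rfl, rfl⟩)
  | loopStop h1 hn ih1 =>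
    cases hM with
    | loop hM hN =>
      obtain ⟨rfl, rfl⟩ := E3 hb
      obtain ⟨s₁, k1, k2⟩ := ih1 hM (tyTr_one _) (E1 _)
      refine ⟨s₁, k1, E_tick.mpr (E_seq2.mpr ⟨1, _, [], _, (one_mul _).symm, E_words_nil.mpr rfl,
        k2, _, hn, rfl, rfl⟩)⟩
  | loopStep h1 h2 h3 ih1 ih2 ih3 =>
    cases hM with
    | loop hM hN =>
      obtain ⟨rfl, rfl⟩ := E3 hb
      obtain ⟨s₁, k1, k2⟩ := ih1 hM (tyTr_one _) (E1 _)
      obtain ⟨s₂, k3, k4⟩ := ih2 hN (tyTr_one _) E2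
      obtain ⟨s₃, k5, k6⟩ := ih3 (.loop hM hN) (tyTr_one _) E2
      rw [mul_one] at k2 k4 k6
      obtain ⟨s₄, s₅, w, a, rfl, k7, k8, k9⟩ := E_seq2.mp (E_tick.mp k6)
      refine ⟨s₁ * (s₂ * (s₄ * s₅)),
        storeTr_mul.mpr ⟨_, k1, storeTr_mul.mpr ⟨_, k3, k5⟩⟩, ?_⟩
      refine E_tick.mpr (E_seq2.mpr ⟨(s₁ * s₂) * s₄, s₅, () :: w, a, ?_,
        E_words_cons.mpr ⟨_, _, rfl, E_seq2.mpr ⟨_, _, _, _, rfl, k2, k4, rfl, rfl⟩, k7⟩, k8, k9⟩)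
      simp only [mul_assoc, mul_one]
  | ifZero h1 h2 ih1 ih2 =>
    cases hM with
    | ifzero hB hM hN hN' =>
      obtain ⟨s₁, k1, k2⟩ := ih1 hM (tyTr_one _) (E1 _)
      obtain ⟨s₂, k3, k4⟩ := ih2 hN hs hb
      rw [mul_one] at k2
      refine ⟨s₁ * s₂, storeTr_mul.mpr ⟨_, k1, k3⟩, ?_⟩
      rw [mul_assoc]
      exact E_tick.mpr (E_union.mpr (.inl (E_seq2.mpr ⟨_, _, _, _, rfl, k2, k4, rfl, rfl⟩)))
  | ifNonzero h1 hn h2 ih1 ih2 =>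
    cases hM with
    | ifzero hB hM hN hN' =>
      obtain ⟨s₁, k1, k2⟩ := ih1 hM (tyTr_one _) (E1 _)
      obtain ⟨s₂, k3, k4⟩ := ih2 hN' hs hb
      rw [mul_one] at k2
      refine ⟨s₁ * s₂, storeTr_mul.mpr ⟨_, k1, k3⟩, ?_⟩
      rw [mul_assoc]
      exact E_tick.mpr (E_union.mpr (.inr
        (E_seq2.mpr ⟨_, _, _, _, rfl, k2, k4, _, hn, rfl, rfl⟩)))
  | local_ h1 hV ih =>
    cases hM with
    | local_ hB hM =>
      rw [scons_tv] at hM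
      -- A block returns a constant, so no later use of its value has to be carried past the
      -- discarded cell.
      have hs' : s' = 1 := by
        rcases hV with rfl | ⟨k, rfl⟩
        · exact (E3 hb).1
        · exact (E4 hb).1
      subst hs'
      obtain ⟨s, k1, k2⟩ := ih hM (tyTr_one _) hb
      refine ⟨fun x => s (x + 1), k1.2, E_tick.mpr (E_under.mpr
        ⟨s 0, b, ⟨⟨_, k1.1⟩, rfl⟩, ?_⟩)⟩
      rw [mul_one] at k2 ⊢
      rwa [scons_eta]

/-! ### Adequacy -/

/-- The evaluation of `M` accounts for a prefix of the trace `s`, and the resulting value for the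
rest of it. -/
def Runs (I : E → ℕ → ℕ → ℕ) (M : Tm E) (A : Ty) (n : ℕ) (s : Trace) (b : Ev) : Prop :=
  ∃ s₁ s₂ V n', s = s₁ * s₂ ∧ n' ≤ n ∧ IsValue V ∧ WT tv V A ∧ (∀ x, Occ x V → Occ x M) ∧
    sem I V n' s₂ b ∧ ∀ σ σ', StoreTr σ s₁ σ' → Eval I σ M σ' V

section

variable {I : E → ℕ → ℕ → ℕ} {M : Tm E} {A : Ty} {n k : ℕ} {s : Trace} {σ σ' : List ℕ}

theorem Runs.num (h : Runs I M A n s (.num k)) (hs : StoreTr σ s σ') :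
    Eval I σ M σ' (.num k) := by
  obtain ⟨s₁, s₂, V, n', rfl, -, hV, -, -, h, hE⟩ := h
  obtain ⟨rfl, rfl⟩ := hV.sem_num (tyTr_mul.mp hs.tyTr).2 h
  rw [mul_one] at hs
  exact hE _ _ hs

theorem Runs.star (h : Runs I M A n s .star) (hs : StoreTr σ s σ') :
    Eval I σ M σ' .skip := by
  obtain ⟨s₁, s₂, V, n', rfl, -, hV, -, -, h, hE⟩ := h
  obtain ⟨rfl, rfl⟩ := hV.sem_star (tyTr_mul.mp hs.tyTr).2 h
  rw [mul_one] at hs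
  exact hE _ _ hs

theorem Runs.value (hV : IsValue M) (hM : WT tv M A) {b : Ev} (h : sem I M n s b) :
    Runs I M A n s b :=
  ⟨1, s, M, n, (one_mul s).symm, le_rfl, hV, hM, fun _ h => h, h, fun σ σ' hσ => by
    rw [storeTr_one.mp hσ]
    exact .value hV⟩

theorem Runs.of_num (h : ∀ σ σ', StoreTr σ s σ' → Eval I σ M σ' (.num k)) :
    Runs I M .nat n s (.num k) :=
  ⟨s, 1, .num k, 0, (mul_one s).symm, Nat.zero_le _, .num k, .num _ _, fun _ h => h.elim,
    ⟨rfl, rfl, rfl⟩, h⟩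

theorem Runs.of_star (h : ∀ σ σ', StoreTr σ s σ' → Eval I σ M σ' .skip) :
    Runs I M .comm n s .star :=
  ⟨s, 1, .skip, 0, (mul_one s).symm, Nat.zero_le _, .skip, .skip _, fun _ h => h.elim,
    ⟨rfl, rfl, rfl⟩, h⟩

/-- Prefixing an evaluation. -/
theorem Runs.step {M' : Tm E} {s' : Trace} {n' : ℕ} {b : Ev} (h : Runs I M' A n' s' b)
    (hn : n' ≤ n) (hO : ∀ x, Occ x M' → Occ x M)
    (hE : ∀ σ σ', StoreTr σ s σ' → ∀ σ'' V, Eval I σ' M' σ'' V → Eval I σ M σ'' V) :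
    Runs I M A n (s * s') b := by
  obtain ⟨s₁, s₂, V, m, rfl, hm, hV, hT, hO', h, hE'⟩ := h
  refine ⟨s * s₁, s₂, V, m, (mul_assoc _ _ _).symm, hm.trans hn, hV, hT,
    fun x hx => hO x (hO' x hx), h, fun σ σ'' hσ => ?_⟩
  obtain ⟨σ', h1, h2⟩ := storeTr_mul.mp hσ
  exact hE _ _ h1 _ _ (hE' _ _ h2)

end

/-- Strong induction on the size. The residual size of a value never exceeds that of the term, and
each recursive call is on a strictly smaller size, even where the term itself grows by substitution.
-/
theorem sem_runs (I : E → ℕ → ℕ → ℕ) (n : ℕ) : ∀ {M : Tm E} {A : Ty} {s : Trace} {b : Ev},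
    WT tv M A → TyTr tv s → sem I M n s b → Runs I M A n s b := by
  induction n using Nat.strong_induction_on with
  | _ n ih =>
  intro M A s b hM hs h
  cases hM with
  | var x => exact .value (.var _) (.var _ _) h
  | lam hM => exact .value (.lam _ _) (.lam hM) h
  | num n => exact .value (.num _) (.num _ _) h
  | skip => exact .value .skip (.skip _) h
  | mkvar hM hN => exact .value (.mkvar _ _) (.mkvar hM hN) h
  | @app _ B A M N hM hN hd =>
    obtain ⟨m, rfl, n₁, n₂, s₁, s₂, a, w, rfl, rfl, h1, h2, rfl⟩ := h
    rw [tyTr_mul] at hs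
    obtain ⟨s₃, s₄, V, n₃, rfl, hn₃, hV, hT, hO, h3, hE⟩ := ih n₁ (by omega) hM hs.1 h1
    rw [tyTr_mul] at hs
    obtain ⟨C, M', rfl⟩ := hV.sem_fn hs.1.2 h3
    cases hT with
    | lam hT =>
      obtain ⟨m, rfl, w', c, ⟨-, heq⟩, h3⟩ := h3
      cases heq
      have hd' : ∀ y, Occ y N → ¬ Occ (sh 0 y) M' := by
        intro y hy hy'
        rw [sh_zero] at hy'
        exact hd y (hO y hy') hy
      -- The abstraction has size `m + 1`, at most `n₁`. Hence `m + n₂` is below `n₁ + n₂`, while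
      -- the application has size `n₁ + n₂ + 1`.
      have h4 : sem I (M'.inst N) (m + n₂) (s₄ * s₂) b := by
        rw [Tm.inst_eq, sem_subst _ _ _ _ hd']
        exact ⟨m, n₂, s₄, s₂, w, rfl, rfl, h2, by rwa [ins_zero]⟩
      have hT' : WT tv (M'.inst N) A := by
        rw [Tm.inst_eq]
        exact hT.subst (ins_zero _ _).symm hN hd'
      rw [mul_assoc]
      refine (ih (m + n₂) (by omega) hT' (tyTr_mul.mpr ⟨hs.1.2, hs.2⟩) h4).step (by omega) ?_
        fun σ σ' hσ σ'' V hE' => .app (hE _ _ hσ) hE'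
      intro x hx
      rw [Tm.inst_eq] at hx
      rcases occ_subst hx with h | h
      · rw [sh_zero] at h
        exact .inl (hO x h)
      · exact .inr h.2
  | arith o hM hN =>
    obtain ⟨m, rfl, n₁, n₂, s₁, s₂, a, c, rfl, rfl, h1, h2, k, l, rfl, rfl, rfl⟩ := h
    rw [tyTr_mul] at hs
    refine .of_num fun σ σ'' hσ => ?_
    obtain ⟨σ', k1, k2⟩ := storeTr_mul.mp hσ
    exact .arith o ((ih n₁ (by omega) hM hs.1 h1).num k1) ((ih n₂ (by omega) hN hs.2 h2).num k2)
  | seq hB hM hN =>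
    obtain ⟨m, rfl, n₁, n₂, s₁, s₂, a, c, rfl, rfl, h1, h2, rfl, rfl⟩ := h
    rw [tyTr_mul] at hs
    exact (ih n₂ (by omega) hN hs.2 h2).step (by omega) (fun x hx => .inr hx)
      fun σ σ' hσ σ'' V hE => .seq ((ih n₁ (by omega) hM hs.1 h1).star hσ) hE
  | assign hM hN =>
    obtain ⟨m, rfl, n₁, n₂, s₁, s₂, a, c, rfl, rfl, h1, h2, k, rfl, rfl, rfl⟩ := h
    rw [tyTr_mul] at hs
    refine .of_star fun σ σ₃ hσ => ?_
    obtain ⟨σ₁, k1, k2⟩ := storeTr_mul.mp hσ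
    have hE1 := (ih n₁ (by omega) hN hs.1 h1).num k1
    obtain ⟨s₃, s₄, V, n₃, rfl, hn₃, hV, hT, hO, h3, hE⟩ := ih n₂ (by omega) hM hs.2 h2
    obtain ⟨σ₂, k3, k4⟩ := storeTr_mul.mp k2
    rcases hV.sem_write h3 with ⟨x, rfl, rfl⟩ | ⟨M₁, M₂, rfl, h4⟩
    · obtain ⟨hx, rfl⟩ := storeTr_write.mp k4
      exact .assign hE1 (hE _ _ k3) hx
    · cases hT with
      | mkvar hT hT' =>
        -- The application that performs the write has size `n₃`, at most the size of the
        -- observation of `M`, hence below that of the assignment.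
        exact .assignMkvar hE1 (hE _ _ k3) ((ih n₃ (by omega)
          (.app hT (.num _ _) fun _ _ h => h) k4.tyTr h4).star k4)
  | deref hM =>
    obtain ⟨m, rfl, a, h1, k, rfl, rfl⟩ := h
    refine .of_num fun σ σ₂ hσ => ?_
    obtain ⟨s₃, s₄, V, n₃, rfl, hn₃, hV, hT, hO, h3, hE⟩ := ih m (by omega) hM hs h1
    obtain ⟨σ₁, k3, k4⟩ := storeTr_mul.mp hσ
    rcases hV.sem_read h3 with ⟨x, rfl, rfl⟩ | ⟨m', M₁, M₂, rfl, rfl, h4⟩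
    · obtain ⟨hx, rfl⟩ := storeTr_read.mp k4
      exact .deref (hE _ _ k3) hx
    · cases hT with
      | mkvar hT hT' =>
        exact .derefMkvar (hE _ _ k3) ((ih m' (by omega) hT' k4.tyTr h4).num k4)
  | @loop _ M N hM hN =>
    obtain ⟨m, rfl, n₁, n₂, s₁, s₂, v, c, rfl, rfl, h1, h2, k, hk, rfl, rfl⟩ := h
    rw [tyTr_mul] at hs
    refine .of_star fun σ σ₂ hσ => ?_
    obtain ⟨σ₁, k1, k2⟩ := storeTr_mul.mp hσ
    have hE := Eval.loopStop (N := N) ((ih n₂ (by omega) hM hs.2 h2).num k2) hk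
    have hn : n₁ ≤ n₁ + n₂ := by omega
    -- The final, failing test has been evaluated; the iterations are now prepended by an inner
    -- induction. Only the bound on their total size is kept, so that `ih` stays fixed while this
    -- size varies.
    generalize n₁ + n₂ = m at ih hn
    clear hσ h2 hk
    induction h1 generalizing σ with
    | nil =>
      rw [← storeTr_one.mp k1]
      exact hE
    | cons h1 h2 ih' =>
      obtain ⟨n₃, n₄, s₃, s₄, a, c, rfl, rfl, h3, h4, rfl, rfl⟩ := h1
      obtain ⟨σ₄, k3, k4⟩ := storeTr_mul.mp k1
      obtain ⟨σ₃, k5, k6⟩ := storeTr_mul.mp k3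
      exact .loopStep ((ih n₃ (by omega) hM k5.tyTr h3).num k5)
        ((ih n₄ (by omega) hN k6.tyTr h4).star k6) (ih' ⟨k4.tyTr, hs.2⟩ _ k4 (by omega))
  | ifzero hB hM hN₁ hN₂ =>
    obtain ⟨m, rfl, h | h⟩ := h
    · obtain ⟨n₁, n₂, s₁, s₂, a, c, rfl, rfl, h1, h2, rfl, rfl⟩ := h
      rw [tyTr_mul] at hs
      exact (ih n₂ (by omega) hN₁ hs.2 h2).step (by omega) (fun x hx => .inr (.inl hx))
        fun σ σ' hσ σ'' V hE => .ifZero ((ih n₁ (by omega) hM hs.1 h1).num hσ) hE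
    · obtain ⟨n₁, n₂, s₁, s₂, a, c, rfl, rfl, h1, h2, k, hk, rfl, rfl⟩ := h
      rw [tyTr_mul] at hs
      exact (ih n₂ (by omega) hN₂ hs.2 h2).step (by omega) (fun x hx => .inr (.inr hx))
        fun σ σ' hσ σ'' V hE => .ifNonzero ((ih n₁ (by omega) hM hs.1 h1).num hσ) hk hE
  | local_ hB hM =>
    obtain ⟨m, rfl, w, c, ⟨⟨k, hw⟩, rfl⟩, h⟩ := h
    have hs' : TyTr tv (scons w s) := by
      have := tyTr_scons.mpr ⟨cell_typed hw, hs⟩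
      rwa [scons_tv] at this
    -- Blocks have type `comm` or `nat`, so typing identifies the observation as a constant.
    have hb := hM.sound (by rw [scons_tv]; exact hs') h
    rw [scons_tv] at hM
    have hR := ih m (by omega) hM hs' h
    rcases hB with rfl | rfl
    · obtain rfl : b = .star := hb
      exact .of_star fun σ σ' hσ =>
        .local_ (hR.star (σ := 0 :: σ) (σ' := k :: σ') ⟨hw, hσ⟩) (.inl rfl)
    · obtain ⟨l, rfl⟩ := hb
      exact .of_num fun σ σ' hσ =>
        .local_ (hR.num (σ := 0 :: σ) (σ' := k :: σ') ⟨hw, hσ⟩) (.inr ⟨l, rfl⟩)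

/-- Only the empty trace leads from the empty store to itself. -/
theorem eval_skip_iff (I : E → ℕ → ℕ → ℕ) {M : Tm E} (hM : WT tv M .comm) :
    Eval I [] M [] .skip ↔ Rel.E (sem I M) 1 .star := by
  constructor
  · intro h
    obtain ⟨s, h1, h2⟩ := h.sem hM (tyTr_one _) (E_leaf.mpr ⟨rfl, rfl⟩)
    rw [show s = 1 from h1, mul_one] at h2
    exact h2
  · rintro ⟨n, h⟩
    exact (sem_runs I n hM (tyTr_one _) h).star rfl

theorem eval_num_iff (I : E → ℕ → ℕ → ℕ) {M : Tm E} (hM : WT tv M .nat) (k : ℕ) :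
    Eval I [] M [] (.num k) ↔ Rel.E (sem I M) 1 (.num k) := by
  constructor
  · intro h
    obtain ⟨s, h1, h2⟩ := h.sem hM (tyTr_one _) (E_leaf.mpr ⟨rfl, rfl⟩)
    rw [show s = 1 from h1, mul_one] at h2
    exact h2
  · rintro ⟨n, h⟩
    exact (sem_runs I n hM (tyTr_one _) h).num rfl

/-! ## The model and the semantics of raw terms -/

/-- Events of a type, as untyped events. -/
def emb : (A : Ty) → Event A → Ev
  | .nat, n => .num n
  | .comm, _ => .star
  | .var, .read n => .read n
  | .var, .write n => .write n
  | .fn A B, p => .fn (p.1.toList.map (emb A)) (emb B p.2)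

/-- Words of events of a type, as untyped words. -/
def embW (A : Ty) (w : Obj A) : List Ev := w.toList.map (emb A)

theorem embW_one (A : Ty) : embW A 1 = [] := rfl

theorem embW_mul (A : Ty) (v w : Obj A) : embW A (v * w) = embW A v ++ embW A w :=
  List.map_append

theorem embW_of (A : Ty) (e : Event A) : embW A (.of e) = [emb A e] := rfl

theorem emb_injective (A : Ty) : Function.Injective (emb A) := by
  induction A with
  | nat =>
    intro m n h
    exact Ev.num.inj h
  | comm =>
    intro _ _ _
    rfl
  | var =>
    rintro (m | m) (n | n) h <;> simp [emb] at h <;> rw [h]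
  | fn A B ihA ihB =>
    rintro ⟨v, e⟩ ⟨w, e'⟩ h
    obtain ⟨h1, h2⟩ := Ev.fn.inj h
    exact Prod.ext (List.map_injective_iff.mpr ihA h1) (ihB h2)

theorem embW_injective (A : Ty) : Function.Injective (embW A) :=
  List.map_injective_iff.mpr (emb_injective A)

/-- Together with `emb_injective` this identifies the events of a type with its untyped events. -/
theorem tyEv_iff {A : Ty} {b : Ev} : TyEv A b ↔ ∃ e, b = emb A e := by
  have hW : ∀ {A : Ty} {w : List Ev}, (∀ a ∈ w, ∃ e, a = emb A e) →
      ∃ v : Obj A, w = embW A v := by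
    intro A w h
    induction w with
    | nil => exact ⟨1, rfl⟩
    | cons a w ih =>
      obtain ⟨e, rfl⟩ := h a List.mem_cons_self
      obtain ⟨v, rfl⟩ := ih fun a ha => h a (List.mem_cons_of_mem _ ha)
      exact ⟨.of e * v, rfl⟩
  induction A generalizing b with
  | nat => exact Iff.rfl
  | comm => exact ⟨fun h => ⟨(), h⟩, fun ⟨_, h⟩ => h⟩
  | var =>
    constructor
    · rintro ⟨n, rfl | rfl⟩
      · exact ⟨.read n, rfl⟩
      · exact ⟨.write n, rfl⟩
    · rintro ⟨n | n, rfl⟩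
      · exact ⟨n, .inl rfl⟩
      · exact ⟨n, .inr rfl⟩
  | fn A B ihA ihB =>
    constructor
    · rintro ⟨w, c, rfl, hw, hc⟩
      obtain ⟨v, rfl⟩ := hW fun a ha => ihA.mp (hw a ha)
      obtain ⟨e, rfl⟩ := ihB.mp hc
      exact ⟨(v, e), rfl⟩
    · rintro ⟨⟨v, e⟩, rfl⟩
      refine ⟨_, _, rfl, fun a ha => ?_, ihB.mpr ⟨e, rfl⟩⟩
      obtain ⟨e', -, rfl⟩ := List.mem_map.mp ha
      exact ihA.mpr ⟨e', rfl⟩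

theorem typed_iff {A : Ty} {w : List Ev} : (∀ a ∈ w, TyEv A a) ↔ ∃ v : Obj A, w = embW A v := by
  constructor
  · intro h
    induction w with
    | nil => exact ⟨1, rfl⟩
    | cons a w ih =>
      obtain ⟨e, rfl⟩ := tyEv_iff.mp (h a List.mem_cons_self)
      obtain ⟨v, rfl⟩ := ih fun a ha => h a (List.mem_cons_of_mem _ ha)
      exact ⟨.of e * v, rfl⟩
  · rintro ⟨v, rfl⟩ a ha
    obtain ⟨e', -, rfl⟩ := List.mem_map.mp ha
    exact tyEv_iff.mpr ⟨e', rfl⟩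

theorem embW_eq_cons {A : Ty} {v : Obj A} {a : Ev} {w : List Ev} :
    a :: w = embW A v ↔ ∃ e v', v = .of e * v' ∧ a = emb A e ∧ w = embW A v' := by
  constructor
  · intro h
    obtain ⟨e, v', h1, h2, h3⟩ := List.map_eq_cons_iff.mp h.symm
    exact ⟨e, v', h1, h2.symm, h3.symm⟩
  · rintro ⟨e, v', rfl, rfl, rfl⟩
    rfl

/-- `Trans` concatenates histories freely, `Cell` reads them from the left; `cell_append` and
induction on the word reconcile the two. -/
theorem trans_iff {m n : ℕ} {s : Obj .var} : Trans m s n ↔ Cell m (embW .var s) n := by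
  constructor
  · intro h
    induction h with
    | nil n => exact rfl
    | read n => exact ⟨rfl, rfl⟩
    | write n n' => exact rfl
    | append _ _ ih1 ih2 =>
      rw [embW_mul]
      exact cell_append.mpr ⟨_, ih1, ih2⟩
  · intro h
    induction s using FreeMonoid.inductionOn' generalizing m with
    | one =>
      obtain rfl : m = n := h
      exact .nil m
    | of_mul a s ih =>
      cases a with
      | read k =>
        obtain ⟨rfl, h⟩ := h
        exact .append (.read k) (ih h)
      | write k => exact .append (.write m k) (ih h)

theorem cellTrace_iff {w : List Ev} :
    (∃ m, Cell 0 w m) ↔ ∃ s : Obj .var, CellTrace s ∧ w = embW .var s := by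
  constructor
  · rintro ⟨m, h⟩
    obtain ⟨s, rfl⟩ := typed_iff.mp (cell_typed h)
    exact ⟨s, ⟨m, trans_iff.mpr h⟩, rfl⟩
  · rintro ⟨s, ⟨m, h⟩, rfl⟩
    exact ⟨m, trans_iff.mp h⟩

/-! ### Tuples as traces -/

open Classical in
/-- The trace of a tuple of sequences over a context. -/
noncomputable def toTr (Γ : Cx) (ρ : CxObj Γ) : Trace := fun x =>
  if h : ∃ A, (x, A) ∈ Γ then embW h.choose (ρ ⟨(x, h.choose), h.choose_spec⟩) else []

theorem Cx.Distinct.eq {Γ : Cx} (h : Γ.Distinct) {x : ℕ} {A B : Ty} (hA : (x, A) ∈ Γ)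
    (hB : (x, B) ∈ Γ) : A = B :=
  congrArg Prod.snd (List.inj_on_of_nodup_map h hA hB rfl)

theorem Cx.Distinct.exists_types {Γ : Cx} (h : Γ.Distinct) :
    ∃ T : ℕ → Ty, ∀ p ∈ Γ, T p.1 = p.2 := by
  classical
  refine ⟨fun x => if h : ∃ A, (x, A) ∈ Γ then h.choose else .nat, fun p hp => ?_⟩
  have h' : ∃ A, (p.1, A) ∈ Γ := ⟨p.2, hp⟩
  exact (dif_pos h').trans (h.eq h'.choose_spec hp)

theorem Deriv.occ {Γ : Cx} {M : Tm E} {A : Ty} (d : Deriv Γ M A) (h : Γ.Distinct) {x : ℕ}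
    (hx : Occ x M) : x ∈ Γ.map Prod.fst :=
  let ⟨_, hT⟩ := h.exists_types
  (d.wt hT).2 x hx

section

variable {Γ Γ' Δ : Cx} {A B : Ty} {x : ℕ}

/-- `toTr` chooses the type of an identifier; distinctness leaves only one candidate. -/
theorem toTr_of_mem (hD : Γ.Distinct) (ρ : CxObj Γ) (h : (x, A) ∈ Γ) :
    toTr Γ ρ x = embW A (ρ ⟨(x, A), h⟩) := by
  have h' : ∃ A, (x, A) ∈ Γ := ⟨A, h⟩
  have hB : ∀ (B : Ty) (hB : (x, B) ∈ Γ),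
      embW B (ρ ⟨(x, B), hB⟩) = embW A (ρ ⟨(x, A), h⟩) := by
    intro B hB
    obtain rfl := hD.eq hB h
    rfl
  rw [toTr, dif_pos h']
  exact hB _ _

theorem toTr_of_notMem (ρ : CxObj Γ) (h : x ∉ Γ.map Prod.fst) : toTr Γ ρ x = [] :=
  dif_neg fun ⟨_, h'⟩ => h (List.mem_map_of_mem h')

theorem toTr_mul (ρ ρ' : CxObj Γ) : toTr Γ (ρ * ρ') = toTr Γ ρ * toTr Γ ρ' := by
  funext x
  rw [trace_mul]
  unfold toTr
  split_ifs
  · exact embW_mul _ _ _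
  · rfl

theorem toTr_one : toTr Γ 1 = 1 := by
  funext x
  unfold toTr
  split_ifs <;> rfl

theorem toTr_injective (hD : Γ.Distinct) : Function.Injective (toTr Γ) := by
  intro ρ ρ' h
  funext p
  apply embW_injective
  rw [← toTr_of_mem hD ρ p.2, ← toTr_of_mem hD ρ' p.2, h]

theorem exists_toTr (hD : Γ.Distinct) {s : Trace} (h : ∀ p ∈ Γ, ∀ a ∈ s p.1, TyEv p.2 a)
    (h' : ∀ x, x ∉ Γ.map Prod.fst → s x = []) : ∃ ρ, s = toTr Γ ρ := by
  choose ρ hρ using fun p : {p : ℕ × Ty // p ∈ Γ} => typed_iff.mp (h p.1 p.2)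
  refine ⟨ρ, funext fun x => ?_⟩
  by_cases hx : x ∈ Γ.map Prod.fst
  · obtain ⟨p, hp, rfl⟩ := List.mem_map.mp hx
    rw [toTr_of_mem hD ρ hp]
    exact hρ ⟨p, hp⟩
  · rw [h' x hx, toTr_of_notMem ρ hx]

theorem toTr_typed (hD : Γ.Distinct) (ρ : CxObj Γ) :
    ∀ p ∈ Γ, ∀ a ∈ toTr Γ ρ p.1, TyEv p.2 a := by
  intro p hp
  rw [toTr_of_mem hD ρ hp]
  exact typed_iff.mpr ⟨_, rfl⟩

/-- Factors of a typed trace are typed and have the same support, so they come from tuples. Hence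
concatenation of traces corresponds to multiplication of subsets in the model. -/
theorem toTr_eq_mul (hD : Γ.Distinct) {ρ : CxObj Γ} {s t : Trace} (h : toTr Γ ρ = s * t) :
    ∃ ρ₁ ρ₂, ρ = ρ₁ * ρ₂ ∧ s = toTr Γ ρ₁ ∧ t = toTr Γ ρ₂ := by
  have ht := toTr_typed hD ρ
  have ho : ∀ x, x ∉ Γ.map Prod.fst → s x = [] ∧ t x = [] := by
    intro x hx
    rw [← List.append_eq_nil_iff, ← trace_mul, ← h, toTr_of_notMem ρ hx]
  rw [h] at ht
  obtain ⟨ρ₁, rfl⟩ := exists_toTr hD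
    (fun p hp a ha => ht p hp a (List.mem_append_left _ ha)) fun x hx => (ho x hx).1
  obtain ⟨ρ₂, rfl⟩ := exists_toTr hD
    (fun p hp a ha => ht p hp a (List.mem_append_right _ ha)) fun x hx => (ho x hx).2
  rw [← toTr_mul] at h
  exact ⟨ρ₁, ρ₂, toTr_injective hD h, rfl, rfl⟩

theorem toTr_nil (ρ : CxObj []) : toTr [] ρ = 1 :=
  funext fun _ => toTr_of_notMem ρ (by simp)

theorem toTr_extend (hD : Γ.Distinct) (hD' : Γ'.Distinct) (hs : Γ ⊆ Γ') (ρ : CxObj Γ) :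
    toTr Γ' (extend Γ Γ' ρ) = toTr Γ ρ := by
  funext x
  by_cases hx : x ∈ Γ'.map Prod.fst
  · obtain ⟨p, hp, rfl⟩ := List.mem_map.mp hx
    rw [toTr_of_mem hD' _ hp]
    by_cases hp' : p ∈ Γ
    · rw [toTr_of_mem hD _ hp']
      simp [extend, hp']
    · rw [toTr_of_notMem ρ]
      · simp [extend, hp', embW_one]
      · intro h
        obtain ⟨q, hq, h⟩ := List.mem_map.mp h
        exact hp' (List.inj_on_of_nodup_map hD' (hs hq) hp h ▸ hq)
  · rw [toTr_of_notMem _ hx, toTr_of_notMem]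
    exact fun h => hx (List.map_subset _ hs h)

theorem toTr_join (hD : Cx.Distinct (Γ ++ Δ)) (ρ : CxObj Γ) (ρ' : CxObj Δ) :
    toTr (Γ ++ Δ) (join Γ Δ (ρ, ρ')) = toTr Γ ρ * toTr Δ ρ' := by
  have hN : (Γ.map Prod.fst ++ Δ.map Prod.fst).Nodup := by
    rw [← List.map_append]
    exact hD
  have hΓ : Γ.Distinct := hN.of_append_left
  have hΔ : Δ.Distinct := hN.of_append_right
  have hd := List.disjoint_of_nodup_append hN
  funext x
  rw [trace_mul]
  by_cases hx : x ∈ Γ.map Prod.fst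
  · rw [toTr_of_notMem ρ' (hd hx), List.append_nil]
    obtain ⟨p, hp, rfl⟩ := List.mem_map.mp hx
    rw [toTr_of_mem hD _ (List.mem_append_left _ hp), toTr_of_mem hΓ _ hp]
    simp [join, hp]
  · rw [toTr_of_notMem ρ hx, List.nil_append]
    by_cases hx' : x ∈ Δ.map Prod.fst
    · obtain ⟨p, hp, rfl⟩ := List.mem_map.mp hx'
      rw [toTr_of_mem hD _ (List.mem_append_right _ hp), toTr_of_mem hΔ _ hp]
      have : p ∉ Γ := fun h => hx (List.mem_map_of_mem h)
      simp [join, this]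
    · rw [toTr_of_notMem _ hx', toTr_of_notMem]
      rw [List.map_append, List.mem_append]
      exact not_or.mpr ⟨hx, hx'⟩

theorem toTr_unbind (hD : Γ.Distinct) (ρ : CxObj ((0, A) :: Γ.shift)) :
    toTr _ ρ = scons (embW A (unbind Γ A ρ).2) (toTr Γ (unbind Γ A ρ).1) := by
  have hD' := hD.shift A
  funext x
  cases x with
  | zero => exact toTr_of_mem hD' ρ List.mem_cons_self
  | succ x =>
    rw [scons]
    by_cases hx : x ∈ Γ.map Prod.fst
    · obtain ⟨p, hp, rfl⟩ := List.mem_map.mp hx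
      rw [toTr_of_mem hD _ hp]
      exact toTr_of_mem hD' ρ (List.mem_cons_of_mem _ (List.mem_map_of_mem hp))
    · rw [toTr_of_notMem _ hx, toTr_of_notMem]
      exact fun h => hx (mem_fst_shift h)

theorem exists_unbind (hD : Γ.Distinct) (ρ : CxObj Γ) (w : Obj A) :
    ∃ ρ', unbind Γ A ρ' = (ρ, w) := by
  have hD' := hD.shift A
  obtain ⟨ρ', h⟩ := exists_toTr hD' (s := scons (embW A w) (toTr Γ ρ)) (by
    intro p hp
    rcases List.mem_cons.mp hp with rfl | hp
    · exact typed_iff.mpr ⟨w, rfl⟩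
    · obtain ⟨q, hq, rfl⟩ := List.mem_map.mp hp
      exact toTr_typed hD ρ q hq) (by
    rintro (_ | x) hx
    · exact (hx (by simp)).elim
    · refine toTr_of_notMem ρ fun h => hx ?_
      simpa [Cx.shift] using h)
  rw [toTr_unbind hD] at h
  obtain ⟨h1, h2⟩ := scons_inj h
  exact ⟨ρ', Prod.ext (toTr_injective hD h2.symm) (embW_injective A h1.symm)⟩

/-! ### Maps of the model and relations -/

open MonRel

open scoped Pointwise

/-- The map `f` and the relation `R` have the same content. -/
def Matches (f : Hom (CxObj Γ) (Obj A)) (R : Rel Ev) : Prop :=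
  ∀ ρ b, Rel.E R (toTr Γ ρ) b ↔ ∃ e, b = emb A e ∧ ρ ∈ f (.of e)

theorem Matches.mem {f : Hom (CxObj Γ) (Obj A)} {R : Rel Ev} (h : Matches f R) {ρ : CxObj Γ}
    {e : Event A} : Rel.E R (toTr Γ ρ) (emb A e) ↔ ρ ∈ f (.of e) := by
  rw [h]
  constructor
  · rintro ⟨e', h1, h2⟩
    rwa [emb_injective A h1]
  · exact fun h => ⟨e, rfl, h⟩

/-- A map into a free monoid sends a word to the product of the images of its letters, which is what
`words` describes. -/
theorem Matches.words_iff {f : Hom (CxObj Γ) (Obj A)} {R : Rel Ev} (h : Matches f R)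
    (hD : Γ.Distinct) {ρ : CxObj Γ} {w : List Ev} :
    Rel.E R.words (toTr Γ ρ) w ↔ ∃ v, w = embW A v ∧ ρ ∈ f v := by
  induction w generalizing ρ with
  | nil =>
    rw [E_words_nil, ← toTr_one (Γ := Γ), (toTr_injective hD).eq_iff]
    constructor
    · rintro rfl
      exact ⟨1, rfl, by rw [map_one]; exact Set.one_mem_one⟩
    · rintro ⟨v, h1, h2⟩
      rw [embW_injective A (h1.symm.trans (embW_one A).symm), map_one] at h2
      exact h2
  | cons a w ih =>
    rw [E_words_cons]
    constructor
    · rintro ⟨s₁, s₂, hs, h1, h2⟩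
      obtain ⟨ρ₁, ρ₂, rfl, rfl, rfl⟩ := toTr_eq_mul hD hs
      obtain ⟨e, rfl, h3⟩ := (h _ _).mp h1
      obtain ⟨v, rfl, h4⟩ := ih.mp h2
      refine ⟨.of e * v, rfl, ?_⟩
      rw [map_mul]
      exact Set.mul_mem_mul h3 h4
    · rintro ⟨v, h1, h2⟩
      obtain ⟨e, v, rfl, rfl, rfl⟩ := embW_eq_cons.mp h1
      rw [map_mul] at h2
      obtain ⟨ρ₁, h3, ρ₂, h4, rfl⟩ := h2
      exact ⟨_, _, toTr_mul _ _, h.mem.mpr h3, ih.mpr ⟨v, rfl, h4⟩⟩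

theorem Matches.seq2_iff {Z : Type} {f : Hom (CxObj Γ) (Obj A)} {R : Rel Ev} (h : Matches f R)
    {f' : Hom (CxObj Γ) (Obj B)} {R' : Rel Ev} (h' : Matches f' R') (hD : Γ.Distinct)
    {g : Ev → Ev → Z → Prop} {ρ : CxObj Γ} {b : Z} :
    Rel.E (R.seq2 R' g) (toTr Γ ρ) b ↔
      ∃ e e', ρ ∈ f (.of e) * f' (.of e') ∧ g (emb A e) (emb B e') b := by
  rw [E_seq2]
  constructor
  · rintro ⟨s₁, s₂, a, c, hs, h1, h2, hg⟩
    obtain ⟨ρ₁, ρ₂, rfl, rfl, rfl⟩ := toTr_eq_mul hD hs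
    obtain ⟨e, rfl, h3⟩ := (h _ _).mp h1
    obtain ⟨e', rfl, h4⟩ := (h' _ _).mp h2
    exact ⟨e, e', Set.mul_mem_mul h3 h4, hg⟩
  · rintro ⟨e, e', ⟨ρ₁, h3, ρ₂, h4, rfl⟩, hg⟩
    exact ⟨_, _, _, _, toTr_mul _ _, h.mem.mpr h3, h'.mem.mpr h4, hg⟩

theorem gen_of {A X : Type} [Monoid A] (R : X → Set A) (x : X) : gen R (.of x) = R x :=
  FreeMonoid.lift_eval_of R x

theorem mem_gen {A X : Type} [Monoid A] {R : X → Set A} {x : X} {a : A} :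
    a ∈ gen R (.of x) ↔ a ∈ R x := by rw [gen_of]

section

variable {A X Y : Type} [Monoid A] {f : Hom A (FreeMonoid X)} {g : Hom A (FreeMonoid Y)}

theorem pair_inl (x : X) : pair f g (.of (.inl x)) = f (.of x) := gen_of _ _

theorem pair_inr (y : Y) : pair f g (.of (.inr y)) = g (.of y) := gen_of _ _

theorem mem_pair_inl_inr {a : A} {x : X} {y : Y} :
    a ∈ pair f g (.of (.inl x) * .of (.inr y)) ↔ a ∈ f (.of x) * g (.of y) := by
  rw [map_mul, pair_inl, pair_inr]

theorem mem_pair_inr_inl {a : A} {x : X} {y : Y} :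
    a ∈ pair f g (.of (.inr y) * .of (.inl x)) ↔ a ∈ g (.of y) * f (.of x) := by
  rw [map_mul, pair_inl, pair_inr]

theorem mem_pair_loop {a : A} {x x' : X} {y : Y} {j : ℕ} :
    a ∈ pair f g ((.of (.inl x) * .of (.inr y)) ^ j * .of (.inl x')) ↔
      a ∈ (f (.of x) * g (.of y)) ^ j * f (.of x') := by
  rw [map_mul, map_pow, map_mul, pair_inl, pair_inl, pair_inr]

end

theorem mem_comp {A B C : Type} [Monoid A] [Monoid B] [Monoid C] {f : Hom A B} {g : Hom B C}
    {a : A} {c : C} : a ∈ comp f g c ↔ ∃ b ∈ g c, a ∈ f b := Iff.rfl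

theorem mem_comp_ofHom {A B C : Type} [Monoid A] [Monoid B] [Monoid C] {h : B →* A} {g : Hom B C}
    {a : A} {c : C} : a ∈ comp (ofHom h) g c ↔ ∃ b ∈ g c, a = h b := Iff.rfl

theorem mem_curry {A B X : Type} [Monoid A] [Monoid B] {f : Hom (A × B) (FreeMonoid X)} {a : A}
    {b : B} {x : X} : a ∈ curry f (.of (b, x)) ↔ (a, b) ∈ f (.of x) :=
  mem_gen (R := fun p : B × X => {a | (a, p.1) ∈ f (.of p.2)})

theorem Matches.tick {f : Hom (CxObj Γ) (Obj A)} {R : Rel Ev} (h : Matches f R) :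
    Matches f R.tick := fun ρ b => by rw [E_tick]; exact h ρ b

theorem Matches.currym {f : Hom (CxObj ((0, A) :: Γ.shift)) (Obj B)} {R : Rel Ev}
    (h : Matches f R) (hD : Γ.Distinct) {ρ : CxObj Γ} {v : Obj A} {e : Event B} :
    ρ ∈ SCI.currym f (.of (v, e)) ↔ Rel.E R (scons (embW A v) (toTr Γ ρ)) (emb B e) := by
  have : ρ ∈ SCI.currym f (.of (v, e)) ↔ ∃ ρ' ∈ f (.of e), (ρ, v) = unbind Γ A ρ' :=
    mem_curry.trans mem_comp_ofHom
  rw [this]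
  constructor
  · rintro ⟨ρ', h1, h2⟩
    rw [← h.mem, toTr_unbind hD, ← h2] at h1
    exact h1
  · intro h1
    obtain ⟨ρ', h2⟩ := exists_unbind hD ρ v
    refine ⟨ρ', ?_, h2.symm⟩
    rw [← h.mem, toTr_unbind hD, h2]
    exact h1

theorem Matches.under_iff {Z : Type} {f : Hom (CxObj ((0, A) :: Γ.shift)) (Obj B)} {R : Rel Ev}
    (h : Matches f R) (hD : Γ.Distinct) {g : List Ev → Ev → Z → Prop}
    (hg : ∀ w c z, g w c z → ∀ a ∈ w, TyEv A a) {ρ : CxObj Γ} {z : Z} :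
    Rel.E (R.under g) (toTr Γ ρ) z ↔
      ∃ v e, g (embW A v) (emb B e) z ∧ ρ ∈ SCI.currym f (.of (v, e)) := by
  rw [E_under]
  constructor
  · rintro ⟨w, c, h1, h2⟩
    obtain ⟨v, rfl⟩ := typed_iff.mp (hg _ _ _ h1)
    obtain ⟨ρ', h3⟩ := exists_unbind hD ρ v
    have h4 := toTr_unbind hD ρ'
    rw [h3] at h4
    rw [← h4] at h2
    obtain ⟨e, rfl, h5⟩ := (h _ _).mp h2
    refine ⟨v, e, h1, ?_⟩
    rw [h.currym hD, ← h4]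
    exact h.mem.mpr h5
  · rintro ⟨v, e, h1, h2⟩
    exact ⟨_, _, h1, (h.currym hD).mp h2⟩

/-- The support condition makes the components outside `Γ` empty, so a tuple over `Γ'` in the
relation is the extension of one over `Γ`. This serves for weakening and exchange alike. -/
theorem Matches.proj {f : Hom (CxObj Γ) (Obj A)} {R : Rel Ev} (h : Matches f R)
    (hD : Γ.Distinct) (hD' : Γ'.Distinct) (hs : Γ ⊆ Γ')
    (hR : SuppIn R (fun x => x ∈ Γ.map Prod.fst)) :
    Matches (comp (SCI.proj Γ' Γ) f) R := by
  intro ρ b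
  constructor
  · intro h1
    obtain ⟨ρ', h2⟩ := exists_toTr hD (s := toTr Γ' ρ)
      (fun p hp => toTr_typed hD' ρ p (hs hp)) (fun x hx => h1.elim fun n h1 => hR _ _ _ h1 x hx)
    obtain ⟨e, rfl, h3⟩ := (h ρ' b).mp (h2 ▸ h1)
    refine ⟨e, rfl, ρ', h3, toTr_injective hD' ?_⟩
    rw [toTr_extend hD hD' hs, h2]
  · rintro ⟨e, rfl, ρ', h3, h2⟩
    rw [show ρ = extend Γ Γ' ρ' from h2, toTr_extend hD hD' hs]
    exact h.mem.mpr h3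

theorem Deriv.suppIn {M : Tm E} (I : E → ℕ → ℕ → ℕ) (d : Deriv Γ M A) (hD : Γ.Distinct) :
    SuppIn (sem I M) (fun x => x ∈ Γ.map Prod.fst) :=
  (sem_suppIn I M).mono fun _ => d.occ hD

theorem Matches.app {f : Hom (CxObj Γ) (Obj (.fn A B))} {f' : Hom (CxObj Δ) (Obj A)}
    {R R' : Rel Ev} (h : Matches f R) (h' : Matches f' R') (hD : Cx.Distinct (Γ ++ Δ))
    (hR : SuppIn R (fun x => x ∈ Γ.map Prod.fst))
    (hR' : SuppIn R' (fun x => x ∈ Δ.map Prod.fst)) :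
    Matches (comp (splitm Γ Δ) (comp (tensor f f') (evm A B)))
      (R.seq2 R'.words fun a w b => a = .fn w b) := by
  have hN : (Γ.map Prod.fst ++ Δ.map Prod.fst).Nodup := by
    rw [← List.map_append]
    exact hD
  have hΓ : Γ.Distinct := hN.of_append_left
  have hΔ : Δ.Distinct := hN.of_append_right
  have hev : ∀ q (e : Event B), q ∈ evm A B (.of e) ↔ q.1 = .of (q.2, e) := fun q e =>
    mem_gen (R := fun x => {q : Obj (.fn A B) × Obj A | q.1 = .of (q.2, x)})
  have hm : ∀ ρ e, ρ ∈ comp (splitm Γ Δ) (comp (tensor f f') (evm A B)) (.of e) ↔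
      ∃ ρ₁ ρ₂ v, ρ₁ ∈ f (.of (v, e)) ∧ ρ₂ ∈ f' v ∧ ρ = join Γ Δ (ρ₁, ρ₂) := by
    intro ρ e
    rw [mem_comp]
    constructor
    · rintro ⟨⟨ρ₁, ρ₂⟩, ⟨⟨u, v⟩, h1, h2, h3⟩, h4⟩
      obtain rfl : u = .of (v, e) := (hev _ _).mp h1
      exact ⟨ρ₁, ρ₂, v, h2, h3, h4⟩
    · rintro ⟨ρ₁, ρ₂, v, h2, h3, h4⟩
      refine ⟨(ρ₁, ρ₂), ⟨(.of (v, e), v), (hev _ _).mpr rfl, h2, h3⟩, h4⟩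
  intro ρ b
  rw [E_seq2]
  simp only [hm]
  constructor
  · rintro ⟨s₁, s₂, a, w, hs, h1, h2, rfl⟩
    obtain ⟨ρ₁, ρ₂, rfl, rfl, rfl⟩ := toTr_eq_mul hD hs
    -- Both factors are tuples over the joint context; their supports allow them to be restricted to
    -- `Γ` and to `Δ`.
    obtain ⟨ρ₃, h3⟩ := exists_toTr hΓ (s := toTr _ ρ₁)
      (fun p hp => toTr_typed hD ρ₁ p (List.mem_append_left _ hp))
      (fun x hx => h1.elim fun n h1 => hR _ _ _ h1 x hx)
    obtain ⟨ρ₄, h4⟩ := exists_toTr hΔ (s := toTr _ ρ₂)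
      (fun p hp => toTr_typed hD ρ₂ p (List.mem_append_right _ hp))
      (fun x hx => h2.elim fun n h2 => hR'.words _ _ _ h2 x hx)
    rw [h3] at h1 hs
    rw [h4] at h2 hs
    obtain ⟨⟨v', e⟩, h5, h6⟩ := (h _ _).mp h1
    obtain ⟨h7, rfl⟩ := Ev.fn.inj h5
    obtain ⟨v, h8, h9⟩ := (h'.words_iff hΔ).mp h2
    obtain rfl := embW_injective A (h7.symm.trans h8)
    refine ⟨e, rfl, ρ₃, ρ₄, _, h6, h9, toTr_injective hD ?_⟩
    rw [hs, toTr_join hD]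
  · rintro ⟨e, rfl, ρ₁, ρ₂, v, h1, h2, rfl⟩
    exact ⟨_, _, _, _, toTr_join hD _ _, h.mem.mpr h1, (h'.words_iff hΔ).mpr ⟨v, rfl, h2⟩, rfl⟩

theorem Matches.loop {f : Hom (CxObj Γ) (Obj .nat)} {f' : Hom (CxObj Γ) (Obj .comm)}
    {R R' : Rel Ev} (h : Matches f R) (h' : Matches f' R') (hD : Γ.Distinct) :
    Matches (comp (pair f f') loopm) (Rel.seq2
      (Rel.words (Rel.seq2 R R' fun a c (_ : Unit) => a = .num 0 ∧ c = .star)) R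
      fun _ a b => ∃ m, m ≠ 0 ∧ a = .num m ∧ b = .star) := by
  have hb : ∀ ρ u, Rel.E (Rel.seq2 R R' fun a c (_ : Unit) => a = .num 0 ∧ c = .star)
      (toTr Γ ρ) u ↔ ρ ∈ f (.of (0 : ℕ)) * f' (.of ()) := by
    intro ρ u
    rw [h.seq2_iff h' hD]
    constructor
    · rintro ⟨e, e', h1, h2, -⟩
      obtain rfl : e = (0 : ℕ) := Ev.num.inj h2
      exact h1
    · intro h1
      exact ⟨_, _, h1, rfl, rfl⟩
  -- The observations of an iteration carry no information, so a word of them is just its length,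
  -- the exponent in `loopm`.
  have hw : ∀ (w : List Unit) ρ,
      Rel.E (Rel.words (Rel.seq2 R R' fun a c (_ : Unit) => a = .num 0 ∧ c = .star)) (toTr Γ ρ) w ↔
        ρ ∈ (f (.of (0 : ℕ)) * f' (.of ())) ^ w.length := by
    intro w
    induction w with
    | nil =>
      intro ρ
      rw [E_words_nil, ← toTr_one (Γ := Γ), (toTr_injective hD).eq_iff]
      exact Iff.rfl
    | cons a w ih =>
      intro ρ
      rw [E_words_cons, List.length_cons, pow_succ']
      constructor
      · rintro ⟨s₁, s₂, hs, h1, h2⟩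
        obtain ⟨ρ₁, ρ₂, rfl, rfl, rfl⟩ := toTr_eq_mul hD hs
        exact Set.mul_mem_mul ((hb _ _).mp h1) ((ih _).mp h2)
      · rintro ⟨ρ₁, h3, ρ₂, h4, rfl⟩
        exact ⟨_, _, toTr_mul _ _, (hb _ _).mpr h3, (ih _).mpr h4⟩
  intro ρ b
  rw [E_seq2]
  simp only [mem_comp, loopm, gen_of]
  constructor
  · rintro ⟨s₁, s₂, w, c, hs, h1, h2, m, hm, rfl, rfl⟩
    obtain ⟨ρ₁, ρ₂, rfl, rfl, rfl⟩ := toTr_eq_mul hD hs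
    refine ⟨(), rfl, _, ⟨w.length, m, hm, rfl⟩, ?_⟩
    refine mem_pair_loop.mpr ?_
    exact Set.mul_mem_mul ((hw _ _).mp h1) (h.mem.mp h2)
  · rintro ⟨e, rfl, _, ⟨j, m, hm, rfl⟩, h1⟩
    obtain ⟨ρ₁, h3, ρ₂, h4, rfl⟩ := mem_pair_loop.mp h1
    refine ⟨_, _, List.replicate j (), _, toTr_mul _ _, (hw _ _).mpr ?_,
      h.mem.mpr h4, m, hm, rfl, rfl⟩
    rwa [List.length_replicate]

end

theorem embW_pow (n k : ℕ) :
    embW .nat ((FreeMonoid.of n : FreeMonoid ℕ) ^ k) = List.replicate k (.num n) := by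
  induction k with
  | zero => rfl
  | succ k ih =>
    rw [pow_succ', List.replicate_succ, ← ih]
    rfl

/-- The right-hand side mentions only the term, so this gives coherence as well. Each case compares
the generators of a map of the model with the corresponding clause of `sem`. -/
theorem den_matches (I : E → ℕ → ℕ → ℕ) {Γ : Cx} {M : Tm E} {A : Ty} (d : Deriv Γ M A)
    (hD : Γ.Distinct) : Matches (den I d) (sem I M) := by
  induction d with
  | var x A =>
    have hs : ∀ e : Event A,
        toTr [(x, A)] (Pi.mulSingle ⟨(x, A), List.mem_cons_self⟩ (.of e)) = single x (emb A e) := by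
      intro e
      funext y
      by_cases hy : y = x
      · subst hy
        rw [toTr_of_mem hD _ List.mem_cons_self, Pi.mulSingle_eq_same]
        simp [single, embW_of]
      · rw [toTr_of_notMem _ (by simpa using hy)]
        simp [single, hy]
    intro ρ b
    constructor
    · rintro ⟨_, -, h⟩
      have hb : TyEv A b := toTr_typed hD ρ (x, A) List.mem_cons_self b (by simp [h, single])
      obtain ⟨e, rfl⟩ := tyEv_iff.mp hb
      refine ⟨e, rfl, toTr_injective hD ?_⟩
      rw [h, ← hs]
      rfl
    · rintro ⟨e, rfl, h⟩
      refine ⟨0, rfl, ?_⟩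
      rw [← hs, show ρ = _ from h]
      rfl
  | @lam Γ A B M d ih =>
    have ih := ih (hD.shift A)
    refine Matches.tick fun ρ b => ?_
    rw [ih.under_iff hD fun w c z h => h.1]
    constructor
    · rintro ⟨v, e, ⟨-, rfl⟩, h⟩
      exact ⟨(v, e), rfl, h⟩
    · rintro ⟨⟨v, e⟩, rfl, h⟩
      exact ⟨v, e, ⟨typed_iff.mpr ⟨v, rfl⟩, rfl⟩, h⟩
  | @app Γ Δ A B M N d e hD' ihd ihe =>
    have hN : (Γ.map Prod.fst ++ Δ.map Prod.fst).Nodup := by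
      rw [← List.map_append]
      exact hD
    have hΓ : Γ.Distinct := hN.of_append_left
    have hΔ : Δ.Distinct := hN.of_append_right
    exact ((ihd hΓ).app (ihe hΔ) hD (d.suppIn I hΓ) (e.suppIn I hΔ)).tick
  | weakening x A d _ ih =>
    have hΓ := List.Nodup.of_cons hD
    exact (ih hΓ).proj hΓ hD (List.subset_cons_self _ _) (d.suppIn I hΓ)
  | exchange d hp ih =>
    have hΓ := (hp.symm.map Prod.fst).nodup hD
    exact (ih hΓ).proj hΓ hD hp.subset (d.suppIn I hΓ)
  | num n =>
    intro ρ b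
    rw [toTr_nil, sem, E_leaf]
    constructor
    · rintro ⟨-, rfl⟩
      exact ⟨n, rfl, mem_gen.mpr rfl⟩
    · rintro ⟨e, rfl, h⟩
      exact ⟨rfl, congrArg Ev.num (mem_gen.mp h)⟩
  | skip =>
    intro ρ b
    rw [toTr_nil, sem, E_leaf]
    constructor
    · rintro ⟨-, rfl⟩
      exact ⟨(), rfl, mem_gen.mpr trivial⟩
    · rintro ⟨e, rfl, -⟩
      exact ⟨rfl, rfl⟩
  | arith o d e ihd ihe =>
    refine Matches.tick fun ρ b => ?_
    rw [(ihd hD).seq2_iff (ihe hD) hD]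
    constructor
    · rintro ⟨e, e', h, m, n, h1, h2, rfl⟩
      obtain rfl : e = m := Ev.num.inj h1
      obtain rfl : e' = n := Ev.num.inj h2
      exact ⟨o.apply I e e', rfl, _, mem_gen.mpr ⟨e, e', rfl, rfl⟩, mem_pair_inl_inr.mpr h⟩
    · rintro ⟨_, rfl, _, h', h⟩
      obtain ⟨m, n, rfl, rfl⟩ := mem_gen.mp h'
      exact ⟨m, n, mem_pair_inl_inr.mp h, m, n, rfl, rfl, rfl⟩
  | @seq Γ B M N hB d e ihd ihe =>
    refine Matches.tick fun ρ b => ?_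
    rw [(ihd hD).seq2_iff (ihe hD) hD]
    constructor
    · rintro ⟨e, e', h, h1, rfl⟩
      exact ⟨e', rfl, _, mem_gen.mpr rfl, mem_pair_inl_inr.mpr h⟩
    · rintro ⟨e', rfl, _, h', h⟩
      obtain rfl := mem_gen.mp h'
      exact ⟨(), e', mem_pair_inl_inr.mp h, rfl, rfl⟩
  | assign d e ihd ihe =>
    refine Matches.tick fun ρ b => ?_
    rw [(ihe hD).seq2_iff (ihd hD) hD]
    constructor
    · rintro ⟨e, e', h, n, h1, h2, rfl⟩
      obtain rfl : e = n := Ev.num.inj h1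
      obtain rfl : e' = VarEvent.write e := emb_injective .var h2
      exact ⟨(), rfl, _, mem_gen.mpr ⟨e, rfl⟩, mem_pair_inr_inl.mpr h⟩
    · rintro ⟨_, rfl, _, h', h⟩
      obtain ⟨n, rfl⟩ := mem_gen.mp h'
      exact ⟨n, VarEvent.write n, mem_pair_inr_inl.mp h, n, rfl, rfl, rfl⟩
  | deref d ih =>
    refine Matches.tick fun ρ b => ?_
    rw [E_relabel]
    constructor
    · rintro ⟨_, h, n, rfl, rfl⟩
      exact ⟨n, rfl, _, mem_gen.mpr rfl, (ih hD).mem.mp h⟩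
    · rintro ⟨n, rfl, _, h', h⟩
      obtain rfl := mem_gen.mp h'
      exact ⟨_, (ih hD).mem.mpr h, n, rfl, rfl⟩
  | loop d e ihd ihe => exact (Matches.loop (ihd hD) (ihe hD) hD).tick
  | @ifzero Γ B M N₁ N₂ hB d e₁ e₂ ih ih₁ ih₂ =>
    refine Matches.tick fun ρ b => ?_
    rw [E_union, (ih hD).seq2_iff (ih₁ hD) hD, (ih hD).seq2_iff (ih₂ hD) hD]
    constructor
    · rintro (⟨e, e', h, h1, rfl⟩ | ⟨e, e', h, m, hm, h1, rfl⟩)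
      · obtain rfl : e = (0 : ℕ) := Ev.num.inj h1
        refine ⟨e', rfl, _, mem_gen.mpr (.inl rfl), mem_pair_inl_inr.mpr ?_⟩
        rwa [pair_inl]
      · obtain rfl : e = m := Ev.num.inj h1
        refine ⟨e', rfl, _, mem_gen.mpr (.inr ⟨e, hm, rfl⟩), mem_pair_inl_inr.mpr ?_⟩
        rwa [pair_inr]
    · rintro ⟨e', rfl, _, h', h⟩
      rcases mem_gen.mp h' with rfl | ⟨m, hm, rfl⟩
      · have h := mem_pair_inl_inr.mp h
        rw [pair_inl] at h
        exact .inl ⟨_, e', h, rfl, rfl⟩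
      · have h := mem_pair_inl_inr.mp h
        rw [pair_inr] at h
        exact .inr ⟨_, e', h, m, hm, rfl, rfl⟩
  | @local_ Γ B M hB d ih =>
    have ih := ih (hD.shift _)
    refine Matches.tick fun ρ b => ?_
    rw [ih.under_iff hD fun w c z h => cell_typed h.1.choose_spec]
    constructor
    · rintro ⟨v, e, ⟨h1, rfl⟩, h⟩
      obtain ⟨s, hs, h2⟩ := cellTrace_iff.mp h1
      obtain rfl := embW_injective _ h2
      exact ⟨e, rfl, _, mem_gen.mpr ⟨v, hs, rfl⟩, h⟩
    · rintro ⟨e, rfl, _, h', h⟩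
      obtain ⟨s, hs, rfl⟩ := mem_gen.mp h'
      exact ⟨s, e, ⟨cellTrace_iff.mpr ⟨s, hs, rfl⟩, rfl⟩, h⟩
  | mkvar d e ihd ihe =>
    refine Matches.tick fun ρ b => ?_
    rw [E_union, E_relabel, E_relabel]
    constructor
    · rintro (⟨_, h, n, k, rfl, rfl⟩ | ⟨_, h, n, rfl, rfl⟩)
      · rw [← embW_pow] at h
        exact ⟨VarEvent.write n, rfl, mem_gen.mpr ⟨_, mem_gen.mpr ⟨k, rfl⟩, (ihd hD).mem.mp h⟩⟩
      · exact ⟨VarEvent.read n, rfl, mem_gen.mpr ((ihe hD).mem.mp h)⟩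
    · rintro ⟨n | n, rfl, h⟩
      · exact .inr ⟨_, (ihe hD).mem.mpr (mem_gen.mp h), n, rfl, rfl⟩
      · obtain ⟨_, h', h⟩ := mem_gen.mp h
        obtain ⟨k, rfl⟩ := mem_gen.mp h'
        have : Rel.E (sem I _) (toTr _ ρ)
            (.fn (embW .nat ((FreeMonoid.of n : FreeMonoid ℕ) ^ k)) .star) := (ihd hD).mem.mpr h
        rw [embW_pow] at this
        exact .inl ⟨_, this, n, k, rfl, rfl⟩

/-! ## Definability -/

/-! ### Relations acting on one cell -/

/-- The observations and traces of `R` that take the content of the cell `c` from `m` to `m'`. -/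
def Step {X : Type} (c : ℕ) (R : Rel X) (m : ℕ) (u : Trace) (m' : ℕ) (x : X) : Prop :=
  ∃ r, Cell m r m' ∧ Rel.E R (ins c r u) x

section

variable {X Y Z : Type} {c m m' : ℕ} {u : Trace}

theorem step_leaf {x y : X} : Step c (leaf x) m u m' y ↔ m' = m ∧ u = 1 ∧ y = x := by
  simp only [Step, E_leaf]
  constructor
  · rintro ⟨r, h1, h2, rfl⟩
    rw [← ins_one c] at h2
    obtain ⟨rfl, rfl⟩ := ins_inj h2
    exact ⟨(show m = m' from h1).symm, rfl, rfl⟩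
  · rintro ⟨rfl, rfl, rfl⟩
    exact ⟨[], rfl, ins_one c, rfl⟩

theorem step_tick {R : Rel X} {x : X} : Step c R.tick m u m' x ↔ Step c R m u m' x := by
  simp only [Step, E_tick]

/-- The content `k` of the cell between the two parts comes from `cell_append`; thus programs with a
counter can be analysed as transition systems. -/
theorem step_seq2 {R : Rel X} {S : Rel Y} {g : X → Y → Z → Prop} {z : Z} :
    Step c (seq2 R S g) m u m' z ↔ ∃ u₁ u₂ k x y, u = u₁ * u₂ ∧ Step c R m u₁ k x ∧
      Step c S k u₂ m' y ∧ g x y z := by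
  simp only [Step, E_seq2]
  constructor
  · rintro ⟨r, h, s₁, s₂, x, y, hs, h1, h2, hg⟩
    rw [← ins_eta c s₁, ← ins_eta c s₂, ← ins_mul] at hs
    obtain ⟨rfl, rfl⟩ := ins_inj hs
    obtain ⟨k, h3, h4⟩ := cell_append.mp h
    exact ⟨_, _, k, x, y, rfl, ⟨_, h3, by rwa [ins_eta]⟩, ⟨_, h4, by rwa [ins_eta]⟩, hg⟩
  · rintro ⟨u₁, u₂, k, x, y, rfl, ⟨r₁, h1, h3⟩, ⟨r₂, h2, h4⟩, hg⟩
    exact ⟨r₁ ++ r₂, cell_append.mpr ⟨k, h1, h2⟩, _, _, x, y, ins_mul _ _ _ _ _, h3, h4, hg⟩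

theorem step_relabel {R : Rel X} {g : X → Z → Prop} {z : Z} :
    Step c (relabel R g) m u m' z ↔ ∃ x, Step c R m u m' x ∧ g x z := by
  simp only [Step, E_relabel]
  constructor
  · rintro ⟨r, h, x, h1, h2⟩
    exact ⟨x, ⟨r, h, h1⟩, h2⟩
  · rintro ⟨x, ⟨r, h, h1⟩, h2⟩
    exact ⟨r, h, x, h1, h2⟩

theorem step_union {R S : Rel X} {x : X} :
    Step c (union R S) m u m' x ↔ Step c R m u m' x ∨ Step c S m u m' x := by
  simp only [Step, E_union, and_or_left, exists_or]

theorem step_under {R : Rel X} {P : List Ev → X → Z → Prop} {z : Z} :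
    Step c (under R P) m u m' z ↔ ∃ w x, P w x z ∧ Step (c + 1) R m (scons w u) m' x := by
  simp only [Step, E_under, ins_scons]
  constructor
  · rintro ⟨r, h, w, x, h1, h2⟩
    exact ⟨w, x, h1, r, h, h2⟩
  · rintro ⟨w, x, h1, r, h, h2⟩
    exact ⟨r, h, w, x, h1, h2⟩

/-- A relation that avoids the cell leaves its content alone. -/
theorem step_shift {R : Rel X} {x : X} :
    Step c (shift c R) m u m' x ↔ m' = m ∧ Rel.E R u x := by
  constructor
  · rintro ⟨r, h, n, h1, h2⟩
    rw [ins_self] at h1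
    rw [ins_comp_sh] at h2
    subst h1
    exact ⟨(show m = m' from h).symm, n, h2⟩
  · rintro ⟨rfl, n, h⟩
    exact ⟨[], rfl, n, ins_self _ _ _, by rwa [ins_comp_sh]⟩

theorem step_words_nil {R : Rel X} : Step c (words R) m u m' [] ↔ m' = m ∧ u = 1 := by
  simp only [Step, E_words_nil]
  constructor
  · rintro ⟨r, h1, h2⟩
    rw [← ins_one c] at h2
    obtain ⟨rfl, rfl⟩ := ins_inj h2
    exact ⟨(show m = m' from h1).symm, rfl⟩
  · rintro ⟨rfl, rfl⟩
    exact ⟨[], rfl, ins_one c⟩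

theorem step_words_cons {R : Rel X} {x : X} {w : List X} :
    Step c (words R) m u m' (x :: w) ↔
      ∃ u₁ u₂ k, u = u₁ * u₂ ∧ Step c R m u₁ k x ∧ Step c (words R) k u₂ m' w := by
  have : Step c (words R) m u m' (x :: w) ↔
      Step c (seq2 R (words R) fun y v z => z = y :: v) m u m' (x :: w) := by
    refine exists_congr fun r => and_congr_right fun _ => ?_
    rw [E_words_cons, E_seq2]
    constructor
    · rintro ⟨s₁, s₂, h, h1, h2⟩
      exact ⟨s₁, s₂, x, w, h, h1, h2, rfl⟩
    · rintro ⟨s₁, s₂, y, v, h, h1, h2, h3⟩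
      obtain ⟨rfl, rfl⟩ := List.cons.inj h3
      exact ⟨s₁, s₂, h, h1, h2⟩
  rw [this, step_seq2]
  constructor
  · rintro ⟨u₁, u₂, k, y, v, h, h1, h2, h3⟩
    obtain ⟨rfl, rfl⟩ := List.cons.inj h3
    exact ⟨u₁, u₂, k, h, h1, h2⟩
  · rintro ⟨u₁, u₂, k, h, h1, h2⟩
    exact ⟨u₁, u₂, k, _, _, h, h1, h2, rfl⟩

end

theorem E_local (I : E → ℕ → ℕ → ℕ) {M : Tm E} {s : Trace} {b : Ev} :
    Rel.E (sem I (.local_ M)) s b ↔ ∃ m, Step 0 (sem I M) 0 s m b := by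
  rw [sem, E_tick, E_under]
  constructor
  · rintro ⟨w, x, ⟨⟨m, h⟩, rfl⟩, h'⟩
    exact ⟨m, w, h, by rwa [ins_zero]⟩
  · rintro ⟨m, w, h, h'⟩
    rw [ins_zero] at h'
    exact ⟨w, b, ⟨⟨m, h⟩, rfl⟩, h'⟩

theorem E_var (I : E → ℕ → ℕ → ℕ) {x : ℕ} {s : Trace} {b : Ev} :
    Rel.E (sem I (.var x)) s b ↔ s = single x b :=
  ⟨fun ⟨_, _, h⟩ => h, fun h => ⟨0, rfl, h⟩⟩

theorem E_seq (I : E → ℕ → ℕ → ℕ) {M N : Tm E} {s : Trace} {b : Ev} :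
    Rel.E (sem I (.seq M N)) s b ↔
      ∃ s₁ s₂, s = s₁ * s₂ ∧ Rel.E (sem I M) s₁ .star ∧ Rel.E (sem I N) s₂ b := by
  rw [sem, E_tick, E_seq2]
  constructor
  · rintro ⟨s₁, s₂, _, _, h, h1, h2, rfl, rfl⟩
    exact ⟨s₁, s₂, h, h1, h2⟩
  · rintro ⟨s₁, s₂, h, h1, h2⟩
    exact ⟨s₁, s₂, _, _, h, h1, h2, rfl, rfl⟩

section

variable {I : E → ℕ → ℕ → ℕ} {c m m' : ℕ} {u : Trace} {b : Ev}

theorem step_num {n : ℕ} : Step c (sem I (.num n)) m u m' b ↔ m' = m ∧ u = 1 ∧ b = .num n :=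
  step_leaf

theorem step_var_self : Step c (sem I (.var c)) m u m' b ↔ u = 1 ∧ Cell m [b] m' := by
  simp only [Step, E_var]
  constructor
  · rintro ⟨r, h, h'⟩
    rw [← ins_single_self] at h'
    obtain ⟨rfl, rfl⟩ := ins_inj h'
    exact ⟨rfl, h⟩
  · rintro ⟨rfl, h⟩
    exact ⟨[b], h, ins_single_self c b⟩

theorem step_deref : Step c (sem I (.deref (.var c))) m u m' b ↔
    m' = m ∧ u = 1 ∧ b = .num m := by
  rw [sem, step_tick, step_relabel]
  constructor
  · rintro ⟨x, h, n, rfl, rfl⟩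
    obtain ⟨rfl, rfl, h⟩ := step_var_self.mp h
    exact ⟨(show n = m' from h).symm, rfl, rfl⟩
  · rintro ⟨rfl, rfl, rfl⟩
    exact ⟨.read _, step_var_self.mpr ⟨rfl, rfl, rfl⟩, _, rfl, rfl⟩

theorem step_seq {M N : Tm E} : Step c (sem I (.seq M N)) m u m' b ↔ ∃ u₁ u₂ k, u = u₁ * u₂ ∧
    Step c (sem I M) m u₁ k .star ∧ Step c (sem I N) k u₂ m' b := by
  rw [sem, step_tick, step_seq2]
  constructor
  · rintro ⟨u₁, u₂, k, _, _, h, h1, h2, rfl, rfl⟩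
    exact ⟨u₁, u₂, k, h, h1, h2⟩
  · rintro ⟨u₁, u₂, k, h, h1, h2⟩
    exact ⟨u₁, u₂, k, _, _, h, h1, h2, rfl, rfl⟩

theorem step_arith {o : Op E} {M N : Tm E} {p q : ℕ}
    (hM : ∀ u m' b, Step c (sem I M) m u m' b ↔ m' = m ∧ u = 1 ∧ b = .num p)
    (hN : ∀ u m' b, Step c (sem I N) m u m' b ↔ m' = m ∧ u = 1 ∧ b = .num q) :
    Step c (sem I (.arith o M N)) m u m' b ↔
      m' = m ∧ u = 1 ∧ b = .num (o.apply I p q) := by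
  rw [sem, step_tick, step_seq2]
  constructor
  · rintro ⟨u₁, u₂, k, _, _, rfl, h1, h2, p', q', rfl, rfl, rfl⟩
    obtain ⟨rfl, rfl, e1⟩ := (hM _ _ _).mp h1
    obtain ⟨rfl, rfl, e2⟩ := (hN _ _ _).mp h2
    obtain rfl := Ev.num.inj e1
    obtain rfl := Ev.num.inj e2
    exact ⟨rfl, mul_one 1, rfl⟩
  · rintro ⟨rfl, rfl, rfl⟩
    exact ⟨1, 1, _, _, _, (mul_one 1).symm, (hM _ _ _).mpr ⟨rfl, rfl, rfl⟩,
      (hN _ _ _).mpr ⟨rfl, rfl, rfl⟩, p, q, rfl, rfl, rfl⟩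

theorem step_ifzero {M N₁ N₂ : Tm E} {p : ℕ}
    (hM : ∀ u m' b, Step c (sem I M) m u m' b ↔ m' = m ∧ u = 1 ∧ b = .num p) :
    Step c (sem I (.ifzero M N₁ N₂)) m u m' b ↔
      p = 0 ∧ Step c (sem I N₁) m u m' b ∨ p ≠ 0 ∧ Step c (sem I N₂) m u m' b := by
  rw [sem, step_tick, step_union, step_seq2, step_seq2]
  refine or_congr ?_ ?_
  · constructor
    · rintro ⟨u₁, u₂, k, _, _, rfl, h1, h2, rfl, rfl⟩
      obtain ⟨rfl, rfl, e1⟩ := (hM _ _ _).mp h1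
      rw [one_mul]
      exact ⟨(Ev.num.inj e1).symm, h2⟩
    · rintro ⟨rfl, h⟩
      exact ⟨1, u, m, _, _, (one_mul u).symm, (hM _ _ _).mpr ⟨rfl, rfl, rfl⟩, h, rfl, rfl⟩
  · constructor
    · rintro ⟨u₁, u₂, k, _, _, rfl, h1, h2, q, hq, rfl, rfl⟩
      obtain ⟨rfl, rfl, e1⟩ := (hM _ _ _).mp h1
      rw [one_mul]
      exact ⟨Ev.num.inj e1 ▸ hq, h2⟩
    · rintro ⟨hp, h⟩
      exact ⟨1, u, m, _, _, (one_mul u).symm, (hM _ _ _).mpr ⟨rfl, rfl, rfl⟩, h, p, hp, rfl, rfl⟩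

/-! ### Auxiliary programs -/

/-- A diverging command. -/
def diverge : Tm E := .loop (.num 0) .skip

/-- A diverging expression. -/
def divergeNat : Tm E := .seq diverge (.num 0)

theorem not_E_diverge {s : Trace} : ¬ Rel.E (sem I diverge) s b := by
  rw [diverge, sem, E_tick, E_seq2]
  rintro ⟨s₁, s₂, _, _, rfl, -, h, n, hn, rfl, -⟩
  exact hn (Ev.num.inj (E_leaf.mp h).2)

theorem not_step_diverge : ¬ Step c (sem I diverge) m u m' b :=
  fun ⟨_, _, h⟩ => not_E_diverge h

theorem not_step_divergeNat : ¬ Step c (sem I divergeNat) m u m' b := by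
  intro h
  obtain ⟨_, _, _, -, h, -⟩ := step_seq.mp h
  exact not_step_diverge h

/-- Check that the variable `x` contains `k`. -/
def isEq (x k : ℕ) : Tm E :=
  .ifzero (.arith .add (.arith .sub (.deref (.var x)) (.num k))
    (.arith .sub (.num k) (.deref (.var x)))) .skip diverge

theorem step_isEq {k : ℕ} :
    Step c (sem I (isEq c k)) m u m' b ↔ m = k ∧ m' = m ∧ u = 1 ∧ b = .star := by
  -- With truncated subtraction, `(m - k) + (k - m)` vanishes exactly when `m = k`.
  rw [isEq, step_ifzero (p := (m - k) + (k - m)) fun _ _ _ => step_arith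
    (fun _ _ _ => step_arith (fun _ _ _ => step_deref) fun _ _ _ => step_num)
    (fun _ _ _ => step_arith (fun _ _ _ => step_num) fun _ _ _ => step_deref)]
  rw [or_iff_left fun h => not_step_diverge h.2]
  exact and_congr (by omega) step_leaf

/-- Increment the variable `x`. -/
def incr (x : ℕ) : Tm E := .assign (.var x) (.arith .add (.deref (.var x)) (.num 1))

theorem step_incr : Step c (sem I (incr c)) m u m' b ↔ m' = m + 1 ∧ u = 1 ∧ b = .star := by
  have ha : ∀ u m' b, Step c (sem I (.arith .add (.deref (.var c)) (.num 1))) m u m' b ↔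
      m' = m ∧ u = 1 ∧ b = .num (m + 1) :=
    fun _ _ _ => step_arith (fun _ _ _ => step_deref) fun _ _ _ => step_num
  rw [incr, sem, step_tick, step_seq2]
  constructor
  · rintro ⟨u₁, u₂, k, _, _, rfl, h1, h2, n, rfl, rfl, rfl⟩
    obtain ⟨rfl, rfl, e1⟩ := (ha _ _ _).mp h1
    obtain ⟨rfl, e2⟩ := step_var_self.mp h2
    obtain rfl := Ev.num.inj e1
    exact ⟨(show _ = m' from e2).symm, mul_one 1, rfl⟩
  · rintro ⟨rfl, rfl, rfl⟩
    exact ⟨1, 1, m, _, _, (mul_one 1).symm, (ha _ _ _).mpr ⟨rfl, rfl, rfl⟩,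
      (step_var_self (b := .write (m + 1))).mpr ⟨rfl, rfl⟩, m + 1, rfl, rfl, rfl⟩

/-- Choose one of the terms according to the content of `x` (at least `i`). -/
def select (x : ℕ) (D : Tm E) : ℕ → List (Tm E) → Tm E
  | _, [] => D
  | i, M :: Ms => .ifzero (.arith .sub (.deref (.var x)) (.num i)) M (select x D (i + 1) Ms)

/-- Since `i ≤ m`, the truncated difference `m - i` is zero only at the head of the list; otherwise
the search continues with `i + 1 ≤ m`. -/
theorem step_select {D : Tm E} (hD : ∀ m u m' b, ¬ Step c (sem I D) m u m' b) {i : ℕ}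
    {Ms : List (Tm E)} (hi : i ≤ m) : Step c (sem I (select c D i Ms)) m u m' b ↔
      ∃ M, Ms[m - i]? = some M ∧ Step c (sem I M) m u m' b := by
  induction Ms generalizing i with
  | nil => simp [select, hD]
  | cons M Ms ih =>
    rw [select, step_ifzero (p := m - i) fun _ _ _ =>
      step_arith (fun _ _ _ => step_deref) fun _ _ _ => step_num]
    rcases hi.eq_or_lt with rfl | h
    · simp
    · have h' : m - i = (m - (i + 1)) + 1 := by omega
      rw [ih h, h', List.getElem?_cons_succ]
      simp

theorem step_select_map {X : Type} {D : Tm E} (hD : ∀ m u m' b, ¬ Step c (sem I D) m u m' b)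
    {l : List X} {f : X → Tm E} : Step c (sem I (select c D 0 (l.map f))) m u m' b ↔
      ∃ p, l[m]? = some p ∧ Step c (sem I (f p)) m u m' b := by
  rw [step_select hD (Nat.zero_le _), Nat.sub_zero, List.getElem?_map]
  simp only [Option.map_eq_some_iff]
  constructor
  · rintro ⟨_, ⟨p, h, rfl⟩, h'⟩
    exact ⟨p, h, h'⟩
  · rintro ⟨p, h, h'⟩
    exact ⟨_, ⟨p, h, rfl⟩, h'⟩

end

-- Programs that recognise and generate events

/-- Successive tests, given the tests for single events. -/
def allTests {X : Type} (t : X → Tm E → Tm E) (w : List X) (Q : Tm E) : Tm E :=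
  w.foldr (fun a M => .seq (t a Q) M) .skip

/-- The command that succeeds iff the value of `Q` is `n`. -/
def testNat (n : ℕ) (Q : Tm E) : Tm E :=
  .local_ (.seq (.assign (.var 0) (Q.rename (sh 0))) (isEq 0 n))

mutual

/-- The command that succeeds iff `Q` has the given event. -/
def test : (A : Ty) → Event A → Tm E → Tm E
  | .nat, n, Q => testNat n Q
  | .comm, _, Q => Q
  | .var, .read n, Q => testNat n (.deref Q)
  | .var, .write n, Q => .assign Q (.num n)
  | .fn A B, p, Q => .local_ (.seq
      (test B p.2 (.app (Q.rename (sh 0)) (produce A 0 (p.1.toList.map fun a => (.skip, a)))))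
      -- Without this check a function that uses only a proper prefix of the arguments would pass.
      (isEq 0 p.1.toList.length))

/-- The term whose `i`-th use, counted in the variable `c`, has the `i`-th of the given events,
and before that performs the command that comes with it. -/
def produce : (A : Ty) → ℕ → List (Tm E × Event A) → Tm E
  | .nat, c, l => select c divergeNat 0 (l.map fun p => .seq (incr c) (.seq p.1 (.num p.2)))
  | .comm, c, l => select c diverge 0 (l.map fun p => .seq (incr c) p.1)
  | .var, c, l => .mkvar
      (.lam .nat (select (c + 1) diverge 0 (l.map fun p =>
        .seq (incr (c + 1)) (.seq (p.1.rename (sh 0)) (match p.2 with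
          | .read _ => diverge
          | .write n => .seq (testNat n (.var 0)) .skip)))))
      (select c divergeNat 0 (l.map fun p =>
        .seq (incr c) (.seq p.1 (match p.2 with
          | .read n => .num n
          | .write _ => divergeNat))))
  -- The command attached to each event is extended by tests of the bound argument, so the recursion
  -- on the result type also checks the arguments.
  | .fn A B, c, l => .lam A (produce B (c + 1) (l.map fun p =>
      (.seq (p.1.rename (sh 0)) (allTests (test A) p.2.1.toList (.var 0)), p.2.2)))

end

/-! ### The semantics of tests and producers -/

section

variable {I : E → ℕ → ℕ → ℕ} {c m m' : ℕ} {u s : Trace} {b : Ev}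

theorem E_testNat {n : ℕ} {Q : Tm E} :
    Rel.E (sem I (testNat n Q)) s b ↔ b = .star ∧ Rel.E (sem I Q) s (.num n) := by
  rw [testNat, E_local]
  simp only [step_seq, step_isEq]
  have ha : ∀ m u, Step 0 (sem I (.assign (.var 0) (Q.rename (sh 0)))) 0 u m .star ↔
      Rel.E (sem I Q) u (.num m) := by
    intro m u
    rw [sem, step_tick, step_seq2, sem_rename]
    constructor
    · rintro ⟨u₁, u₂, k, _, _, rfl, h1, h2, n, rfl, rfl, -⟩
      obtain ⟨rfl, h1⟩ := step_shift.mp h1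
      obtain ⟨rfl, e2⟩ := step_var_self.mp h2
      obtain rfl : n = m := e2
      rwa [mul_one]
    · intro h
      exact ⟨u, 1, 0, _, _, (mul_one u).symm, step_shift.mpr ⟨rfl, h⟩,
        (step_var_self (b := .write m)).mpr ⟨rfl, rfl⟩, m, rfl, rfl, rfl⟩
  constructor
  · rintro ⟨m, u₁, u₂, k, rfl, h1, rfl, rfl, rfl, rfl⟩
    rw [mul_one]
    exact ⟨rfl, (ha _ _).mp h1⟩
  · rintro ⟨rfl, h⟩
    exact ⟨n, s, 1, n, (mul_one s).symm, (ha _ _).mpr h, rfl, rfl, rfl, rfl⟩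

theorem single_zero_eq (b : Ev) : single 0 b = scons [b] 1 := by
  funext y
  cases y <;> simp [single, scons, word_one]

/-- The command `M` has the only trace `ins c [] S`. -/
def Det (I : E → ℕ → ℕ → ℕ) (c : ℕ) (M : Tm E) (S : Trace) : Prop :=
  ∀ s b, Rel.E (sem I M) s b ↔ b = .star ∧ s = ins c [] S

theorem Det.step {M : Tm E} {S : Trace} (h : Det I c M S) :
    Step c (sem I M) m u m' b ↔ m' = m ∧ u = S ∧ b = .star := by
  constructor
  · rintro ⟨r, h1, h2⟩
    obtain ⟨rfl, h3⟩ := (h _ _).mp h2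
    obtain ⟨rfl, rfl⟩ := ins_inj h3
    exact ⟨(show m = m' from h1).symm, rfl, rfl⟩
  · rintro ⟨rfl, rfl, rfl⟩
    exact ⟨[], rfl, (h _ _).mpr ⟨rfl, rfl⟩⟩

/-- The common opening of all producers: count the use, then perform the attached command, which
contributes exactly `S` and leaves the counter alone. -/
theorem Det.step_incr_seq {M N : Tm E} {S : Trace} (h : Det I c M S) :
    Step c (sem I (.seq (incr c) (.seq M N))) m u m' b ↔
      ∃ u', u = S * u' ∧ Step c (sem I N) (m + 1) u' m' b := by
  simp only [step_seq, step_incr, h.step, and_true]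
  constructor
  · rintro ⟨u₁, _, k, rfl, ⟨rfl, rfl⟩, _, u₂, k, rfl, ⟨rfl, rfl⟩, h'⟩
    exact ⟨u₂, one_mul _, h'⟩
  · rintro ⟨u', rfl, h⟩
    exact ⟨1, _, m + 1, (one_mul _).symm, ⟨rfl, rfl⟩, S, u', m + 1, rfl, ⟨rfl, rfl⟩, h⟩

/-- The shifted command avoids the new identifier and `N` uses nothing else, so the composite is
again deterministic. This feeds the producer at function types. -/
theorem Det.seq_rename {M N : Tm E} {S : Trace} (h : Det I c M S) {w : List Ev}
    (hN : ∀ s b, Rel.E (sem I N) s b ↔ b = .star ∧ s = scons w 1) :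
    Det I (c + 1) (.seq (M.rename (sh 0)) N) (scons w S) := by
  intro s b
  have hM : ∀ s, Rel.E (shift 0 (sem I M)) s .star ↔ s = scons [] (ins c [] S) := by
    intro s
    constructor
    · rintro ⟨n, h1, h2⟩
      have h3 := ((h _ _).mp ⟨n, h2⟩).2
      rw [← ins_zero, ← h3, ← h1, ins_eta]
    · rintro rfl
      obtain ⟨n, hn⟩ := (h _ _).mpr ⟨rfl, rfl⟩
      exact ⟨n, rfl, by rwa [← ins_zero, ins_comp_sh]⟩
  rw [E_seq, sem_rename, ins_scons]
  simp only [hM, hN]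
  constructor
  · rintro ⟨_, _, rfl, rfl, rfl, rfl⟩
    refine ⟨rfl, ?_⟩
    rw [← scons_mul, mul_one, List.nil_append]
  · rintro ⟨rfl, rfl⟩
    refine ⟨_, _, ?_, rfl, rfl, rfl⟩
    rw [← scons_mul, mul_one, List.nil_append]

theorem Det.rename {M : Tm E} {S : Trace} (h : Det I c M S) :
    Det I (c + 1) (M.rename (sh 0)) (scons [] S) := by
  intro s b
  rw [sem_rename, ins_scons]
  constructor
  · rintro ⟨n, h1, h2⟩
    obtain ⟨rfl, h3⟩ := (h _ _).mp ⟨n, h2⟩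
    refine ⟨rfl, ?_⟩
    rw [← ins_zero, ← h3, ← h1, ins_eta]
  · rintro ⟨rfl, rfl⟩
    obtain ⟨n, hn⟩ := (h _ _).mpr ⟨rfl, rfl⟩
    exact ⟨n, rfl, by rwa [← ins_zero, ins_comp_sh]⟩

/-- Each test contributes one letter at the tested identifier, so in sequence they force the whole
word. Knowing the tests at `.star` is enough, and the final `skip` fixes the observation. -/
theorem E_allTests {A : Ty}
    (h : ∀ (a : Event A) (Q : Tm E) s,
      Rel.E (sem I (test A a Q)) s .star ↔ Rel.E (sem I Q) s (emb A a))
    (w : List (Event A)) : Rel.E (sem I (allTests (test A) w (.var 0))) s b ↔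
      b = .star ∧ s = scons (w.map (emb A)) 1 := by
  induction w generalizing s with
  | nil =>
    rw [allTests, List.foldr_nil, sem, E_leaf, List.map_nil, scons_one]
    exact and_comm
  | cons a w ih =>
    have hc : scons (emb A a :: w.map (emb A)) (1 : Trace) =
        scons [emb A a] 1 * scons (w.map (emb A)) 1 := by
      rw [← scons_mul, mul_one]
      rfl
    rw [allTests, List.foldr_cons, E_seq, List.map_cons, hc]
    change (∃ s₁ s₂, s = s₁ * s₂ ∧ _ ∧ Rel.E (sem I (allTests (test A) w (.var 0))) s₂ b) ↔ _
    simp only [h, ih, E_var, single_zero_eq]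
    constructor
    · rintro ⟨_, _, rfl, rfl, rfl, rfl⟩
      exact ⟨rfl, rfl⟩
    · rintro ⟨rfl, rfl⟩
      exact ⟨_, _, rfl, rfl, rfl, rfl⟩

/-- The specification of `produce`. -/
def Produces (I : E → ℕ → ℕ → ℕ) (A : Ty) : Prop :=
  ∀ (c : ℕ) (l : List (Tm E × Event A)) (S : ℕ → Trace),
    (∀ i p, l[i]? = some p → Det I c p.1 (S i)) → ∀ m u m' b,
    (Step c (sem I (produce A c l)) m u m' b ↔
      m' = m + 1 ∧ ∃ p, l[m]? = some p ∧ u = S m ∧ b = emb A p.2)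

theorem produces_nat : Produces I .nat := by
  intro c l S hl m u m' b
  rw [produce, step_select_map fun _ _ _ _ => not_step_divergeNat]
  constructor
  · rintro ⟨p, hp, h⟩
    obtain ⟨u', rfl, h'⟩ := (hl m p hp).step_incr_seq.mp h
    obtain ⟨rfl, rfl, rfl⟩ := step_num.mp h'
    exact ⟨rfl, p, hp, mul_one _, rfl⟩
  · rintro ⟨rfl, p, hp, rfl, rfl⟩
    exact ⟨p, hp, (hl m p hp).step_incr_seq.mpr
      ⟨1, (mul_one _).symm, step_num.mpr ⟨rfl, rfl, rfl⟩⟩⟩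

theorem produces_comm : Produces I .comm := by
  intro c l S hl m u m' b
  rw [produce, step_select_map fun _ _ _ _ => not_step_diverge]
  simp only [step_seq, step_incr]
  constructor
  · rintro ⟨p, hp, u₁, u₂, k, rfl, ⟨rfl, rfl, -⟩, h⟩
    obtain ⟨rfl, rfl, rfl⟩ := (hl m p hp).step.mp h
    exact ⟨rfl, p, hp, one_mul _, rfl⟩
  · rintro ⟨rfl, p, hp, rfl, rfl⟩
    exact ⟨p, hp, 1, S m, m + 1, (one_mul _).symm, ⟨rfl, rfl, trivial⟩,
      (hl m p hp).step.mpr ⟨rfl, rfl, rfl⟩⟩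

theorem produces_var : Produces I .var := by
  intro c l S hl m u m' b
  have htest : ∀ {n v m m'} {b : Ev},
      Step (c + 1) (sem I (.seq (testNat n (.var 0)) .skip)) m v m' b ↔
        m' = m ∧ v = scons [.num n] 1 ∧ b = .star := by
    intro n v m m' b
    refine Det.step fun s b => ?_
    rw [E_seq, ins_scons, ins_one, ← single_zero_eq]
    simp only [E_testNat, E_var]
    constructor
    · rintro ⟨_, s₂, rfl, ⟨-, rfl⟩, h⟩
      obtain ⟨rfl, rfl⟩ := E_leaf.mp h
      exact ⟨rfl, mul_one _⟩
    · rintro ⟨rfl, rfl⟩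
      exact ⟨_, 1, (mul_one _).symm, ⟨trivial, rfl⟩, E_leaf.mpr ⟨rfl, rfl⟩⟩
  rw [produce, sem, step_tick, step_union, step_relabel, step_relabel]
  constructor
  · rintro (⟨_, h, n, k, rfl, rfl⟩ | ⟨_, h, n, rfl, rfl⟩)
    · rw [sem, step_tick, step_under] at h
      obtain ⟨w, x, ⟨-, hx⟩, h⟩ := h
      obtain ⟨rfl, rfl⟩ := Ev.fn.inj hx
      obtain ⟨⟨M, e⟩, hp, h⟩ := (step_select_map fun _ _ _ _ => not_step_diverge).mp h
      obtain ⟨u', hu, h⟩ := (hl m _ hp).rename.step_incr_seq.mp h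
      cases e with
      | read n => exact (not_step_diverge h).elim
      | write n' =>
        obtain ⟨rfl, rfl, -⟩ := htest.mp h
        rw [← scons_mul, mul_one, List.nil_append] at hu
        obtain ⟨hw, rfl⟩ := scons_inj hu
        -- The body tests its argument exactly once, so the constant word is a singleton, and its
        -- letter determines the number written.
        have hn : n = n' := by
          have := List.mem_singleton_self (Ev.num n')
          rw [← hw] at this
          exact (Ev.num.inj (List.eq_of_mem_replicate this)).symm
        subst hn
        exact ⟨rfl, _, hp, rfl, rfl⟩
    · obtain ⟨⟨M, e⟩, hp, h⟩ := (step_select_map fun _ _ _ _ => not_step_divergeNat).mp h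
      obtain ⟨u', rfl, h'⟩ := (hl m _ hp).step_incr_seq.mp h
      cases e with
      | read n' =>
        obtain ⟨rfl, rfl, hn⟩ := step_num.mp h'
        obtain rfl := Ev.num.inj hn
        exact ⟨rfl, _, hp, mul_one _, rfl⟩
      | write n' => exact (not_step_divergeNat h').elim
  · rintro ⟨rfl, ⟨M, n | n⟩, hp, rfl, rfl⟩
    · refine .inr ⟨.num n, ?_, n, rfl, rfl⟩
      exact (step_select_map fun _ _ _ _ => not_step_divergeNat).mpr ⟨_, hp,
        (hl m _ hp).step_incr_seq.mpr ⟨1, (mul_one _).symm, step_num.mpr ⟨rfl, rfl, rfl⟩⟩⟩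
    · refine .inl ⟨.fn [.num n] .star, ?_, n, 1, rfl, rfl⟩
      rw [sem, step_tick, step_under]
      refine ⟨[.num n], .star, ⟨fun a ha => ⟨n, List.mem_singleton.mp ha⟩, rfl⟩, ?_⟩
      refine (step_select_map fun _ _ _ _ => not_step_diverge).mpr ⟨_, hp,
        (hl m _ hp).rename.step_incr_seq.mpr ⟨_, ?_, htest.mpr ⟨rfl, rfl, rfl⟩⟩⟩
      rw [← scons_mul, mul_one, List.nil_append]

theorem produces_fn {A B : Ty}
    (hA : ∀ (a : Event A) (Q : Tm E) s,
      Rel.E (sem I (test A a Q)) s .star ↔ Rel.E (sem I Q) s (emb A a))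
    (hB : Produces I B) : Produces I (.fn A B) := by
  intro c l S hl m u m' b
  -- The expected trace of the extended command adds the argument word at the bound identifier. The
  -- value beyond the list is never used.
  let S' : ℕ → Trace := fun i => match l[i]? with
    | some p => scons (embW A p.2.1) (S i)
    | none => 1
  have hS : ∀ {i p}, l[i]? = some p → S' i = scons (embW A p.2.1) (S i) := by
    intro i p hp
    simp only [S', hp]
  have hB' := hB (c + 1) (l.map fun p =>
      (.seq (p.1.rename (sh 0)) (allTests (test A) p.2.1.toList (.var 0)), p.2.2)) S' (by
    intro i q hq
    rw [List.getElem?_map, Option.map_eq_some_iff] at hq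
    obtain ⟨p, hp, rfl⟩ := hq
    rw [hS hp]
    exact (hl i p hp).seq_rename fun s b => E_allTests hA _)
  rw [produce, sem, step_tick, step_under]
  simp only [hB', List.getElem?_map, Option.map_eq_some_iff]
  constructor
  · rintro ⟨w, x, ⟨-, rfl⟩, rfl, _, ⟨p, hp, rfl⟩, hu, rfl⟩
    rw [hS hp] at hu
    obtain ⟨rfl, rfl⟩ := scons_inj hu
    exact ⟨rfl, p, hp, rfl, rfl⟩
  · rintro ⟨rfl, p, hp, rfl, rfl⟩
    exact ⟨embW A p.2.1, emb B p.2.2, ⟨typed_iff.mpr ⟨_, rfl⟩, rfl⟩, rfl, _, ⟨p, hp, rfl⟩,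
      (hS hp).symm, rfl⟩

/-- Successive uses move the counter from `m` to `m'` and deliver the segment of the list in
between. The alternative `m = m'` covers the empty word when `m` is already past the end. -/
theorem Produces.words {A : Ty} (h : Produces I A) (l : List (Event A)) {w : List Ev} :
    Step 0 (Rel.words (sem I (produce A 0 (l.map fun a => (.skip, a))))) m u m' w ↔
      u = 1 ∧ m' = m + w.length ∧ (m = m' ∨ m' ≤ l.length) ∧
        w = (l.drop m |>.take (m' - m)).map (emb A) := by
  have h1 : ∀ m u m' b, Step 0 (sem I (produce A 0 (l.map fun a => (.skip, a)))) m u m' b ↔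
      m' = m + 1 ∧ u = 1 ∧ ∃ a, l[m]? = some a ∧ b = emb A a := by
    intro m u m' b
    rw [h 0 (l.map fun a => (.skip, a)) (fun _ => 1)]
    · simp only [List.getElem?_map, Option.map_eq_some_iff]
      constructor
      · rintro ⟨rfl, _, ⟨a, h, rfl⟩, rfl, rfl⟩
        exact ⟨rfl, rfl, a, h, rfl⟩
      · rintro ⟨rfl, rfl, a, h, rfl⟩
        exact ⟨rfl, _, ⟨a, h, rfl⟩, rfl, rfl⟩
    · intro i p hp
      rw [List.getElem?_map, Option.map_eq_some_iff] at hp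
      obtain ⟨a, -, rfl⟩ := hp
      intro s b
      rw [sem, E_leaf, ins_one]
      exact and_comm
  induction w generalizing m u with
  | nil =>
    rw [step_words_nil]
    constructor
    · rintro ⟨rfl, rfl⟩
      simp
    · rintro ⟨rfl, h, -, -⟩
      exact ⟨h, rfl⟩
  | cons b w ih =>
    rw [step_words_cons]
    simp only [h1, ih]
    constructor
    · rintro ⟨_, _, _, rfl, ⟨rfl, rfl, a, ha, rfl⟩, rfl, hm, hm', hw⟩
      obtain ⟨hlt, rfl⟩ := List.getElem?_eq_some_iff.mp ha
      refine ⟨mul_one _, by simp only [List.length_cons]; omega, .inr (by omega), ?_⟩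
      rw [List.drop_eq_getElem_cons hlt, show m' - m = m' - (m + 1) + 1 by omega,
        List.take_succ_cons, List.map_cons, ← hw]
    · rintro ⟨rfl, hm, hm', hw⟩
      rw [List.length_cons] at hm
      have hlt : m < l.length := by omega
      rw [List.drop_eq_getElem_cons hlt, show m' - m = m' - (m + 1) + 1 by omega,
        List.take_succ_cons, List.map_cons] at hw
      obtain ⟨rfl, hw'⟩ := List.cons.inj hw
      exact ⟨1, 1, m + 1, (mul_one _).symm, ⟨rfl, rfl, _, List.getElem?_eq_getElem hlt, rfl⟩,
        rfl, by omega, by omega, hw'⟩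

/-- At a function type the test needs a producer for the argument and the producer needs a test for
it, so both statements go through one induction. `Q` may be open, as it must be when the argument of
an abstraction is tested. -/
theorem test_produce (A : Ty) : (∀ (a : Event A) (Q : Tm E) s,
    Rel.E (sem I (test A a Q)) s .star ↔ Rel.E (sem I Q) s (emb A a)) ∧ Produces I A := by
  induction A with
  | nat =>
    refine ⟨fun a Q s => ?_, produces_nat⟩
    rw [test]
    exact E_testNat.trans (and_iff_right rfl)
  | comm => exact ⟨fun a Q s => by rw [test]; exact Iff.rfl, produces_comm⟩
  | var =>
    refine ⟨fun a Q s => ?_, produces_var⟩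
    cases a with
    | read n =>
      rw [test, E_testNat, sem, E_tick, E_relabel]
      constructor
      · rintro ⟨-, _, h, k, rfl, h'⟩
        obtain rfl := Ev.num.inj h'
        exact h
      · intro h
        exact ⟨rfl, _, h, n, rfl, rfl⟩
    | write n =>
      rw [test, sem, E_tick, E_seq2]
      constructor
      · rintro ⟨s₁, s₂, _, _, rfl, h1, h2, k, rfl, rfl, -⟩
        obtain ⟨rfl, hk⟩ := E_leaf.mp h1
        obtain rfl := Ev.num.inj hk
        rwa [one_mul]
      · intro h
        exact ⟨1, s, _, _, (one_mul s).symm, E_leaf.mpr ⟨rfl, rfl⟩, h, n, rfl, rfl, rfl⟩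
  | fn A B ihA ihB =>
    refine ⟨?_, produces_fn ihA.1 ihB.2⟩
    intro p Q s
    rw [test, E_local]
    obtain ⟨v, e⟩ : Obj A × Event B := p
    simp only [step_seq, step_isEq]
    -- A run that ends with counter `m` shows that `Q` has used exactly the first `m` of the
    -- prepared arguments; the check on the counter then forces all of them.
    have ha : ∀ u m, Step 0 (sem I (test B e (.app (Q.rename (sh 0))
        (produce A 0 (v.toList.map fun a => (.skip, a)))))) 0 u m .star ↔
        ∃ w, Rel.E (sem I Q) u (.fn w (emb B e)) ∧
          m = w.length ∧ m ≤ v.toList.length ∧ w = (v.toList.take m).map (emb A) := by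
      intro u m
      have : Step 0 (sem I (test B e (.app (Q.rename (sh 0))
          (produce A 0 (v.toList.map fun a => (.skip, a)))))) 0 u m .star ↔
          Step 0 (sem I (.app (Q.rename (sh 0))
            (produce A 0 (v.toList.map fun a => (.skip, a))))) 0 u m (emb B e) :=
        exists_congr fun r => and_congr_right fun _ => ihB.1 _ _ _
      rw [this, sem, sem_rename, step_tick, step_seq2]
      simp only [step_shift, ihA.2.words]
      constructor
      · rintro ⟨u₁, u₂, k, _, w, rfl, ⟨rfl, h⟩, ⟨rfl, h1, h2, h3⟩, rfl⟩
        rw [mul_one]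
        exact ⟨w, h, by omega, by omega, h3⟩
      · rintro ⟨w, h, h1, h2, h3⟩
        exact ⟨u, 1, 0, _, w, (mul_one u).symm, ⟨rfl, h⟩, ⟨rfl, by omega, .inr h2, h3⟩, rfl⟩
    simp only [ha]
    constructor
    · rintro ⟨m, u₁, u₂, k, rfl, ⟨w, h, -, -, h1⟩, rfl, rfl, rfl, -⟩
      rw [List.take_length] at h1
      subst h1
      rw [mul_one]
      exact h
    · intro h
      refine ⟨v.toList.length, s, 1, v.toList.length, (mul_one s).symm,
        ⟨embW A v, h, ?_, le_rfl, ?_⟩, rfl, rfl, rfl, trivial⟩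
      · exact (List.length_map _).symm
      · rw [List.take_length]
        rfl

end

/-! ### Typing of tests and producers -/

theorem WT.diverge (T : ℕ → Ty) : WT T (diverge : Tm E) .comm := .loop (.num _ _) (.skip _)

theorem WT.divergeNat (T : ℕ → Ty) : WT T (divergeNat : Tm E) .nat :=
  .seq (.inr (.inl rfl)) (.diverge T) (.num _ _)

theorem WT.var_of_eq {T : ℕ → Ty} {x : ℕ} {A : Ty} (h : T x = A) : WT T (.var x : Tm E) A :=
  h ▸ .var T x

theorem WT.isEq {T : ℕ → Ty} {x : ℕ} (h : T x = .var) (k : ℕ) :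
    WT T (isEq x k : Tm E) .comm :=
  .ifzero (.inl rfl) (.arith _ (.arith _ (.deref (.var_of_eq h)) (.num _ _))
    (.arith _ (.num _ _) (.deref (.var_of_eq h)))) (.skip _) (.diverge _)

theorem WT.incr {T : ℕ → Ty} {x : ℕ} (h : T x = .var) : WT T (incr x : Tm E) .comm :=
  .assign (.var_of_eq h) (.arith _ (.deref (.var_of_eq h)) (.num _ _))

theorem WT.select {T : ℕ → Ty} {x : ℕ} {D : Tm E} {B : Ty} (h : T x = .var)
    (hB : B = .comm ∨ B = .nat ∨ B = .var) (hD : WT T D B) {l : List (Tm E)}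
    (hl : ∀ M ∈ l, WT T M B) (i : ℕ) : WT T (select x D i l) B := by
  induction l generalizing i with
  | nil => exact hD
  | cons M l ih =>
    exact .ifzero hB (.arith _ (.deref (.var_of_eq h)) (.num _ _)) (hl M List.mem_cons_self)
      (ih (fun N hN => hl N (List.mem_cons_of_mem _ hN)) _)

theorem WT.testNat {T : ℕ → Ty} {Q : Tm E} (h : WT T Q .nat) (n : ℕ) :
    WT T (testNat n Q) .comm :=
  .local_ (.inl rfl) (.seq (.inl rfl) (.assign (.var_of_eq rfl) (h.rename_sh _)) (.isEq rfl n))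

theorem WT.allTests {X : Type} {T : ℕ → Ty} {t : X → Tm E → Tm E} {Q : Tm E} (w : List X)
    (h : ∀ a, WT T (t a Q) .comm) : WT T (allTests t w Q) .comm := by
  induction w with
  | nil => exact .skip _
  | cons a w ih => exact .seq (.inl rfl) (h a) ih

theorem not_occ_diverge {x : ℕ} : ¬ Occ x (diverge : Tm E) := by simp [diverge, Occ]

theorem not_occ_divergeNat {x : ℕ} : ¬ Occ x (divergeNat : Tm E) := by
  simp [divergeNat, diverge, Occ]

theorem occ_isEq {x y k : ℕ} (h : Occ y (isEq x k : Tm E)) : y = x := by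
  simpa [isEq, diverge, Occ] using h

theorem occ_incr {x y : ℕ} (h : Occ y (incr x : Tm E)) : y = x := by
  simpa [incr, Occ] using h

theorem occ_select {x y i : ℕ} {D : Tm E} {l : List (Tm E)} (h : Occ y (select x D i l)) :
    y = x ∨ Occ y D ∨ ∃ M ∈ l, Occ y M := by
  induction l generalizing i with
  | nil => exact .inr (.inl h)
  | cons M l ih =>
    rcases h with h | h | h
    · exact .inl (by simpa [Occ] using h)
    · exact .inr (.inr ⟨M, List.mem_cons_self, h⟩)
    · rcases ih h with h | h | ⟨N, hN, h⟩
      · exact .inl h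
      · exact .inr (.inl h)
      · exact .inr (.inr ⟨N, List.mem_cons_of_mem _ hN, h⟩)

theorem occ_testNat {n y : ℕ} {Q : Tm E} (h : Occ y (testNat n Q)) : Occ y Q := by
  rcases h with (h | h) | h
  · cases h
  · obtain ⟨x, h, hx⟩ := occ_rename_sh.mp h
    rwa [Nat.succ_injective h]
  · cases occ_isEq h

theorem occ_allTests {X : Type} {t : X → Tm E → Tm E} {Q : Tm E} {y : ℕ}
    (ht : ∀ a, Occ y (t a Q) → Occ y Q) {w : List X} (h : Occ y (allTests t w Q)) : Occ y Q := by
  induction w with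
  | nil => cases h
  | cons a w ih => exact h.elim (ht a) ih

/-- Needed for typing: the test at a function type applies `Q` to a producer, and the two must share
no identifier. -/
theorem occ_test_produce (A : Ty) :
    (∀ (a : Event A) (Q : Tm E) y, Occ y (test A a Q) → Occ y Q) ∧
    ∀ c (l : List (Tm E × Event A)) y, Occ y (produce A c l) →
      y = c ∨ ∃ p ∈ l, Occ y p.1 := by
  induction A with
  | nat =>
    refine ⟨fun a Q y h => ?_, fun c l y h => ?_⟩
    · rw [test] at h
      exact occ_testNat h
    · rw [produce] at h
      rcases occ_select h with h | h | ⟨M, hM, h⟩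
      · exact .inl h
      · exact (not_occ_divergeNat h).elim
      · obtain ⟨p, hp, rfl⟩ := List.mem_map.mp hM
        rcases h with h | h | h
        · exact .inl (occ_incr h)
        · exact .inr ⟨p, hp, h⟩
        · cases h
  | comm =>
    refine ⟨fun a Q y h => ?_, fun c l y h => ?_⟩
    · rwa [test] at h
    · rw [produce] at h
      rcases occ_select h with h | h | ⟨M, hM, h⟩
      · exact .inl h
      · exact (not_occ_diverge h).elim
      · obtain ⟨p, hp, rfl⟩ := List.mem_map.mp hM
        exact h.imp occ_incr fun h => ⟨p, hp, h⟩
  | var =>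
    refine ⟨fun a Q y h => ?_, fun c l y h => ?_⟩
    · cases a with
      | read n =>
        rw [test] at h
        exact occ_testNat h
      | write n =>
        rw [test] at h
        exact h.elim id False.elim
    · rw [produce] at h
      rcases h with h | h
      · rcases occ_select h with h | h | ⟨M, hM, h⟩
        · exact .inl (Nat.succ_injective h)
        · exact (not_occ_diverge h).elim
        · obtain ⟨⟨N, e⟩, hp, rfl⟩ := List.mem_map.mp hM
          rcases h with h | h | h
          · exact .inl (Nat.succ_injective (occ_incr h))
          · obtain ⟨x, h, hx⟩ := occ_rename_sh.mp h
            rw [← Nat.succ_injective h] at hx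
            exact .inr ⟨_, hp, hx⟩
          · cases e with
            | read n => exact (not_occ_diverge h).elim
            | write n =>
              rcases h with h | h
              · cases occ_testNat h
              · cases h
      · rcases occ_select h with h | h | ⟨M, hM, h⟩
        · exact .inl h
        · exact (not_occ_divergeNat h).elim
        · obtain ⟨⟨N, e⟩, hp, rfl⟩ := List.mem_map.mp hM
          rcases h with h | h | h
          · exact .inl (occ_incr h)
          · exact .inr ⟨_, hp, h⟩
          · cases e with
            | read n => cases h
            | write n => exact (not_occ_divergeNat h).elim
  | fn A B ihA ihB =>
    refine ⟨fun p Q y h => ?_, fun c l y h => ?_⟩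
    · rw [test] at h
      rcases h with h | h
      · rcases ihB.1 _ _ _ h with h | h
        · obtain ⟨x, h, hx⟩ := occ_rename_sh.mp h
          rwa [Nat.succ_injective h]
        · rcases ihA.2 _ _ _ h with h | ⟨q, hq, h⟩
          · cases h
          · obtain ⟨a, -, rfl⟩ := List.mem_map.mp hq
            cases h
      · cases occ_isEq h
    · rw [produce] at h
      rcases ihB.2 _ _ _ h with h | ⟨q, hq, h⟩
      · exact .inl (Nat.succ_injective h)
      · obtain ⟨p, hp, rfl⟩ := List.mem_map.mp hq
        rcases h with h | h
        · obtain ⟨x, h, hx⟩ := occ_rename_sh.mp h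
          rw [← Nat.succ_injective h] at hx
          exact .inr ⟨p, hp, hx⟩
        · cases occ_allTests (fun a => ihA.1 a _ _) h

theorem wt_test_produce (A : Ty) :
    (∀ T (a : Event A) (Q : Tm E), WT T Q A → WT T (test A a Q) .comm) ∧
    ∀ (T : ℕ → Ty) c (l : List (Tm E × Event A)), T c = .var → (∀ p ∈ l, WT T p.1 .comm) →
      WT T (produce A c l) A := by
  have hn : Ty.nat = .comm ∨ Ty.nat = .nat ∨ Ty.nat = .var := .inr (.inl rfl)
  induction A with
  | nat =>
    refine ⟨fun T a Q h => ?_, fun T c l hc hl => ?_⟩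
    · rw [test]
      exact h.testNat a
    · rw [produce]
      refine .select hc hn (.divergeNat _) (fun M hM => ?_) _
      obtain ⟨p, hp, rfl⟩ := List.mem_map.mp hM
      exact .seq hn (.incr hc) (.seq hn (hl p hp) (.num _ _))
  | comm =>
    refine ⟨fun T a Q h => ?_, fun T c l hc hl => ?_⟩
    · rwa [test]
    · rw [produce]
      refine .select hc (.inl rfl) (.diverge _) (fun M hM => ?_) _
      obtain ⟨p, hp, rfl⟩ := List.mem_map.mp hM
      exact .seq (.inl rfl) (.incr hc) (hl p hp)
  | var =>
    refine ⟨fun T a Q h => ?_, fun T c l hc hl => ?_⟩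
    · cases a with
      | read n =>
        rw [test]
        exact h.deref.testNat n
      | write n =>
        rw [test]
        exact .assign h (.num _ _)
    · rw [produce]
      have hc' : scons Ty.nat T (c + 1) = .var := hc
      refine .mkvar (.lam (.select hc' (.inl rfl) (.diverge _) (fun M hM => ?_) _))
        (.select hc hn (.divergeNat _) (fun M hM => ?_) _)
      · obtain ⟨⟨N, e⟩, hp, rfl⟩ := List.mem_map.mp hM
        refine .seq (.inl rfl) (.incr hc') (.seq (.inl rfl) ((hl _ hp).rename_sh _) ?_)
        cases e with
        | read n => exact .diverge _
        | write n => exact .seq (.inl rfl) (.testNat (.var_of_eq rfl) n) (.skip _)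
      · obtain ⟨⟨N, e⟩, hp, rfl⟩ := List.mem_map.mp hM
        refine .seq hn (.incr hc) (.seq hn (hl _ hp) ?_)
        cases e with
        | read n => exact .num _ _
        | write n => exact .divergeNat _
  | fn A B ihA ihB =>
    refine ⟨fun T p Q h => ?_, fun T c l hc hl => ?_⟩
    · rw [test]
      refine .local_ (.inl rfl) (.seq (.inl rfl) (ihB.1 _ _ _ (.app (h.rename_sh _)
        (ihA.2 _ _ _ rfl ?_) ?_)) (.isEq rfl _))
      · intro q hq
        obtain ⟨a, -, rfl⟩ := List.mem_map.mp hq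
        exact .skip _
      -- The producer uses only the fresh counter, identifier `0`, which the renamed `Q` avoids.
      · intro x hx hx'
        obtain ⟨y, rfl, -⟩ := occ_rename_sh.mp hx
        rcases (occ_test_produce A).2 _ _ _ hx' with h | ⟨q, hq, h⟩
        · cases h
        · obtain ⟨a, -, rfl⟩ := List.mem_map.mp hq
          cases h
    · rw [produce]
      refine .lam (ihB.2 _ _ _ hc fun q hq => ?_)
      obtain ⟨p, hp, rfl⟩ := List.mem_map.mp hq
      exact .seq (.inl rfl) ((hl p hp).rename_sh _)
        (.allTests _ fun a => ihA.1 _ a _ (.var_of_eq rfl))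

/-! ## Full abstraction -/

/-- A term as a context without a hole. -/
def Tm.toContext : Tm E → Context E
  | .num n => .num n
  | .arith o M N => .arith o M.toContext N.toContext
  | .skip => .skip
  | .seq M N => .seq M.toContext N.toContext
  | .assign M N => .assign M.toContext N.toContext
  | .deref M => .deref M.toContext
  | .loop M N => .loop M.toContext N.toContext
  | .ifzero M N₁ N₂ => .ifzero M.toContext N₁.toContext N₂.toContext
  | .var x => .var x
  | .lam A M => .lam A M.toContext
  | .app M N => .app M.toContext N.toContext
  | .local_ M => .local_ M.toContext
  | .mkvar M N => .mkvar M.toContext N.toContext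

theorem Tm.plug_toContext (M P : Tm E) : M.toContext.plug P = M := by
  induction M with
  | _ => simp only [Tm.toContext, Context.plug, *]

/-- The context that checks for the event `a`. -/
def testContext (A : Ty) (a : Event A) : Context E :=
  .app (.lam A (test A a (.var 0)).toContext) .hole

theorem plug_testContext (A : Ty) (a : Event A) (M : Tm E) :
    (testContext A a).plug M = .app (.lam A (test A a (.var 0))) M := by
  simp only [testContext, Context.plug, Tm.plug_toContext]

theorem distinct_nil : Cx.Distinct [] := List.nodup_nil

theorem Deriv.not_occ {M : Tm E} {A : Ty} (d : Deriv [] M A) (x : ℕ) : ¬ Occ x M := fun h => by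
  simpa using d.occ distinct_nil h

theorem wt_testContext {M : Tm E} {A : Ty} (d : Deriv [] M A) (a : Event A) :
    WT tv ((testContext A a).plug M) .comm := by
  rw [plug_testContext]
  exact .app (.lam ((wt_test_produce A).1 _ a _ (.var_of_eq rfl)))
    (d.wt (by simp)).1 fun x _ => d.not_occ x

theorem hasType_testContext {M : Tm E} {A : Ty} (d : Deriv [] M A) (a : Event A) :
    HasType [] ((testContext A a).plug M) .comm := by
  refine (wt_testContext d a).hasType distinct_nil (by simp) fun x hx => ?_
  rw [plug_testContext] at hx
  rcases hx with hx | hx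
  · cases (occ_test_produce A).1 _ _ _ hx
  · exact (d.not_occ x hx).elim

theorem E_testContext (I : E → ℕ → ℕ → ℕ) {M : Tm E} {A : Ty} (a : Event A) :
    Rel.E (sem I ((testContext A a).plug M)) 1 .star ↔ Rel.E (sem I M) 1 (emb A a) := by
  rw [plug_testContext, sem, E_tick, E_seq2, sem]
  -- The test uses the bound identifier for exactly the one event `a`, so the hole is used once.
  have key : ∀ w : List Ev,
      Rel.E (sem I (test A a (.var 0))) (scons w 1) .star ↔ w = [emb A a] := by
    intro w
    rw [(test_produce A).1, E_var, single_zero_eq]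
    exact ⟨fun h => (scons_inj h).1, fun h => h ▸ rfl⟩
  simp only [E_tick, E_under]
  constructor
  · rintro ⟨s₁, s₂, _, w, hs, ⟨w', c, ⟨-, rfl⟩, h1⟩, h2, h3⟩
    obtain ⟨rfl, rfl⟩ := Ev.fn.inj h3
    obtain ⟨rfl, rfl⟩ := trace_mul_eq_one.mp hs.symm
    obtain rfl := (key _).mp h1
    obtain ⟨t₁, t₂, ht, h, h'⟩ := E_words_cons.mp h2
    obtain ⟨rfl, rfl⟩ := trace_mul_eq_one.mp ht.symm
    exact h
  · intro h
    exact ⟨1, 1, _, [emb A a], rfl,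
      ⟨_, _, ⟨fun b hb => tyEv_iff.mpr ⟨a, List.mem_singleton.mp hb⟩, rfl⟩, (key _).mpr rfl⟩,
      E_words_cons.mpr ⟨1, 1, rfl, h, E_words_nil.mpr rfl⟩, rfl⟩

theorem eval_testContext (I : E → ℕ → ℕ → ℕ) {M : Tm E} {A : Ty} (d : Deriv [] M A)
    (a : Event A) : Eval I [] ((testContext A a).plug M) [] .skip ↔
      Rel.E (sem I M) 1 (emb A a) := by
  rw [eval_skip_iff I (wt_testContext d a), E_testContext]

open scoped Pointwise in
-- Closed terms have only the empty trace, and maps out of a free monoid are determined on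
-- generators.
theorem den_eq_iff {M N : Tm E} {A : Ty} (I : E → ℕ → ℕ → ℕ) (dM : Deriv [] M A)
    (dN : Deriv [] N A) : den I dM = den I dN ↔ Rel.E (sem I M) = Rel.E (sem I N) := by
  have hM := den_matches I dM distinct_nil
  have hN := den_matches I dN distinct_nil
  constructor
  · intro h
    have key : ∀ {M N : Tm E} (dM : Deriv [] M A) (dN : Deriv [] N A),
        den I dM = den I dN → ∀ s b, Rel.E (sem I M) s b → Rel.E (sem I N) s b := by
      intro M N dM dN h s b hs
      obtain rfl : s = 1 := funext fun x => E_sem_support I hs (dM.not_occ x)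
      rw [← toTr_nil 1] at hs ⊢
      rw [den_matches I dM distinct_nil] at hs
      rw [den_matches I dN distinct_nil, ← h]
      exact hs
    funext s b
    exact propext ⟨key dM dN h s b, key dN dM h.symm s b⟩
  · intro h
    refine FreeMonoid.hom_eq fun e => Set.ext fun ρ => ?_
    rw [← hM.mem, ← hN.mem, h]

end SCI

theorem mainTheorem8 {E : Type} (I : E → ℕ → ℕ → ℕ) (A : SCI.Ty) (M N : SCI.Tm E)
    (dM : SCI.Deriv [] M A) (dN : SCI.Deriv [] N A) :
    SCI.den I dM = SCI.den I dN ↔ SCI.CtxEquiv I M N := by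
  rw [SCI.den_eq_iff]
  constructor
  -- At the program types the values are constants, so adequacy expresses evaluation through `sem`,
  -- which is equal for the two plugged contexts.
  · rintro h C B hB ⟨d⟩ ⟨d'⟩ V hV ⟨dV⟩
    have hC := SCI.plug_congr I h C
    have h1 := (d.wt (T := SCI.tv) (by simp)).1
    have h2 := (d'.wt (T := SCI.tv) (by simp)).1
    have h3 := (dV.wt (T := SCI.tv) (by simp)).1
    rcases hB with rfl | rfl
    · obtain rfl := hV.comm h3
      rw [SCI.eval_skip_iff I h1, SCI.eval_skip_iff I h2, hC]
    · obtain ⟨n, rfl⟩ := hV.nat h3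
      rw [SCI.eval_num_iff I h1, SCI.eval_num_iff I h2, hC]
  · intro h
    have key : ∀ {M N : SCI.Tm E} (dM : SCI.Deriv [] M A) (dN : SCI.Deriv [] N A),
        SCI.CtxEquiv I M N → ∀ s b, SCI.Rel.E (SCI.sem I M) s b → SCI.Rel.E (SCI.sem I N) s b := by
      intro M N dM dN h s b hs
      obtain rfl : s = 1 := funext fun x => SCI.E_sem_support I hs (dM.not_occ x)
      obtain ⟨n, hn⟩ := hs
      -- Typing shows that the observation is an event of type `A`, so there is a context that tests
      -- for it.
      obtain ⟨a, rfl⟩ := SCI.tyEv_iff.mp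
        ((dM.wt (T := SCI.tv) (by simp)).1.sound (SCI.tyTr_one _) hn)
      rw [← SCI.eval_testContext I dN]
      refine (h (SCI.testContext A a) .comm (.inl rfl) (SCI.hasType_testContext dM a)
        (SCI.hasType_testContext dN a) .skip .skip ⟨.skip⟩).mp ?_
      exact (SCI.eval_testContext I dM a).mpr ⟨n, hn⟩
    funext s b
    exact propext ⟨key dM dN h s b,
      key dN dM (fun C B hB h1 h2 V hV hT => (h C B hB h2 h1 V hV hT).symm) s b⟩
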